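/- Let $d\ge 3$ be an integer, $\lambda>0$, $\lambda_c=\lambda_c(d)=\frac{(d-1)^{d-1}}{(d-2)^d}$, $H(x)=-x\ln x-(1-x)\ln(1-x)$ (with $0\ln 0=0$), $\mathcal T=\{(\alpha,\beta):\alpha,\beta\ge 0,\ \alpha+\beta\le 1\}$, and for $(\alpha,\beta)\in\mathcal T$ $$\Phi_1(\alpha,\beta)=(\alpha+\beta)\ln\lambda+H(\alpha)+H(\beta)+d\Big[(1-\beta)H\Big(\tfrac{\alpha}{1-\beta}\Big)-H(\alpha)\Big],$$ where $(1-\beta)H(\frac{\alpha}{1-\beta})$ is read as $0$ at $(\alpha,\beta)=(0,1)$. Let $\mathbb T^d$ be the infinite $d$-regular tree. A probability measure $\mu$ on the independent sets of $\mathbb T^d$ is a (hard-core) Gibbs measure with activity $\lambda$ if for every finite subtree $T$, conditionally on all vertices of the outer boundary of $T$ being unoccupied, the restriction to $T$ equals each independent set $S$ of $T$ with probability $\lambda^{|S|}/\sum_{S'}\lambda^{|S'|}$, the sum being over the independent sets $S'$ of $T$. It is simple if for every vertex $v$, conditionally on either of the two possible values at $v$, the configurations on the $d$ subtrees rooted at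 the neighbours of $v$ are independent. It is translation-invariant if it is invariant under all automorphisms of $\mathbb T^d$, and semi-translation-invariant if it is invariant under all automorphisms preserving the two classes of even and odd vertices (determined by the parity of the distance to a fixed vertex). Then the following hold. 1. For every $\lambda>0$ there is a unique simple translation-invariant Gibbs measure with activity $\lambda$; if $p^*=p^*(\lambda)$ denotes the probability under it that any given vertex is occupied, then $(p^*,p^*)$ is the unique maximum point of $\Phi_1$ over $\{(\alpha,\beta)\in\mathcal T:\alpha=\beta\}$. 2. If $\lambda\le\lambda_c$, then $(p^*,p^*)$ is the unique maximum point of $\Phi_1$ over $\mathcal T$; it is also the only local maximum of $\Phi_1$ relative to $\mathcal T$. 3. If $\lambda>\lambda_c$, then $(p^*,p^*)$ is a saddle point of $\Phi_1$ (a stationary point that is neither a local maximum nor a local minimum), and there are $p_1<p^*<p_2$, $p_i=p_i(\lambda)$, such that the maximum points of $\Phi_1$ over $\mathcal T$ are exactly $(p_1,p_2)$ and $(p_2,p_1)$; these are also the only local maxima of $\Phi_1$ relative to $\mathcal T$. Moreover, there are exactly two simple semi-translation-invariant Gibbs measures with activity $\lambda$ that are not translation-invariant: under one of them even vertices are occupied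 with probability $p_1$ and odd vertices with probability $p_2$, and under the other one even vertices are occupied with probability $p_2$ and odd vertices with probability $p_1$. 4. The function $p^*$ is continuous in $\lambda$ on $(0,\infty)$, the functions $p_1$ and $p_2$ are continuous on $(\lambda_c,\infty)$, and $p_1-p^*\to 0$ and $p_2-p^*\to 0$ as $\lambda\downarrow\lambda_c$. -/

import Mathlib

open Set Filter Topology MeasureTheory ProbabilityTheory

noncomputable section

/-- The critical activity `(d-1)^(d-1) / (d-2)^d`. -/
def criticalActivity (d : ℕ) : ℝ :=
  ((d : ℝ) - 1) ^ (d - 1) / ((d : ℝ) - 2) ^ d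

/-- The triangle of admissible pairs of densities. -/
def triangle : Set (ℝ × ℝ) :=
  {q | 0 ≤ q.1 ∧ 0 ≤ q.2 ∧ q.1 + q.2 ≤ 1}

/-- `Ψ₁(α, β) = (1 - β) H(α / (1 - β)) - H(α)`, with `H` the entropy in natural logarithms. -/
def Psi1 (q : ℝ × ℝ) : ℝ :=
  (1 - q.2) * Real.binEntropy (q.1 / (1 - q.2)) - Real.binEntropy q.1

/-- The first-moment exponent `Φ₁`. -/
def Phi1 (d : ℕ) (lam : ℝ) (q : ℝ × ℝ) : ℝ :=
  (q.1 + q.2) * Real.log lam + Real.binEntropy q.1 + Real.binEntropy q.2 + d * Psi1 q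

/-- A saddle point: a stationary point that is neither a local maximum nor a local minimum. -/
def IsSaddle (f : ℝ × ℝ → ℝ) (q : ℝ × ℝ) : Prop :=
  HasFDerivAt f (0 : ℝ × ℝ →L[ℝ] ℝ) q ∧ ¬ IsLocalMax f q ∧ ¬ IsLocalMin f q

/-- The points of `s` at which `f` attains its (global) maximum over `s`. -/
def maximaOn (f : ℝ × ℝ → ℝ) (s : Set (ℝ × ℝ)) : Set (ℝ × ℝ) :=
  {q | q ∈ s ∧ IsMaxOn f s q}

/-- The points of `s` that are local maxima of `f` relative to `s`. -/
def localMaximaOn (f : ℝ × ℝ → ℝ) (s : Set (ℝ × ℝ)) : Set (ℝ × ℝ) :=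
  {q | q ∈ s ∧ IsLocalMaxOn f s q}

section HardCore

variable {V : Type*} (G : SimpleGraph V)

open Classical in
/-- The partition function of the hard-core model on the finite graph induced on `T`. -/
def partitionFunction (lam : ℝ) (T : Finset V) : ℝ :=
  ∑ S ∈ T.powerset.filter (fun S : Finset V => G.IsIndepSet (S : Set V)), lam ^ S.card

/-- The outer boundary of a set of vertices. -/
def outerBoundary (T : Set V) : Set V :=
  {v | v ∉ T ∧ ∃ u ∈ T, G.Adj u v}

/-- Configurations are sets of (occupied) vertices, with the product σ-algebra.
A Gibbs measure is a probability measure on independent sets such that, for every finite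
subtree `T`, conditioning on the outer boundary of `T` being unoccupied gives the hard-core
distribution with activity `lam` on the independent sets of `T`. -/
structure IsGibbs (lam : ℝ) (μ : Measure (Set V)) : Prop where
  isProbabilityMeasure : IsProbabilityMeasure μ
  ae_isIndepSet : ∀ᵐ I ∂μ, G.IsIndepSet I
  cond_eq : ∀ T : Finset V, (G.induce (T : Set V)).IsTree →
    ∀ S : Finset V, S ⊆ T → G.IsIndepSet (S : Set V) →
      (cond μ {I | Disjoint I (outerBoundary G (T : Set V))}).real {I | I ∩ (T : Set V) = S} =
        lam ^ S.card / partitionFunction G lam T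

/-- For adjacent vertices `v`, `u` of a tree: the vertices of the subtree rooted at `u` that
is obtained by deleting `v`. -/
def branch (v u : V) : Set V :=
  {w | G.dist v w = G.dist u w + 1}

/-- Conditionally on either value at any vertex `v`, the configurations on the subtrees rooted
at the neighbours of `v` are independent. -/
def IsSimpleMeasure (μ : Measure (Set V)) : Prop :=
  ∀ v : V,
    iIndepFun (fun (u : G.neighborSet v) (I : Set V) => I ∩ branch G v u) (cond μ {I | v ∈ I}) ∧
    iIndepFun (fun (u : G.neighborSet v) (I : Set V) => I ∩ branch G v u) (cond μ {I | v ∉ I})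

/-- Invariance under all automorphisms. -/
def IsTranslationInvariant (μ : Measure (Set V)) : Prop :=
  ∀ φ : G ≃g G, μ.map (fun I : Set V => φ '' I) = μ

/-- Even vertices, that is those at even distance from the base vertex `o`; the other vertices
are odd. -/
def IsEvenVertex (o v : V) : Prop := Even (G.dist o v)

/-- Invariance under all parity-preserving automorphisms. -/
def IsSemiTranslationInvariant (o : V) (μ : Measure (Set V)) : Prop :=
  ∀ φ : G ≃g G, (∀ v, IsEvenVertex G o (φ v) ↔ IsEvenVertex G o v) →
    μ.map (fun I : Set V => φ '' I) = μ

end HardCore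

end

/-!
A simple Gibbs measure is a Markov chain along the edges of the tree, determined by the density of
occupied vertices at each vertex. Under (semi-)translation invariance only the densities `(α, β)` of
the two parity classes remain, and the Gibbs property at a single vertex becomes
`α (1 - α) ^ (d - 1) = lam (1 - α - β) ^ d` together with the same equation for `(β, α)`. These are
exactly the stationarity equations of `Phi1` in the interior of the triangle, while the infinite
slope of `-x log x` at `0` rules out local maxima on the boundary.

The symmetric solution exists for every activity. The asymmetric ones form a single curve, up to
exchanging `α` and `β`, along which the activity increases strictly from its critical value. Below
that value the symmetric point is therefore the only candidate for a local maximum; above it `Phi1`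
is strictly convex there in the antidiagonal direction, so the maximum is at the asymmetric pair.
-/

/-! ### Parents and branches in a tree -/

section RootedTree

variable {V : Type*} {G : SimpleGraph V}

open Classical in
/-- The parent of `w` in the tree `G` rooted at `r`, that is the neighbour of `w` on the path to
`r`. The root is its own parent. -/
noncomputable def treeParent (G : SimpleGraph V) (r w : V) : V :=
  if h : ∃ p, G.Adj p w ∧ G.dist r w = G.dist r p + 1 then h.choose else w

lemma treeParent_self (r : V) : treeParent G r r = r := by
  simp [treeParent]

lemma exists_adj_dist_eq_add_one (hG : G.Connected) {r w : V} (h : w ≠ r) :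
    ∃ p, G.Adj p w ∧ G.dist r w = G.dist r p + 1 := by
  obtain ⟨W, hW⟩ := hG.exists_walk_length_eq_dist w r
  cases W with
  | nil => exact absurd rfl h
  | @cons _ p _ hwp W =>
    refine ⟨p, hwp.symm, ?_⟩
    have hle : G.dist p r ≤ W.length := SimpleGraph.dist_le W
    have htri : G.dist w r ≤ G.dist w p + G.dist p r := hG.dist_triangle
    rw [SimpleGraph.dist_eq_one_iff_adj.2 hwp] at htri
    rw [SimpleGraph.Walk.length_cons] at hW
    rw [SimpleGraph.dist_comm (u := r), SimpleGraph.dist_comm (u := r)]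
    lia

lemma treeParent_spec (hG : G.Connected) {r w : V} (h : w ≠ r) :
    G.Adj (treeParent G r w) w ∧ G.dist r w = G.dist r (treeParent G r w) + 1 := by
  have hex := exists_adj_dist_eq_add_one hG h
  rw [treeParent, dif_pos hex]
  exact hex.choose_spec

lemma induction_on_treeParent {motive : V → Prop} (hG : G.Connected) (o : V)
    (root : motive o) (step : ∀ v, v ≠ o → motive (treeParent G o v) → motive v) (v : V) :
    motive v := by
  induction hn : G.dist o v using Nat.strong_induction_on generalizing v with
  | _ n ih =>
    by_cases hv : v = o
    · exact hv ▸ root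
    · have hd := (treeParent_spec hG hv).2
      exact step v hv (ih _ (by lia) _ rfl)

lemma countable_of_connected_of_locallyFinite [G.LocallyFinite] (hG : G.Connected) :
    Countable V := by
  obtain ⟨o⟩ := hG.nonempty
  have finite_sphere : ∀ n : ℕ, {v | G.dist o v = n}.Finite := by
    intro n
    induction n with
    | zero =>
      exact (finite_singleton o).subset fun v hv => (hG.dist_eq_zero_iff.1 hv).symm
    | succ n ih =>
      refine (ih.biUnion fun v _ => (G.neighborFinset v).finite_toSet).subset
        fun w (hw : G.dist o w = n + 1) => ?_
      have hwo : w ≠ o := by rintro rfl; simp at hw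
      obtain ⟨hadj, hd⟩ := treeParent_spec hG hwo
      exact mem_biUnion (show G.dist o (treeParent G o w) = n by lia) (by simpa using hadj)
  have hunion : (univ : Set V) = ⋃ n : ℕ, {v | G.dist o v = n} := by
    ext v; simp
  rw [← countable_univ_iff, hunion]
  exact countable_iUnion fun n => (finite_sphere n).countable

lemma eq_of_adj_of_dist_eq_add_one (hG : G.IsTree) {r w p q : V} (hp : G.Adj p w)
    (hq : G.Adj q w) (hdp : G.dist r w = G.dist r p + 1) (hdq : G.dist r w = G.dist r q + 1) :
    p = q := by
  classical
  have exists_path_via : ∀ p, G.Adj p w → G.dist r w = G.dist r p + 1 →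
      ∃ P : G.Walk r w, P.IsPath ∧ P.penultimate = p := by
    intro p hp hdp
    obtain ⟨P, hP, hlength⟩ := hG.connected.exists_path_of_dist r p
    refine ⟨P.concat hp, hP.concat (fun hw => ?_) hp, SimpleGraph.Walk.penultimate_concat _ _⟩
    have hle := SimpleGraph.dist_le (P.takeUntil w hw)
    have htake := P.length_takeUntil_le_length hw
    lia
  obtain ⟨P, hP, rfl⟩ := exists_path_via p hp hdp
  obtain ⟨Q, hQ, rfl⟩ := exists_path_via q hq hdq
  rw [(hG.existsUnique_path r w).unique hP hQ]

lemma treeParent_eq (hG : G.IsTree) {r w p : V} (hp : G.Adj p w)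
    (hd : G.dist r w = G.dist r p + 1) : treeParent G r w = p := by
  have h : w ≠ r := by rintro rfl; simp at hd
  obtain ⟨hadj, hd'⟩ := treeParent_spec hG.connected h
  exact eq_of_adj_of_dist_eq_add_one hG hadj hp hd' hd

lemma treeParent_of_adj (hG : G.IsTree) {r w : V} (h : G.Adj r w) : treeParent G r w = r :=
  treeParent_eq hG h (by simp [SimpleGraph.dist_eq_one_iff_adj.2 h])

lemma treeParent_eq_or_treeParent_eq (hG : G.IsTree) (r : V) {x y : V} (h : G.Adj x y) :
    (x ≠ r ∧ treeParent G r x = y) ∨ (y ≠ r ∧ treeParent G r y = x) := by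
  rcases hG.dist_eq_dist_add_one_of_adj r h with hd | hd
  · exact Or.inl ⟨by rintro rfl; simp at hd, treeParent_eq hG h.symm hd⟩
  · exact Or.inr ⟨by rintro rfl; simp at hd, treeParent_eq hG h hd⟩

lemma mem_branch_iff (hG : G.IsTree) {v u w : V} (h : G.Adj v u) :
    w ∈ branch G v u ↔ w ≠ v ∧ treeParent G w v = u := by
  have hdist : w ∈ branch G v u ↔ G.dist w v = G.dist w u + 1 := by
    simp [branch, SimpleGraph.dist_comm]
  rw [hdist]
  constructor
  · intro hd
    exact ⟨by rintro rfl; simp at hd, treeParent_eq hG h.symm hd⟩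
  · rintro ⟨hw, rfl⟩
    exact (treeParent_spec hG.connected hw.symm).2

lemma notMem_branch_iff (hG : G.IsTree) {v u w : V} (h : G.Adj v u) :
    w ∉ branch G v u ↔ w ∈ branch G u v := by
  have hd := hG.dist_eq_dist_add_one_of_adj w h
  rw [SimpleGraph.dist_comm (v := u), SimpleGraph.dist_comm (v := v)] at hd
  simp only [branch, mem_ofPred_eq]
  lia

lemma self_mem_branch {v u : V} (h : G.Adj v u) : u ∈ branch G v u := by
  simp [branch, SimpleGraph.dist_eq_one_iff_adj.2 h]

lemma self_notMem_branch (v u : V) : v ∉ branch G v u := by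
  simp [branch]

lemma disjoint_branch (hG : G.IsTree) {v u u' : V} (h : G.Adj v u) (h' : G.Adj v u')
    (hne : u ≠ u') : Disjoint (branch G v u) (branch G v u') := by
  rw [Set.disjoint_left]
  intro x hx hx'
  exact hne (((mem_branch_iff hG h).1 hx).2.symm.trans ((mem_branch_iff hG h').1 hx').2)

lemma eq_and_eq_of_adj_of_mem_branch (hG : G.IsTree) {v u x y : V} (h : G.Adj v u)
    (hxy : G.Adj x y) (hx : x ∈ branch G v u) (hy : y ∉ branch G v u) : x = u ∧ y = v := by
  replace hy : G.dist u y = G.dist v y + 1 := (notMem_branch_iff hG h).1 hy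
  replace hx : G.dist v x = G.dist u x + 1 := hx
  have hu := hG.dist_eq_dist_add_one_of_adj u hxy
  have hv := hG.dist_eq_dist_add_one_of_adj v hxy
  have hux : G.dist u x = G.dist v y := by lia
  -- Otherwise the parents of `y` towards `u` and `v` agree, but the one towards `u` is `x`.
  have hyv : y = v := by
    by_contra hne
    obtain ⟨hz, hdz⟩ := treeParent_spec hG.connected hne
    set z := treeParent G v y
    have huz := hG.dist_eq_dist_add_one_of_adj u hz
    have hzv := hG.dist_eq_dist_add_one_of_adj z h
    simp only [SimpleGraph.dist_comm (u := z)] at hzv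
    have hzx : z = x := eq_of_adj_of_dist_eq_add_one hG (r := u) hz hxy (by lia) (by lia)
    rw [hzx] at hdz
    lia
  rw [hyv, SimpleGraph.dist_self, hG.connected.dist_eq_zero_iff] at hux
  exact ⟨hux.symm, hyv⟩

lemma treeParent_mem_branch (hG : G.IsTree) {v u r x : V} (h : G.Adj v u)
    (hr : r ∉ branch G v u) (hx : x ∈ branch G v u) (hxu : x ≠ u) :
    treeParent G r x ∈ branch G v u := by
  by_contra hp
  have hxr : x ≠ r := by rintro rfl; exact hr hx
  have hadj := (treeParent_spec hG.connected hxr).1.symm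
  exact hxu (eq_and_eq_of_adj_of_mem_branch hG h hadj hx hp).1

lemma treeParent_eq_treeParent_of_adj (hG : G.IsTree) {o v x : V} (h : G.Adj o v)
    (hxo : x ≠ o) (hxv : x ≠ v) : treeParent G o x = treeParent G v x := by
  obtain ⟨hp, hd⟩ := treeParent_spec hG.connected hxo
  refine (treeParent_eq hG hp ?_).symm
  set p := treeParent G o x
  have same_side : x ∈ branch G o v ↔ p ∈ branch G o v := by
    constructor
    · intro hx
      by_contra hpb
      exact hxv (eq_and_eq_of_adj_of_mem_branch hG h hp.symm hx hpb).1
    · intro hpb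
      by_contra hx
      exact hxo (eq_and_eq_of_adj_of_mem_branch hG h hp hpb hx).2
  have hx := notMem_branch_iff hG (w := x) h
  have hp' := notMem_branch_iff hG (w := p) h
  simp only [branch, mem_ofPred_eq] at same_side hx hp'
  lia

lemma isEvenVertex_self (o : V) : IsEvenVertex G o o := by
  simp [IsEvenVertex]

lemma isEvenVertex_iff_not_of_adj (hG : G.IsTree) (o : V) {v w : V} (h : G.Adj v w) :
    IsEvenVertex G o v ↔ ¬ IsEvenVertex G o w := by
  unfold IsEvenVertex
  rcases hG.dist_eq_dist_add_one_of_adj o h with hd | hd <;> rw [hd] <;> grind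

end RootedTree

/-! ### Homogeneity of regular trees -/

section Homogeneity

variable {V V' : Type*} {G : SimpleGraph V} {G' : SimpleGraph V'}

/-- The function on the vertices of a tree rooted at `o` that is defined recursively from its
value `b` at the root: the value at any other vertex `w` is `step w` of the value at its parent. -/
noncomputable def treeRec {β : Type*} (G : SimpleGraph V) (o : V) (b : β) (step : V → β → β)
    (w : V) : β :=
  Nat.rec (motive := fun _ => V → β) (fun _ => b) (fun _ f v => step v (f (treeParent G o v)))
    (G.dist o w) w

lemma treeRec_root {β : Type*} (o : V) (b : β) (step : V → β → β) :
    treeRec G o b step o = b := by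
  simp [treeRec]

lemma treeRec_of_ne {β : Type*} (hG : G.Connected) {o w : V} (hw : w ≠ o) (b : β)
    (step : V → β → β) :
    treeRec G o b step w = step w (treeRec G o b step (treeParent G o w)) := by
  rw [treeRec, (treeParent_spec hG hw).2]
  rfl

/-- The children of `w` in the tree `G` rooted at `r`. -/
def treeChildren (G : SimpleGraph V) (r w : V) : Set V :=
  G.neighborSet w \ {treeParent G r w}

lemma mem_treeChildren_iff (hG : G.IsTree) {r w x : V} :
    x ∈ treeChildren G r w ↔ x ≠ r ∧ treeParent G r x = w := by
  constructor
  · rintro ⟨hwx, hx⟩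
    exact (treeParent_eq_or_treeParent_eq hG r hwx).resolve_left fun h => hx h.2.symm
  · rintro ⟨hx, rfl⟩
    obtain ⟨hadj, hd⟩ := treeParent_spec hG.connected hx
    refine ⟨hadj, fun h => ?_⟩
    rcases eq_or_ne (treeParent G r x) r with hr | hr
    · rw [hr, treeParent_self] at h
      exact hx h
    · have hd' := (treeParent_spec hG.connected hr).2
      rw [mem_singleton_iff] at h
      rw [← h] at hd'
      lia

lemma adj_iff_mem_treeChildren (hG : G.IsTree) (r : V) {x y : V} :
    G.Adj x y ↔ y ∈ treeChildren G r x ∨ x ∈ treeChildren G r y := by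
  refine ⟨fun h => ?_, ?_⟩
  · rw [mem_treeChildren_iff hG, mem_treeChildren_iff hG]
    exact (treeParent_eq_or_treeParent_eq hG r h).symm
  · rintro (h | h)
    · exact h.1
    · exact h.1.symm

lemma exists_bijOn_treeChildren [G.LocallyFinite] [G'.LocallyFinite] (hG : G.Connected)
    (hG' : G'.Connected) {d : ℕ} (hreg : G.IsRegularOfDegree d) (hreg' : G'.IsRegularOfDegree d)
    {o w : V} {o' w' : V'} (h : w = o ↔ w' = o') :
    ∃ e : V → V', BijOn e (treeChildren G o w) (treeChildren G' o' w') := by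
  have : Nonempty V' := ⟨o'⟩
  have encard_neighborSet : (G.neighborSet w).encard = (G'.neighborSet w').encard := by
    rw [encard_eq_coe_toFinset_card, encard_eq_coe_toFinset_card]
    exact congrArg _ ((hreg.degree_eq w).trans (hreg'.degree_eq w').symm)
  refine (toFinite _).sdiff.exists_bijOn_of_encard_eq ?_
  unfold treeChildren
  by_cases hw : w = o
  · have hw' := h.1 hw
    subst hw hw'
    rw [treeParent_self, treeParent_self, sdiff_singleton_eq_self (by simp),
      sdiff_singleton_eq_self (by simp), encard_neighborSet]
  · have hp : treeParent G o w ∈ G.neighborSet w := (treeParent_spec hG hw).1.symm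
    have hp' : treeParent G' o' w' ∈ G'.neighborSet w' :=
      (treeParent_spec hG' (mt h.2 hw)).1.symm
    rw [encard_sdiff_singleton_of_mem hp, encard_sdiff_singleton_of_mem hp', encard_neighborSet]

section IsoOfChildren

variable {o : V} {f : V → V'}

lemma treeParent_apply_of_mapsTo_treeChildren (hG : G.IsTree) (hG' : G'.IsTree)
    (hf : ∀ w, MapsTo f (treeChildren G o w) (treeChildren G' (f o) (f w))) {w : V} (hw : w ≠ o) :
    f w ≠ f o ∧ treeParent G' (f o) (f w) = f (treeParent G o w) :=
  (mem_treeChildren_iff hG').1 (hf _ ((mem_treeChildren_iff hG).2 ⟨hw, rfl⟩))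

lemma injective_of_bijOn_treeChildren (hG : G.IsTree) (hG' : G'.IsTree)
    (hf : ∀ w, BijOn f (treeChildren G o w) (treeChildren G' (f o) (f w))) :
    Function.Injective f := by
  have hparent := @treeParent_apply_of_mapsTo_treeChildren _ _ _ _ o f hG hG'
    fun w => (hf w).mapsTo
  refine induction_on_treeParent hG.connected o (fun w' h => ?_) fun w hw ih w' h => ?_
  · by_contra hw'
    exact (hparent (Ne.symm hw')).1 h.symm
  · have hw' : w' ≠ o := by
      rintro rfl
      exact (hparent hw).1 h
    have hp : treeParent G o w = treeParent G o w' :=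
      ih (by rw [← (hparent hw).2, ← (hparent hw').2, h])
    exact (hf _).injOn ((mem_treeChildren_iff hG).2 ⟨hw, hp⟩)
      ((mem_treeChildren_iff hG).2 ⟨hw', rfl⟩) h

lemma surjective_of_surjOn_treeChildren (hG' : G'.IsTree)
    (hf : ∀ w, SurjOn f (treeChildren G o w) (treeChildren G' (f o) (f w))) :
    Function.Surjective f := by
  refine induction_on_treeParent hG'.connected (f o) ⟨o, rfl⟩ ?_
  rintro y hy ⟨p, hp⟩
  obtain ⟨w, -, hw⟩ := hf p ((mem_treeChildren_iff hG').2 ⟨hy, hp.symm⟩)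
  exact ⟨w, hw⟩

lemma exists_iso_of_bijOn_treeChildren (hG : G.IsTree) (hG' : G'.IsTree)
    (hf : ∀ w, BijOn f (treeChildren G o w) (treeChildren G' (f o) (f w))) :
    ∃ φ : G ≃g G', ⇑φ = f := by
  have hinj := injective_of_bijOn_treeChildren hG hG' hf
  have hsurj := surjective_of_surjOn_treeChildren hG' fun w => (hf w).surjOn
  have mem_children_iff : ∀ x y,
      f y ∈ treeChildren G' (f o) (f x) ↔ y ∈ treeChildren G o x := by
    refine fun x y => ⟨fun h => ?_, fun h => (hf x).mapsTo h⟩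
    obtain ⟨z, hz, hzy⟩ := (hf x).surjOn h
    exact hinj hzy ▸ hz
  refine ⟨⟨Equiv.ofBijective f ⟨hinj, hsurj⟩, fun {x y} => ?_⟩, rfl⟩
  rw [adj_iff_mem_treeChildren hG o, ← mem_children_iff, ← mem_children_iff]
  exact adj_iff_mem_treeChildren hG' (f o)

end IsoOfChildren

/-- The isomorphism is built outwards from the roots, by choosing bijections between the children
of corresponding vertices. -/
theorem exists_iso_apply_eq_of_isRegularOfDegree [G.LocallyFinite] [G'.LocallyFinite]
    (hG : G.IsTree) (hG' : G'.IsTree) {d : ℕ} (hreg : G.IsRegularOfDegree d)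
    (hreg' : G'.IsRegularOfDegree d) (o : V) (o' : V') : ∃ φ : G ≃g G', φ o = o' := by
  have : Nonempty V' := ⟨o'⟩
  choose! e he using fun w w' => @exists_bijOn_treeChildren _ _ G G' _ _ hG.connected
    hG'.connected d hreg hreg' o w o' w'
  set f := treeRec G o o' fun w y => e (treeParent G o w) y w
  have hroot : f o = o' := treeRec_root o o' _
  have hstep : ∀ w, EqOn f (e w (f w)) (treeChildren G o w) := by
    intro w x hx
    obtain ⟨hxo, rfl⟩ := (mem_treeChildren_iff hG).1 hx
    exact treeRec_of_ne hG.connected hxo o' _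
  have root_iff : ∀ w, w = o ↔ f w = o' := by
    refine induction_on_treeParent hG.connected o (by simp [hroot]) fun w hw ih => ?_
    have hmem := (mem_treeChildren_iff hG).2 ⟨hw, rfl⟩
    have hmem' := (he _ _ ih).mapsTo hmem
    rw [← hstep _ hmem, mem_treeChildren_iff hG'] at hmem'
    exact iff_of_false hw hmem'.1
  have hf : ∀ w, BijOn f (treeChildren G o w) (treeChildren G' (f o) (f w)) := by
    intro w
    rw [hroot]
    exact (he w _ (root_iff w)).congr (hstep w).symm
  obtain ⟨φ, hφ⟩ := exists_iso_of_bijOn_treeChildren hG hG' hf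
  exact ⟨φ, hφ ▸ hroot⟩

lemma isEvenVertex_apply_iff (hG : G.IsTree) (o : V) (φ : G ≃g G) {u : V}
    (hu : IsEvenVertex G o (φ u) ↔ IsEvenVertex G o u) (v : V) :
    IsEvenVertex G o (φ v) ↔ IsEvenVertex G o v := by
  refine induction_on_treeParent hG.connected u
    (motive := fun v => IsEvenVertex G o (φ v) ↔ IsEvenVertex G o v) hu (fun w hw ih => ?_) v
  have h := (treeParent_spec hG.connected hw).1
  have hparity := isEvenVertex_iff_not_of_adj hG o h
  have hparity' := isEvenVertex_iff_not_of_adj hG o (φ.map_adj_iff.2 h)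
  tauto

end Homogeneity

/-! ### Product measures -/

section ProductMeasure

open Measure

lemma measure_ext_of_measureReal {Ω : Type*} [MeasurableSpace Ω] {μ ν : Measure Ω}
    [IsFiniteMeasure μ] [IsFiniteMeasure ν] (h : ∀ s, MeasurableSet s → μ.real s = ν.real s) :
    μ = ν :=
  Measure.ext fun s hs => (measureReal_eq_measureReal_iff).1 (h s hs)

lemma iIndepFun_map {Ω Ω' κ : Type*} [MeasurableSpace Ω] [MeasurableSpace Ω'] {β : κ → Type*}
    [∀ k, MeasurableSpace (β k)] {P : Measure Ω} {g : Ω → Ω'} (hg : Measurable g)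
    {f : ∀ k, Ω' → β k} (hf : ∀ k, Measurable (f k)) (h : iIndepFun (fun k ω => f k (g ω)) P) :
    iIndepFun f (P.map g) := by
  rw [iIndepFun_iff_measure_inter_preimage_eq_mul] at h ⊢
  intro S A hA
  have hmeas : ∀ k ∈ S, MeasurableSet (f k ⁻¹' A k) := fun k hk => hf k (hA k hk)
  rw [Measure.map_apply hg (Finset.measurableSet_biInter S hmeas),
    Finset.prod_congr rfl fun k hk => Measure.map_apply hg (hmeas k hk), preimage_iInter₂]
  exact h S hA

variable {V : Type*} {X : V → Type*} [∀ i, MeasurableSpace (X i)]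

lemma measurableSet_cylinderEvents_of_dependsOn {E : Set (∀ i, X i)} (hE : MeasurableSet E)
    {A : Set V} (hA : DependsOn (fun U => U ∈ E) A) :
    MeasurableSet[cylinderEvents A] E := by
  classical
  rcases E.eq_empty_or_nonempty with rfl | ⟨c, -⟩
  · exact @MeasurableSet.empty _ (_)
  let resample : (∀ i, X i) → ∀ i, X i := fun U i => if i ∈ A then U i else c i
  have hmeas : Measurable[cylinderEvents A] resample := by
    refine @measurable_pi_iff _ _ _ (_) _ _ |>.2 fun i => ?_
    by_cases hi : i ∈ A
    · simpa only [resample, hi, if_true] using measurable_cylinderEvent_apply hi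
    · simp only [resample, hi, if_false]
      exact measurable_const
  have hpre : E = resample ⁻¹' E := by
    ext U
    exact (hA (x := U) (y := resample U) fun i hi => by simp [resample, hi]).to_iff
  rw [hpre]
  exact hmeas hE

variable (ν : ∀ i, Measure (X i)) [∀ i, IsProbabilityMeasure (ν i)]

lemma infinitePi_inter_of_dependsOn {E F : Set (∀ i, X i)} (hE : MeasurableSet E)
    (hF : MeasurableSet F) {A B : Set V} (hAB : Disjoint A B)
    (hEA : DependsOn (fun U => U ∈ E) A) (hFB : DependsOn (fun U => U ∈ F) B) :
    infinitePi ν (E ∩ F) = infinitePi ν E * infinitePi ν F := by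
  have coordinates : iIndepFun (fun (i : V) (U : ∀ i, X i) => U i) (infinitePi ν) :=
    iIndepFun_infinitePi (P := ν) (X := fun _ x => x) fun _ => measurable_id
  have cylinders : Indep (cylinderEvents A) (cylinderEvents B)
      (infinitePi ν) :=
    indep_iSup_of_disjoint (fun i => (measurable_pi_apply i).comap_le) coordinates.iIndep hAB
  exact (Indep_iff _ _ _).1 cylinders E F (measurableSet_cylinderEvents_of_dependsOn hE hEA)
    (measurableSet_cylinderEvents_of_dependsOn hF hFB)

lemma iIndepFun_infinitePi_of_dependsOn {κ : Type*} {β : κ → Type*} [∀ k, MeasurableSpace (β k)]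
    {f : ∀ k, (∀ i, X i) → β k} (hf : ∀ k, Measurable (f k)) {B : κ → Set V}
    (hB : Pairwise (Function.onFun Disjoint B)) (hd : ∀ k, DependsOn (f k) (B k)) :
    iIndepFun f (infinitePi ν) := by
  classical
  rw [iIndepFun_iff_measure_inter_preimage_eq_mul]
  intro S A hA
  induction S using Finset.induction_on with
  | empty => simp
  | insert k S hk ih =>
    rw [Finset.set_biInter_insert, Finset.prod_insert hk,
      ← ih fun i hi => hA i (Finset.mem_insert_of_mem hi)]
    refine infinitePi_inter_of_dependsOn ν (A := B k) (B := ⋃ j ∈ S, B j)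
      (hf k (hA k (Finset.mem_insert_self _ _)))
      (Finset.measurableSet_biInter S fun j hj => hf j (hA j (Finset.mem_insert_of_mem hj)))
      ?_ (fun U U' h => by simp only [mem_preimage, hd k h]) fun U U' h => ?_
    · simp only [disjoint_iUnion_right]
      exact fun j hj => hB (ne_of_mem_of_not_mem hj hk).symm
    · simp only [mem_iInter, mem_preimage, eq_iff_iff]
      refine forall₂_congr fun j hj => ?_
      rw [hd j fun i hi => h i (mem_biUnion hj hi)]

end ProductMeasure

section Coins

open Measure unitInterval

variable {V : Type*}

/-- The law of independent coins at the vertices, where the coin at `v` shows `true` with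
probability `q v`. It is the source of randomness of the broadcasting process below. -/
noncomputable def coinMeasure (q : V → I) : Measure (V → Bool) :=
  infinitePi fun v => bernoulliMeasure true false (q v)

variable (q : V → I)

instance : IsProbabilityMeasure (coinMeasure q) := by
  unfold coinMeasure; infer_instance

lemma coinMeasure_real_inter_of_dependsOn {E F : Set (V → Bool)} (hE : MeasurableSet E)
    (hF : MeasurableSet F) {A B : Set V} (hAB : Disjoint A B)
    (hEA : DependsOn (fun U => U ∈ E) A) (hFB : DependsOn (fun U => U ∈ F) B) :
    (coinMeasure q).real (E ∩ F) = (coinMeasure q).real E * (coinMeasure q).real F := by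
  simp only [measureReal_def, ← ENNReal.toReal_mul]
  rw [coinMeasure, infinitePi_inter_of_dependsOn _ hE hF hAB hEA hFB]

lemma measurableSet_coin_eq (v : V) (b : Bool) : MeasurableSet {U : V → Bool | U v = b} :=
  measurableSet_eq_fun (measurable_pi_apply v) measurable_const

lemma measurableSet_coin_forall_eq (s : Finset V) (b : Bool) :
    MeasurableSet {U : V → Bool | ∀ v ∈ s, U v = b} := by
  simp only [ofPred_forall]
  exact Finset.measurableSet_biInter s fun v _ => measurableSet_coin_eq v b

lemma coinMeasure_real_forall_eq_false (s : Finset V) :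
    (coinMeasure q).real {U | ∀ v ∈ s, U v = false} = ∏ v ∈ s, (1 - (q v : ℝ)) := by
  have hpi : {U : V → Bool | ∀ v ∈ s, U v = false} = Set.pi (s : Set V) fun _ => {false} := by
    ext U; simp [Set.mem_pi]
  rw [hpi, measureReal_def, coinMeasure, infinitePi_pi _ (fun _ _ => measurableSet_singleton _),
    ENNReal.toReal_prod]
  refine Finset.prod_congr rfl fun v _ => ?_
  rw [← measureReal_def, bernoulliMeasure_real_apply_of_notMem_of_mem _ (measurableSet_singleton _)
    (by simp) (by simp)]

lemma coinMeasure_real_eq_false (v : V) : (coinMeasure q).real {U | U v = false} = 1 - q v := by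
  simpa using coinMeasure_real_forall_eq_false q {v}

lemma compl_coin_eq_true (v : V) : {U : V → Bool | U v = true}ᶜ = {U | U v = false} := by
  ext; simp

lemma coinMeasure_real_eq_true (v : V) : (coinMeasure q).real {U | U v = true} = q v := by
  have hcompl := probReal_compl_eq_one_sub (μ := coinMeasure q) (measurableSet_coin_eq v true)
  rw [compl_coin_eq_true, coinMeasure_real_eq_false] at hcompl
  linarith

open Classical in
lemma coinMeasure_real_coin_eq_inter (v : V) (b : Bool) {E : Set (V → Bool)}
    (hE : MeasurableSet E) :
    (coinMeasure q).real ({U | U v = b} ∩ E) =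
      (coinMeasure q).real {U | U v = b} *
        (coinMeasure q).real {U | Function.update U v b ∈ E} := by
  have hupdate : {U | U v = b} ∩ E = {U | U v = b} ∩ {U | Function.update U v b ∈ E} := by
    ext U
    refine and_congr_right fun (h : U v = b) => ?_
    rw [mem_ofPred_eq, ← h, Function.update_eq_self]
  rw [hupdate]
  refine coinMeasure_real_inter_of_dependsOn q (measurableSet_coin_eq v b)
    (measurable_update_left hE) (A := {v}) (B := {v}ᶜ) disjoint_compl_right
    (fun U U' h => by simp [h v rfl]) fun U U' h => ?_
  have heq : Function.update U v b = Function.update U' v b := by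
    ext i
    by_cases hi : i = v
    · subst hi; simp
    · simp [hi, h i hi]
  simp [heq]

open Classical in
lemma coinMeasure_real_eq_add_update (v : V) {E : Set (V → Bool)} (hE : MeasurableSet E) :
    (coinMeasure q).real E =
      q v * (coinMeasure q).real {U | Function.update U v true ∈ E} +
      (1 - q v) * (coinMeasure q).real {U | Function.update U v false ∈ E} := by
  rw [← measureReal_inter_add_sdiff (s := E) (measurableSet_coin_eq v true), sdiff_eq,
    compl_coin_eq_true, inter_comm, inter_comm E, coinMeasure_real_coin_eq_inter q v true hE,
    coinMeasure_real_coin_eq_inter q v false hE, coinMeasure_real_eq_true,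
    coinMeasure_real_eq_false]

end Coins

/-! ### Broadcasting -/

section Broadcast

variable {V : Type*} (G : SimpleGraph V)

/-- The independent set that is broadcast from the root `r` with the coins `U`: the root is occupied
if `b` holds, and any other vertex is occupied if its coin shows `true` and its parent is not
occupied. -/
def broadcast (r : V) (b : Bool) (U : V → Bool) : Set V :=
  {w | treeRec G r (b = true) (fun w parentOccupied => U w = true ∧ ¬ parentOccupied) w}

variable {G} {r : V} {b : Bool} {U : V → Bool}

@[simp]
lemma root_mem_broadcast : r ∈ broadcast G r b U ↔ b = true := by
  simp [broadcast, treeRec_root]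

lemma mem_broadcast_iff (hG : G.Connected) {w : V} (hw : w ≠ r) :
    w ∈ broadcast G r b U ↔ U w = true ∧ treeParent G r w ∉ broadcast G r b U := by
  simp only [broadcast, mem_ofPred_eq]
  rw [treeRec_of_ne hG hw]

lemma eq_broadcast (hG : G.Connected) {J : Set V} (hr : r ∈ J ↔ b = true)
    (h : ∀ w, w ≠ r → (w ∈ J ↔ U w = true ∧ treeParent G r w ∉ J)) : J = broadcast G r b U := by
  ext w
  refine induction_on_treeParent hG r (motive := fun w => w ∈ J ↔ w ∈ broadcast G r b U)
    (by simp [hr]) (fun w hw ih => ?_) w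
  rw [h w hw, mem_broadcast_iff hG hw, ih]

lemma isIndepSet_broadcast (hG : G.IsTree) : G.IsIndepSet (broadcast G r b U) := by
  intro x hx y hy _ hadj
  rcases treeParent_eq_or_treeParent_eq hG r hadj with ⟨h, h'⟩ | ⟨h, h'⟩
  · rw [mem_broadcast_iff hG.connected h, h'] at hx
    exact hx.2 hy
  · rw [mem_broadcast_iff hG.connected h, h'] at hy
    exact hy.2 hx

lemma measurable_broadcast (hG : G.Connected) (r : V) (b : Bool) :
    Measurable (broadcast G r b) := by
  rw [measurable_set_iff]
  refine induction_on_treeParent hG r ?_ fun w hw ih => ?_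
  · simp
  · simp only [mem_broadcast_iff hG hw]
    refine Measurable.and ?_ ih.not
    exact measurableSet_setOfPred.1 (measurableSet_coin_eq w true)

lemma dependsOn_broadcast_inter_branch (hG : G.IsTree) {u : V} (h : G.Adj r u) :
    DependsOn (fun U => broadcast G r b U ∩ branch G r u) (branch G r u) := by
  intro U U' hUU'
  ext x
  refine and_congr_left fun hx => ?_
  have hr : r ∉ branch G r u := self_notMem_branch r u
  refine induction_on_treeParent hG.connected r (motive := fun x => x ∈ branch G r u →
    (x ∈ broadcast G r b U ↔ x ∈ broadcast G r b U')) (fun h => absurd h hr) ?_ x hx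
  intro w hw ih hwb
  rw [mem_broadcast_iff hG.connected hw, mem_broadcast_iff hG.connected hw, hUU' w hwb]
  refine and_congr_right fun _ => not_congr ?_
  by_cases hwu : w = u
  · subst hwu
    rw [treeParent_of_adj hG h]
    simp
  · exact ih (treeParent_mem_branch hG h hr hwb hwu)

lemma dependsOn_broadcast_true (hG : G.IsTree) :
    DependsOn (broadcast G r true) {w | ¬ G.Adj r w} := by
  intro U U' h
  refine eq_broadcast hG.connected (by simp) fun w hw => ?_
  rw [mem_broadcast_iff hG.connected hw]
  by_cases hadj : G.Adj r w
  · simp [treeParent_of_adj hG hadj]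
  · rw [h w hadj]

lemma broadcast_true_eq_insert (hG : G.IsTree) (hU : ∀ u, G.Adj r u → U u = false) :
    broadcast G r true U = insert r (broadcast G r false U) := by
  symm
  refine eq_broadcast hG.connected (by simp) fun w hw => ?_
  rw [mem_insert_iff, or_iff_right hw, mem_broadcast_iff hG.connected hw, mem_insert_iff, not_or]
  refine and_congr_right fun hUw => ?_
  have hparent : treeParent G r w ≠ r := by
    intro hp
    simp [hU w (hp ▸ (treeParent_spec hG.connected hw).1)] at hUw
  simp [hparent]

open Classical in
lemma broadcast_false_update_true (hG : G.IsTree) {o v : V} (h : G.Adj o v) (U : V → Bool) :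
    broadcast G o false (Function.update U v true) = broadcast G v true U := by
  refine eq_broadcast hG.connected ?_ fun w hw => ?_
  · rw [mem_broadcast_iff hG.connected h.ne', treeParent_of_adj hG h]
    simp
  · by_cases hwo : w = o
    · subst hwo
      rw [treeParent_of_adj hG h.symm, mem_broadcast_iff hG.connected h.ne', treeParent_of_adj hG h]
      simp
    · rw [mem_broadcast_iff hG.connected hwo, treeParent_eq_treeParent_of_adj hG h hwo hw]
      simp [hw]

open Classical in
lemma broadcast_false_update_false (hG : G.IsTree) {o v : V} (h : G.Adj o v) (U : V → Bool) :
    broadcast G o false (Function.update U v false) =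
      broadcast G v false (Function.update U o false) := by
  refine eq_broadcast hG.connected ?_ fun w hw => ?_
  · rw [mem_broadcast_iff hG.connected h.ne']
    simp
  · by_cases hwo : w = o
    · subst hwo
      simp
    · rw [mem_broadcast_iff hG.connected hwo, treeParent_eq_treeParent_of_adj hG h hwo hw]
      simp [hw, hwo]

lemma broadcast_false_inter_eq_iff (hG : G.IsTree) {W S : Set V} (hrS : r ∉ S) (hrW : r ∈ W)
    (hW : ∀ u, G.Adj r u → u ∈ W) (hS : ∀ u, G.Adj r u → u ∉ S) :
    broadcast G r false U ∩ W = S ↔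
      (∀ u, G.Adj r u → U u = false) ∧ broadcast G r true U ∩ W = insert r S := by
  have hr : r ∉ broadcast G r false U := by simp
  constructor
  · intro h
    have hU : ∀ u, G.Adj r u → U u = false := by
      intro u hu
      have hmem : u ∉ broadcast G r false U := fun hmem => hS u hu (h ▸ ⟨hmem, hW u hu⟩)
      rw [mem_broadcast_iff hG.connected hu.ne', treeParent_of_adj hG hu] at hmem
      simpa using hmem
    exact ⟨hU, by rw [broadcast_true_eq_insert hG hU, insert_inter_of_mem hrW, h]⟩
  · rintro ⟨hU, h⟩
    rw [broadcast_true_eq_insert hG hU, insert_inter_of_mem hrW] at h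
    have hr' : r ∉ broadcast G r false U ∩ W := fun h' => hr h'.1
    rw [← insert_sdiff_self_of_notMem hr', h, insert_sdiff_self_of_notMem hrS]

end Broadcast

/-! ### A local criterion for Gibbs measures -/

section LocalCriterion

variable {V : Type*}

lemma measurable_inter_const (B : Set V) : Measurable fun I : Set V => I ∩ B :=
  measurable_set_iff.2 fun x => by
    by_cases hx : x ∈ B
    · simpa [hx] using measurable_set_mem x
    · simp [hx]

lemma measurableSet_inter_eq [Countable V] (B S : Set V) :
    MeasurableSet {I : Set V | I ∩ B = S} :=
  (measurable_inter_const B) (measurableSet_singleton S)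

lemma measurableSet_isIndepSet [Countable V] (G : SimpleGraph V) :
    MeasurableSet {I : Set V | G.IsIndepSet I} :=
  measurableSet_setOfPred.2 <| .forall fun x => (measurable_set_mem x).imp <| .forall fun y =>
    (measurable_set_mem y).imp measurable_const

lemma cond_real_apply {Ω : Type*} [MeasurableSpace Ω] (μ : Measure Ω) {s : Set Ω}
    (hs : MeasurableSet s) (t : Set Ω) :
    (cond μ s).real t = (μ.real s)⁻¹ * μ.real (s ∩ t) := by
  simp [measureReal_def, cond_apply hs]

variable {G : SimpleGraph V}

lemma finite_outerBoundary [G.LocallyFinite] (T : Finset V) :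
    (outerBoundary G (T : Set V)).Finite := by
  refine (T.finite_toSet.biUnion fun v _ => (G.neighborFinset v).finite_toSet).subset ?_
  rintro u ⟨-, v, hv, hadj⟩
  exact mem_biUnion hv (by simpa using hadj)

lemma mem_union_outerBoundary_of_adj {T : Set V} {s u : V} (hs : s ∈ T) (h : G.Adj s u) :
    u ∈ T ∪ outerBoundary G T := by
  by_cases hu : u ∈ T
  · exact Or.inl hu
  · exact Or.inr ⟨hu, s, hs, h⟩

lemma measurableSet_disjoint [Countable V] (B : Set V) :
    MeasurableSet {I : Set V | Disjoint I B} := by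
  simp only [Set.disjoint_iff_inter_eq_empty]
  exact measurableSet_inter_eq _ _

lemma disjoint_outerBoundary_and_inter_eq_iff {T S I : Set V} (hS : S ⊆ T) :
    Disjoint I (outerBoundary G T) ∧ I ∩ T = S ↔ I ∩ (T ∪ outerBoundary G T) = S := by
  constructor
  · rintro ⟨hI, hIT⟩
    rw [inter_union_distrib_left, hIT, hI.inter_eq, union_empty]
  · intro h
    have hI : Disjoint I (outerBoundary G T) := by
      refine Set.disjoint_left.2 fun x hx hxB => ?_
      exact hxB.1 (hS (h ▸ ⟨hx, Or.inr hxB⟩))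
    refine ⟨hI, ?_⟩
    rw [← h, inter_union_distrib_left, hI.inter_eq, union_empty]

lemma setOf_disjoint_outerBoundary_eq_biUnion (T : Finset V) :
    {I | Disjoint I (outerBoundary G (T : Set V))} =
      ⋃ S ∈ T.powerset, {I : Set V | I ∩ (T ∪ outerBoundary G (T : Set V)) = (S : Set V)} := by
  classical
  ext I
  simp only [mem_iUnion, Finset.mem_powerset, exists_prop, mem_ofPred_eq]
  constructor
  · intro hI
    refine ⟨T.filter (· ∈ I), Finset.filter_subset _ _, ?_⟩
    have hIT : I ∩ T = T.filter (· ∈ I) := by ext x; simp [and_comm]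
    exact (disjoint_outerBoundary_and_inter_eq_iff (hIT ▸ inter_subset_right)).1 ⟨hI, hIT⟩
  · rintro ⟨S, hS, hI⟩
    exact ((disjoint_outerBoundary_and_inter_eq_iff (by exact_mod_cast hS)).2 hI).1

/-- The ratio of the probabilities of two local configurations that differ at one vertex `s`, with
empty neighbourhood, is the activity. -/
def HasActivity (G : SimpleGraph V) (lam : ℝ) (μ : Measure (Set V)) : Prop :=
  ∀ ⦃s : V⦄ ⦃W S : Set V⦄, s ∉ S → s ∈ W → (∀ u, G.Adj s u → u ∈ W) → (∀ u, G.Adj s u → u ∉ S) →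
    μ.real {I | I ∩ W = insert s S} = lam * μ.real {I | I ∩ W = S}

variable {lam : ℝ} {μ : Measure (Set V)}

lemma HasActivity.real_inter_eq (hμ : HasActivity G lam μ) {W : Set V} {S : Finset V}
    (hSW : (S : Set V) ⊆ W) (hW : ∀ s ∈ S, ∀ u, G.Adj s u → u ∈ W)
    (hS : G.IsIndepSet (S : Set V)) :
    μ.real {I | I ∩ W = S} = lam ^ S.card * μ.real {I | I ∩ W = ∅} := by
  classical
  induction S using Finset.induction_on with
  | empty => simp
  | insert s S hs ih =>
    rw [Finset.coe_insert] at hS hSW ⊢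
    rw [hμ (by simpa using hs) (hSW (mem_insert s _)) (hW s (Finset.mem_insert_self s S))
      fun u hu huS => hS (mem_insert s _) (mem_insert_of_mem s huS) hu.ne hu,
      ih ((subset_insert s _).trans hSW) (fun v hv => hW v (Finset.mem_insert_of_mem hv))
        (hS.mono (subset_insert s _)),
      Finset.card_insert_of_notMem hs, pow_succ']
    ring

lemma real_eq_zero_of_forall_not_isIndepSet (hindep : ∀ᵐ I ∂μ, G.IsIndepSet I) {E : Set (Set V)}
    (hE : ∀ I ∈ E, ¬ G.IsIndepSet I) : μ.real E = 0 := by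
  rw [measureReal_def, measure_mono_null hE (ae_iff.1 hindep), ENNReal.toReal_zero]

lemma real_inter_eq_of_not_isIndepSet (hindep : ∀ᵐ I ∂μ, G.IsIndepSet I) (W : Set V) {S : Set V}
    (hS : ¬ G.IsIndepSet S) : μ.real {I | I ∩ W = S} = 0 :=
  real_eq_zero_of_forall_not_isIndepSet hindep fun I (hI : I ∩ W = S) hI' =>
    hS (hI ▸ hI'.mono inter_subset_left)

lemma HasActivity.real_disjoint_outerBoundary [Countable V] [IsFiniteMeasure μ]
    (hμ : HasActivity G lam μ) (hindep : ∀ᵐ I ∂μ, G.IsIndepSet I) (T : Finset V) :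
    μ.real {I | Disjoint I (outerBoundary G (T : Set V))} =
      partitionFunction G lam T *
        μ.real {I : Set V | I ∩ (T ∪ outerBoundary G (T : Set V)) = ∅} := by
  classical
  rw [setOf_disjoint_outerBoundary_eq_biUnion, measureReal_biUnion_finset ?_
    fun S _ => measurableSet_inter_eq _ _, partitionFunction, Finset.sum_filter, Finset.sum_mul]
  · refine Finset.sum_congr rfl fun S hS => ?_
    rw [Finset.mem_powerset] at hS
    split_ifs with h
    · exact hμ.real_inter_eq (subset_union_of_subset_left (by exact_mod_cast hS) _)
        (fun s hs u hu => mem_union_outerBoundary_of_adj (hS hs) hu) h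
    · rw [real_inter_eq_of_not_isIndepSet hindep _ h, zero_mul]
  · intro S _ S' _ hne
    refine Set.disjoint_left.2 fun I hI hI' => hne ?_
    exact Finset.coe_injective (hI.symm.trans hI')

theorem HasActivity.isGibbs [Countable V] [G.LocallyFinite] [IsProbabilityMeasure μ]
    (hμ : HasActivity G lam μ) (hindep : ∀ᵐ I ∂μ, G.IsIndepSet I)
    (hempty : ∀ W : Set V, W.Finite → μ.real {I | I ∩ W = ∅} ≠ 0) : IsGibbs G lam μ := by
  refine ⟨inferInstance, hindep, fun T _ S hST hS => ?_⟩
  have hST' : (S : Set V) ⊆ T := by exact_mod_cast hST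
  rw [cond_real_apply _ (measurableSet_disjoint _), hμ.real_disjoint_outerBoundary hindep,
    ← ofPred_and]
  simp only [disjoint_outerBoundary_and_inter_eq_iff hST']
  rw [hμ.real_inter_eq (subset_union_of_subset_left hST' _)
    (fun s hs u hu => mem_union_outerBoundary_of_adj (hST hs) hu) hS, ← div_eq_inv_mul,
    mul_div_mul_right _ _ (hempty _ (T.finite_toSet.union (finite_outerBoundary T)))]

end LocalCriterion

/-! ### Tree-indexed Markov chains -/

section TreeMeasure

variable {V : Type*} {G : SimpleGraph V} {a q : V → unitInterval}

/-- The distribution of the independent set that is broadcast from the root `r`, where the root is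
occupied with probability `a r`, and a vertex `v` with unoccupied parent with probability `q v`. -/
noncomputable def treeMeasure (G : SimpleGraph V) (a q : V → unitInterval) (r : V) :
    Measure (Set V) :=
  unitInterval.toNNReal (a r) • (coinMeasure q).map (broadcast G r true) +
    unitInterval.toNNReal (unitInterval.symm (a r)) • (coinMeasure q).map (broadcast G r false)

lemma isProbabilityMeasure_map_broadcast (hG : G.Connected) (r : V) (b : Bool) :
    IsProbabilityMeasure ((coinMeasure q).map (broadcast G r b)) :=
  Measure.isProbabilityMeasure_map (measurable_broadcast hG r b).aemeasurable

lemma isProbabilityMeasure_treeMeasure (hG : G.Connected) (r : V) :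
    IsProbabilityMeasure (treeMeasure G a q r) := by
  have := isProbabilityMeasure_map_broadcast (q := q) hG r
  constructor
  simp [treeMeasure]

lemma treeMeasure_real_apply (hG : G.Connected) (r : V) {E : Set (Set V)} (hE : MeasurableSet E) :
    (treeMeasure G a q r).real E =
      a r * (coinMeasure q).real {U | broadcast G r true U ∈ E} +
      (1 - a r) * (coinMeasure q).real {U | broadcast G r false U ∈ E} := by
  have := isProbabilityMeasure_map_broadcast (q := q) hG r
  rw [treeMeasure, measureReal_add_apply, measureReal_nnreal_smul_apply,
    measureReal_nnreal_smul_apply, map_measureReal_apply (measurable_broadcast hG r _) hE,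
    map_measureReal_apply (measurable_broadcast hG r _) hE]
  rfl

lemma treeMeasure_real_root (hG : G.Connected) (r : V) :
    (treeMeasure G a q r).real {I | r ∈ I} = a r := by
  rw [treeMeasure_real_apply hG r (measurableSet_mem r)]
  simp

lemma cond_treeMeasure_mem (hG : G.Connected) {r : V} (ha : 0 < a r) :
    cond (treeMeasure G a q r) {I | r ∈ I} = (coinMeasure q).map (broadcast G r true) := by
  have := isProbabilityMeasure_treeMeasure hG (a := a) (q := q) r
  have := isProbabilityMeasure_map_broadcast (q := q) hG r true
  refine measure_ext_of_measureReal fun E hE => ?_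
  have ha₀ : (a r : ℝ) ≠ 0 := ne_of_gt ha
  rw [cond_real_apply _ (measurableSet_mem r), treeMeasure_real_root hG,
    treeMeasure_real_apply hG r ((measurableSet_mem r).inter hE),
    map_measureReal_apply (measurable_broadcast hG r _) hE]
  simp [ha₀]
  rfl

lemma cond_treeMeasure_notMem (hG : G.Connected) {r : V} (ha : a r < 1) :
    cond (treeMeasure G a q r) {I | r ∉ I} = (coinMeasure q).map (broadcast G r false) := by
  have := isProbabilityMeasure_treeMeasure hG (a := a) (q := q) r
  have := isProbabilityMeasure_map_broadcast (q := q) hG r false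
  refine measure_ext_of_measureReal fun E hE => ?_
  have ha₁ : 1 - (a r : ℝ) ≠ 0 := (sub_pos.2 (show (a r : ℝ) < 1 from ha)).ne'
  have unoccupied : (treeMeasure G a q r).real {I | r ∉ I} = 1 - a r := by
    have h := probReal_compl_eq_one_sub (μ := treeMeasure G a q r) (measurableSet_mem r)
    rwa [treeMeasure_real_root hG] at h
  rw [cond_real_apply _ (measurableSet_notMem r), unoccupied,
    treeMeasure_real_apply hG r ((measurableSet_notMem r).inter hE),
    map_measureReal_apply (measurable_broadcast hG r _) hE]
  simp [ha₁]
  rfl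

lemma ae_isIndepSet_treeMeasure [Countable V] (hG : G.IsTree) (r : V) :
    ∀ᵐ I ∂(treeMeasure G a q r), G.IsIndepSet I := by
  have := isProbabilityMeasure_treeMeasure hG.connected (a := a) (q := q) r
  refine (measureReal_eq_zero_iff).1 ?_
  change (treeMeasure G a q r).real {I : Set V | G.IsIndepSet I}ᶜ = 0
  rw [treeMeasure_real_apply hG.connected r (measurableSet_isIndepSet G).compl]
  simp [isIndepSet_broadcast hG]

lemma iIndepFun_inter_branch_map_broadcast (hG : G.IsTree) (v : V) (b : Bool) :
    iIndepFun (fun (u : G.neighborSet v) (I : Set V) => I ∩ branch G v u)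
      ((coinMeasure q).map (broadcast G v b)) := by
  have hmeas := measurable_broadcast hG.connected v b
  refine iIndepFun_map hmeas (fun u => measurable_inter_const _)
    (iIndepFun_infinitePi_of_dependsOn _ (B := fun u : G.neighborSet v => branch G v u)
      (fun u => (measurable_inter_const _).comp hmeas) (fun u u' hne => ?_)
      fun u => dependsOn_broadcast_inter_branch hG u.2)
  exact disjoint_branch hG u.2 u'.2 fun h => hne (Subtype.ext h)

lemma hasActivity_treeMeasure_of_root [Countable V] [G.LocallyFinite] (hG : G.IsTree) {lam : ℝ}
    {r : V} (hlam : (a r : ℝ) = lam * (1 - a r) * ∏ u ∈ G.neighborFinset r, (1 - (q u : ℝ)))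
    {W S : Set V} (hrS : r ∉ S) (hrW : r ∈ W) (hW : ∀ u, G.Adj r u → u ∈ W)
    (hS : ∀ u, G.Adj r u → u ∉ S) :
    (treeMeasure G a q r).real {I | I ∩ W = insert r S} =
      lam * (treeMeasure G a q r).real {I | I ∩ W = S} := by
  set p := (coinMeasure q).real {U | broadcast G r true U ∩ W = insert r S}
  have occupied_ne : ∀ U, broadcast G r true U ∩ W ≠ S := fun U h => hrS (h ▸ ⟨by simp, hrW⟩)
  have unoccupied_ne : ∀ U, broadcast G r false U ∩ W ≠ insert r S := by
    intro U h
    have hr : r ∈ broadcast G r false U ∩ W := h ▸ mem_insert r S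
    simpa using hr.1
  have hindep : (coinMeasure q).real {U | broadcast G r false U ∩ W = S} =
      (∏ u ∈ G.neighborFinset r, (1 - (q u : ℝ))) * p := by
    simp only [broadcast_false_inter_eq_iff hG hrS hrW hW hS, ofPred_and]
    rw [← coinMeasure_real_forall_eq_false]
    simp only [← SimpleGraph.mem_neighborFinset]
    refine coinMeasure_real_inter_of_dependsOn q (measurableSet_coin_forall_eq _ false)
      (measurable_broadcast hG.connected r true (measurableSet_inter_eq W (insert r S)))
      (A := G.neighborSet r) (B := (G.neighborSet r)ᶜ) disjoint_compl_right
      (fun U U' h => ?_) fun U U' h => ?_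
    · simp only [mem_ofPred_eq, SimpleGraph.mem_neighborFinset, eq_iff_iff]
      exact forall₂_congr fun u hu => by rw [h u hu]
    · simp only [mem_ofPred_eq, dependsOn_broadcast_true hG h]
  simp only [treeMeasure_real_apply hG.connected r (measurableSet_inter_eq _ _), mem_ofPred_eq,
    occupied_ne, unoccupied_ne, ofPred_false, measureReal_empty, hindep]
  linear_combination p * hlam

lemma treeMeasure_real_inter_eq_empty_ne_zero [Countable V] (hG : G.Connected) {r : V}
    (ha : a r < 1) (hq : ∀ v, q v < 1) {W : Set V} (hW : W.Finite) :
    (treeMeasure G a q r).real {I | I ∩ W = ∅} ≠ 0 := by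
  lift W to Finset V using hW
  rw [treeMeasure_real_apply hG r (measurableSet_inter_eq _ _)]
  have empty_of_coins : (coinMeasure q).real {U | ∀ v ∈ W, U v = false} ≤
      (coinMeasure q).real {U | broadcast G r false U ∈ {I | I ∩ (W : Set V) = ∅}} := by
    refine measureReal_mono fun U (hU : ∀ v ∈ W, U v = false) => ?_
    refine Set.eq_empty_of_forall_notMem fun w ⟨hw, hwW⟩ => ?_
    have hwr : w ≠ r := by rintro rfl; simp at hw
    rw [mem_broadcast_iff hG hwr, hU w hwW] at hw
    simp at hw
  rw [coinMeasure_real_forall_eq_false] at empty_of_coins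
  have coins_pos : 0 < ∏ v ∈ W, (1 - (q v : ℝ)) :=
    Finset.prod_pos fun v _ => sub_pos.2 (show (q v : ℝ) < 1 from hq v)
  have ha' : 0 < 1 - (a r : ℝ) := sub_pos.2 (show (a r : ℝ) < 1 from ha)
  have := mul_pos ha' (coins_pos.trans_le empty_of_coins)
  have : 0 ≤ (a r : ℝ) := (a r).2.1
  positivity

section Consistent

variable (hG : G.IsTree) (hq : ∀ v w, G.Adj v w → (q w : ℝ) * (1 - a v) = a w)
include hG hq

lemma treeMeasure_eq_of_adj {o v : V} (h : G.Adj o v) :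
    treeMeasure G a q o = treeMeasure G a q v := by
  classical
  have := isProbabilityMeasure_treeMeasure hG.connected (a := a) (q := q)
  refine measure_ext_of_measureReal fun E hE => ?_
  have real_eq : ∀ o v, G.Adj o v → (treeMeasure G a q o).real E =
      a o * (coinMeasure q).real {U | broadcast G o true U ∈ E} +
      a v * (coinMeasure q).real {U | broadcast G v true U ∈ E} +
      (1 - a o - a v) * (coinMeasure q).real
        {U | broadcast G o false (Function.update U v false) ∈ E} := by
    intro o v h
    rw [treeMeasure_real_apply hG.connected o hE, coinMeasure_real_eq_add_update q v
      (E := {U | broadcast G o false U ∈ E}) (measurable_broadcast hG.connected o false hE)]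
    simp only [mem_ofPred_eq, broadcast_false_update_true hG h]
    rw [← hq o v h]
    ring
  rw [real_eq o v h, real_eq v o h.symm]
  simp only [broadcast_false_update_false hG h]
  ring

lemma treeMeasure_eq (o v : V) : treeMeasure G a q v = treeMeasure G a q o := by
  induction v using induction_on_treeParent hG.connected o with
  | root => rfl
  | step v hv ih => rw [← ih, treeMeasure_eq_of_adj hG hq (treeParent_spec hG.connected hv).1]

lemma treeMeasure_real_mem (o v : V) : (treeMeasure G a q o).real {I | v ∈ I} = a v := by
  rw [← treeMeasure_eq hG hq o v, treeMeasure_real_root hG.connected]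

lemma isSimpleMeasure_treeMeasure (ha : ∀ v, 0 < a v) (ha' : ∀ v, a v < 1) (o : V) :
    IsSimpleMeasure G (treeMeasure G a q o) := by
  intro v
  rw [← treeMeasure_eq hG hq o v, cond_treeMeasure_mem hG.connected (ha v),
    cond_treeMeasure_notMem hG.connected (ha' v)]
  exact ⟨iIndepFun_inter_branch_map_broadcast hG v true,
    iIndepFun_inter_branch_map_broadcast hG v false⟩

lemma isGibbs_treeMeasure [G.LocallyFinite] (ha : ∀ v, a v < 1) (hq' : ∀ v, q v < 1) {lam : ℝ}
    (hlam : ∀ v, (a v : ℝ) = lam * (1 - a v) * ∏ u ∈ G.neighborFinset v, (1 - (q u : ℝ))) (o : V) :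
    IsGibbs G lam (treeMeasure G a q o) := by
  have := countable_of_connected_of_locallyFinite hG.connected
  have := isProbabilityMeasure_treeMeasure hG.connected (a := a) (q := q) o
  have hactivity : HasActivity G lam (treeMeasure G a q o) := by
    intro r W S hrS hrW hW hS
    rw [← treeMeasure_eq hG hq o r]
    exact hasActivity_treeMeasure_of_root hG (hlam r) hrS hrW hW hS
  exact hactivity.isGibbs (ae_isIndepSet_treeMeasure hG o) fun W hW =>
    treeMeasure_real_inter_eq_empty_ne_zero hG.connected (ha o) hq' hW

end Consistent

end TreeMeasure

/-! ### Simple measures with equal densities -/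

section Uniqueness

variable {V : Type*} {G : SimpleGraph V}

lemma ext_of_real_inter_eq [Countable V] {P : Finset V → Prop}
    (hunion : ∀ W W' : Finset V, P W → P W' →
      ∃ W'' : Finset V, (W'' : Set V) = (W : Set V) ∪ (W' : Set V) ∧ P W'')
    (hcover : ∀ v, ∃ W, v ∈ W ∧ P W) {μ ν : Measure (Set V)} [IsProbabilityMeasure μ]
    [IsProbabilityMeasure ν]
    (h : ∀ W : Finset V, P W → ∀ S : Set V, μ.real {I | I ∩ W = S} = ν.real {I | I ∩ W = S}) :
    μ = ν := by
  let cylinders : Set (Set (Set V)) :=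
    {E | ∃ W : Finset V, P W ∧ ∃ S : Set V, E = {I | I ∩ (W : Set V) = S}}
  have isPiSystem : IsPiSystem cylinders := by
    rintro _ ⟨W, hW, S, rfl⟩ _ ⟨W', hW', S', rfl⟩ ⟨I₀, rfl, rfl⟩
    obtain ⟨W'', hWW', hW''⟩ := hunion W W' hW hW'
    refine ⟨W'', hW'', I₀ ∩ W'', ?_⟩
    ext I
    simp only [hWW', Set.ext_iff, mem_inter_iff, mem_ofPred_eq, mem_union]
    grind
  have generates : (inferInstance : MeasurableSpace (Set V)) = .generateFrom cylinders := by
    refine le_antisymm ?_ (MeasurableSpace.generateFrom_le ?_)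
    · have hid : @Measurable _ _ (.generateFrom cylinders) _ (fun I : Set V => I) := by
        refine (@measurable_set_iff _ _ (.generateFrom cylinders) _).2 fun v => ?_
        refine (@measurableSet_setOfPred _ (.generateFrom cylinders) _).1 ?_
        obtain ⟨W, hvW, hW⟩ := hcover v
        have mem_eq : {I : Set V | v ∈ I} =
            ⋃ S ∈ {S : Set V | S ⊆ W ∧ v ∈ S}, {I | I ∩ (W : Set V) = S} := by
          ext I
          simp [hvW]
        rw [mem_eq]
        exact .biUnion (W.finite_toSet.finite_subsets.subset fun S hS => hS.1).countable
          fun S _ => MeasurableSpace.measurableSet_generateFrom ⟨W, hW, S, rfl⟩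
      exact fun E hE => hid hE
    · rintro _ ⟨W, -, S, rfl⟩
      exact measurableSet_inter_eq _ _
  refine ext_of_generate_finite cylinders generates isPiSystem ?_ (by simp)
  rintro _ ⟨W, hW, S, rfl⟩
  exact (measureReal_eq_measureReal_iff).1 (h W hW S)

lemma inter_insert_eq_iff {W I S : Set V} {w : V} (hw : w ∉ W) :
    I ∩ insert w W = S ↔ I ∩ W = S \ {w} ∧ (w ∈ I ↔ w ∈ S) := by
  simp only [Set.ext_iff, mem_inter_iff, mem_insert_iff, Set.mem_sdiff, mem_singleton_iff]
  grind

lemma real_inter_insert_eq {μ ν : Measure (Set V)} [IsFiniteMeasure μ] [IsFiniteMeasure ν]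
    {W : Set V} {w : V} (hw : w ∉ W)
    (h : ∀ S : Set V, μ.real {I | I ∩ W = S} = ν.real {I | I ∩ W = S})
    (hmem : ∀ S : Set V,
      μ.real ({I | I ∩ W = S} ∩ {I | w ∈ I}) = ν.real ({I | I ∩ W = S} ∩ {I | w ∈ I})) (S : Set V) :
    μ.real {I | I ∩ insert w W = S} = ν.real {I | I ∩ insert w W = S} := by
  simp only [inter_insert_eq_iff hw]
  by_cases hwS : w ∈ S
  · simp only [hwS, iff_true]
    exact hmem (S \ {w})
  · simp only [hwS, iff_false]
    have hμ := measureReal_inter_add_sdiff (μ := μ) (s := {I : Set V | I ∩ W = S \ {w}})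
      (measurableSet_mem w)
    have hν := measureReal_inter_add_sdiff (μ := ν) (s := {I : Set V | I ∩ W = S \ {w}})
      (measurableSet_mem w)
    have heq := h (S \ {w})
    have heq' := hmem (S \ {w})
    change μ.real ({I | I ∩ W = S \ {w}} \ {I | w ∈ I}) =
      ν.real ({I | I ∩ W = S \ {w}} \ {I | w ∈ I})
    linarith

lemma exists_finset_mapsTo_treeParent (hG : G.Connected) (o v : V) :
    ∃ W : Finset V, v ∈ W ∧ MapsTo (treeParent G o) W W := by
  classical
  induction v using induction_on_treeParent hG o with
  | root => exact ⟨{o}, by simp, by simp [treeParent_self]⟩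
  | step v _ ih =>
    obtain ⟨W, hpW, hW⟩ := ih
    refine ⟨insert v W, Finset.mem_insert_self _ _, ?_⟩
    simp only [MapsTo, Finset.coe_insert, forall_mem_insert]
    exact ⟨mem_insert_of_mem _ hpW, hW.mono_right (subset_insert _ _)⟩

open Classical in
lemma finset_induction_on_treeParent (hG : G.Connected) (o : V) {motive : Finset V → Prop}
    (empty : motive ∅) (root : motive {o})
    (insert : ∀ (w : V) (W : Finset V), w ≠ o → w ∉ W → treeParent G o w ∈ W →
      MapsTo (treeParent G o) W W → motive W → motive (insert w W))
    (W : Finset V) (hW : MapsTo (treeParent G o) W W) : motive W := by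
  induction W using Finset.induction_on_max_value (fun x => G.dist o x) with
  | empty => exact empty
  | insert w W hw hmax ih =>
    simp only [MapsTo, Finset.coe_insert, forall_mem_insert] at hW
    rcases eq_or_ne w o with rfl | hwo
    · have hWempty : W = ∅ := by
        refine Finset.eq_empty_of_forall_notMem fun x hx => hw ?_
        have hdist := hmax x hx
        rw [SimpleGraph.dist_self, Nat.le_zero, hG.dist_eq_zero_iff] at hdist
        exact hdist ▸ hx
      simpa [hWempty] using root
    · have hWW : MapsTo (treeParent G o) W W := by
        intro x hx
        refine (hW.2 x hx).resolve_left fun hxw => ?_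
        have hxo : x ≠ o := by
          rintro rfl
          exact hwo (hxw ▸ treeParent_self x)
        have hdist := (treeParent_spec hG hxo).2
        rw [hxw] at hdist
        exact absurd (hmax x hx) (by lia)
      exact insert w W hwo hw (hW.1.resolve_left (treeParent_spec hG hwo).1.ne) hWW (ih hWW)

lemma disjoint_branch_of_mapsTo_treeParent (hG : G.IsTree) {o w : V} (hwo : w ≠ o) {W : Set V}
    (hw : w ∉ W) (hW : MapsTo (treeParent G o) W W) :
    Disjoint W (branch G (treeParent G o w) w) := by
  obtain ⟨hadj, hd⟩ := treeParent_spec hG.connected hwo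
  have ho : o ∉ branch G (treeParent G o w) w := by
    simp only [branch, mem_ofPred_eq, SimpleGraph.dist_comm (v := o)]
    lia
  refine Set.disjoint_left.2 fun x => ?_
  induction x using induction_on_treeParent hG.connected o with
  | root => exact fun _ => ho
  | step x _ ih =>
    intro hxW hxb
    refine ih (hW hxW) (treeParent_mem_branch hG hadj ho hxb ?_)
    rintro rfl
    exact hw hxW

lemma sdiff_insert_branch_eq_iUnion (hG : G.IsTree) {v w : V} (h : G.Adj v w) (I : Set V) :
    I \ insert v (branch G v w) = ⋃ u : {u : G.neighborSet v // u.1 ≠ w}, I ∩ branch G v u.1 := by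
  ext x
  simp only [Set.mem_sdiff, mem_insert_iff, not_or, mem_iUnion, mem_inter_iff, exists_and_left,
    and_congr_right_iff]
  rintro -
  constructor
  · rintro ⟨hxv, hxw⟩
    have hadj := (treeParent_spec hG.connected (Ne.symm hxv)).1.symm
    refine ⟨⟨⟨treeParent G x v, hadj⟩, fun hw : treeParent G x v = w => ?_⟩,
      (mem_branch_iff hG hadj).2 ⟨hxv, rfl⟩⟩
    exact hxw ((mem_branch_iff hG h).2 ⟨hxv, hw⟩)
  · rintro ⟨⟨⟨u, hu⟩, huw⟩, hx⟩
    exact ⟨((mem_branch_iff hG hu).1 hx).1, Set.disjoint_left.1 (disjoint_branch hG hu h huw) hx⟩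

variable {μ ν : Measure (Set V)}

lemma IsSimpleMeasure.indepFun_inter_branch [G.LocallyFinite] (hs : IsSimpleMeasure G μ)
    (hG : G.IsTree) {v w : V} (h : G.Adj v w) :
    IndepFun (fun I => I ∩ branch G v w) (fun I => I \ insert v (branch G v w))
      (cond μ {I | v ∉ I}) := by
  classical
  let others : Finset (G.neighborSet v) := {u | u.1 ≠ w}
  have hindep := (hs v).2.indepFun_finset {⟨w, h⟩} others (by simp [others])
    fun u => measurable_inter_const _
  have hunion : Measurable fun g : others → Set V => ⋃ u : others, g u := by
    refine measurable_set_iff.2 fun x => ?_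
    simp only [mem_iUnion]
    exact .exists fun u => (measurable_set_mem x).comp (measurable_pi_apply u)
  refine (hindep.comp (measurable_pi_apply ⟨⟨w, h⟩, by simp⟩) hunion).congr ?_ ?_
  · exact .of_forall fun I => rfl
  · refine .of_forall fun I => ?_
    simp only [sdiff_insert_branch_eq_iUnion hG h, Function.comp_apply]
    ext x
    simp [others]

lemma real_notMem [IsProbabilityMeasure μ] (v : V) :
    μ.real {I | v ∉ I} = 1 - μ.real {I | v ∈ I} :=
  probReal_compl_eq_one_sub (measurableSet_mem v)

lemma real_notMem_inter_mem (hindep : ∀ᵐ I ∂μ, G.IsIndepSet I) {v w : V} (h : G.Adj v w) :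
    μ.real ({I | v ∉ I} ∩ {I | w ∈ I}) = μ.real {I | w ∈ I} := by
  refine measureReal_congr ?_
  filter_upwards [hindep] with I hI
  exact propext ⟨fun hvw => hvw.2, fun hw => ⟨fun hv => hI hv hw h.ne h, hw⟩⟩

lemma IsSimpleMeasure.real_inter_eq_mul_of_adj [G.LocallyFinite] [IsProbabilityMeasure μ]
    (hs : IsSimpleMeasure G μ) (hG : G.IsTree) (hindep : ∀ᵐ I ∂μ, G.IsIndepSet I) {v w : V}
    (h : G.Adj v w) (hv : μ.real {I | v ∈ I} < 1) {W S : Set V} (hvW : v ∈ W)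
    (hW : Disjoint W (branch G v w)) (hvS : v ∉ S) :
    μ.real ({I | I ∩ W = S} ∩ {I | w ∈ I}) * (1 - μ.real {I | v ∈ I}) =
      μ.real {I | I ∩ W = S} * μ.real {I | w ∈ I} := by
  have := countable_of_connected_of_locallyFinite hG.connected
  have hprod := (hs.indepFun_inter_branch hG h).measure_inter_preimage_eq_mul {J | w ∈ J}
    {J | J ∩ W = S} (measurableSet_mem w) (measurableSet_inter_eq W S)
  have mem_preimage_left :
      (fun I => I ∩ branch G v w) ⁻¹' {J | w ∈ J} = {I : Set V | w ∈ I} := by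
    ext I
    simp [self_mem_branch h]
  have inter_preimage_right :
      {I : Set V | v ∉ I} ∩ (fun I => I \ insert v (branch G v w)) ⁻¹' {J | J ∩ W = S} =
        {I | I ∩ W = S} := by
    ext I
    have hW' : ∀ x ∈ W, x ∉ branch G v w := fun x hx => Set.disjoint_left.1 hW hx
    simp only [mem_inter_iff, mem_preimage, mem_ofPred_eq, Set.ext_iff, Set.mem_sdiff,
      mem_insert_iff]
    grind
  have hprod' := congrArg ENNReal.toReal hprod
  simp only [ENNReal.toReal_mul, ← measureReal_def] at hprod'
  rw [cond_real_apply _ (measurableSet_notMem v), cond_real_apply _ (measurableSet_notMem v),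
    cond_real_apply _ (measurableSet_notMem v), inter_left_comm, inter_preimage_right,
    mem_preimage_left, real_notMem_inter_mem hindep h, real_notMem, inter_comm] at hprod'
  have hv' : 1 - μ.real {I | v ∈ I} ≠ 0 := by linarith
  field_simp at hprod'
  linarith

section Ext

variable [G.LocallyFinite] [IsProbabilityMeasure μ] [IsProbabilityMeasure ν] (hG : G.IsTree)
  (hμi : ∀ᵐ I ∂μ, G.IsIndepSet I) (hνi : ∀ᵐ I ∂ν, G.IsIndepSet I)
  (hμs : IsSimpleMeasure G μ) (hνs : IsSimpleMeasure G ν)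
  (heq : ∀ v, μ.real {I | v ∈ I} = ν.real {I | v ∈ I}) (hlt : ∀ v, μ.real {I | v ∈ I} < 1)
include hG hμi hνi hμs hνs heq hlt

lemma IsSimpleMeasure.real_inter_mem_eq {v w : V} (h : G.Adj v w) {W : Set V} (hvW : v ∈ W)
    (hW : Disjoint W (branch G v w)) (S : Set V)
    (hS : μ.real {I | I ∩ W = S} = ν.real {I | I ∩ W = S}) :
    μ.real ({I | I ∩ W = S} ∩ {I | w ∈ I}) = ν.real ({I | I ∩ W = S} ∩ {I | w ∈ I}) := by
  by_cases hvS : v ∈ S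
  · have not_indep : ∀ I ∈ {I : Set V | I ∩ W = S} ∩ {I | w ∈ I}, ¬ G.IsIndepSet I := by
      rintro I ⟨rfl, hwI⟩ hI
      exact hI hvS.1 hwI h.ne h
    rw [real_eq_zero_of_forall_not_isIndepSet hμi not_indep,
      real_eq_zero_of_forall_not_isIndepSet hνi not_indep]
  · have hμ := hμs.real_inter_eq_mul_of_adj hG hμi h (hlt v) hvW hW hvS
    have hν := hνs.real_inter_eq_mul_of_adj hG hνi h (heq v ▸ hlt v) hvW hW hvS
    rw [hS, heq, heq, ← hν] at hμ
    exact mul_right_cancel₀ (sub_pos.2 (heq v ▸ hlt v)).ne' hμ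

lemma IsSimpleMeasure.real_inter_eq (o : V) (W : Finset V) (hW : MapsTo (treeParent G o) W W)
    (S : Set V) : μ.real {I | I ∩ (W : Set V) = S} = ν.real {I | I ∩ (W : Set V) = S} := by
  classical
  have real_empty : ∀ S : Set V, μ.real {I | I ∩ ∅ = S} = ν.real {I | I ∩ ∅ = S} := by
    intro S
    rcases eq_or_ne ∅ S with rfl | hS <;> simp [*]
  refine finset_induction_on_treeParent hG.connected o
    (motive := fun W => ∀ S, μ.real {I | I ∩ (W : Set V) = S} = ν.real {I | I ∩ (W : Set V) = S})
    (by simpa using real_empty) ?_ (fun w W hwo hw hpW hW ih => ?_) W hW S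
  · intro S
    rw [← insert_empty_eq, Finset.coe_insert, Finset.coe_empty]
    refine real_inter_insert_eq (notMem_empty o) real_empty (fun S => ?_) S
    rcases eq_or_ne ∅ S with rfl | hS <;> simp [*]
  · rw [← Finset.mem_coe] at hw
    rw [Finset.coe_insert]
    exact real_inter_insert_eq hw ih fun S =>
      IsSimpleMeasure.real_inter_mem_eq hG hμi hνi hμs hνs heq hlt
        (treeParent_spec hG.connected hwo).1 hpW
        (disjoint_branch_of_mapsTo_treeParent hG hwo hw hW) S (ih S)

theorem IsSimpleMeasure.ext : μ = ν := by
  classical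
  have := countable_of_connected_of_locallyFinite hG.connected
  obtain ⟨o⟩ := hG.connected.nonempty
  refine ext_of_real_inter_eq (P := fun W => MapsTo (treeParent G o) W W)
    (fun W W' hW hW' => ⟨W ∪ W', by simp, ?_⟩) (exists_finset_mapsTo_treeParent hG.connected o)
    (IsSimpleMeasure.real_inter_eq hG hμi hνi hμs hνs heq hlt o)
  rw [Finset.coe_union]
  exact hW.union_union hW'

end Ext

end Uniqueness

/-! ### Invariance under automorphisms -/

section Invariance

lemma cond_map {Ω Ω' : Type*} [MeasurableSpace Ω] [MeasurableSpace Ω'] (μ : Measure Ω)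
    {g : Ω → Ω'} (hg : Measurable g) {E : Set Ω'} (hE : MeasurableSet E) :
    cond (μ.map g) E = (cond μ (g ⁻¹' E)).map g := by
  ext A hA
  rw [cond_apply hE, Measure.map_apply hg hE, Measure.map_apply hg (hE.inter hA),
    Measure.map_apply hg hA, cond_apply (hg hE), preimage_inter]

variable {V : Type*} {G : SimpleGraph V}

lemma dist_iso_apply (hG : G.Connected) (φ : G ≃g G) (u v : V) :
    G.dist (φ u) (φ v) = G.dist u v := by
  have dist_apply_le (ψ : G ≃g G) (u v : V) : G.dist (ψ u) (ψ v) ≤ G.dist u v := by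
    obtain ⟨p, hp⟩ := hG.exists_walk_length_eq_dist u v
    rw [← hp, ← p.length_map ψ.toHom]
    exact SimpleGraph.dist_le (p.map ψ.toHom)
  refine le_antisymm (dist_apply_le φ u v) ?_
  simpa using dist_apply_le φ.symm (φ u) (φ v)

lemma mem_image_iso (φ : G ≃g G) (I : Set V) (v : V) : v ∈ φ '' I ↔ φ.symm v ∈ I :=
  mem_image_iff_of_inverse φ.symm_apply_apply φ.apply_symm_apply

lemma measurable_image_iso (φ : G ≃g G) : Measurable fun I : Set V => φ '' I := by
  refine measurable_set_iff.2 fun v => ?_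
  simp only [mem_image_iso]
  exact measurable_set_mem _

lemma preimage_image_iso_mem (φ : G ≃g G) (v : V) :
    (fun I : Set V => φ '' I) ⁻¹' {I | v ∈ I} = {I | φ.symm v ∈ I} := by
  ext I
  exact mem_image_iso φ I v

lemma map_image_iso_real_mem (φ : G ≃g G) (μ : Measure (Set V)) (v : V) :
    (μ.map fun I => φ '' I).real {I | v ∈ I} = μ.real {I | φ.symm v ∈ I} := by
  rw [map_measureReal_apply (measurable_image_iso φ) (measurableSet_mem v),
    preimage_image_iso_mem]

lemma image_iso_inter_branch (hG : G.Connected) (φ : G ≃g G) (v u : V) (I : Set V) :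
    φ '' I ∩ branch G v u = φ '' (I ∩ branch G (φ.symm v) (φ.symm u)) := by
  ext x
  simp only [mem_inter_iff, mem_image_iso, branch, mem_ofPred_eq, dist_iso_apply hG φ.symm]

lemma iIndepFun_inter_branch_map_iso (hG : G.Connected) (φ : G ≃g G) {v : V}
    {ρ : Measure (Set V)}
    (h : iIndepFun
      (fun (u : G.neighborSet (φ.symm v)) (I : Set V) => I ∩ branch G (φ.symm v) u) ρ) :
    iIndepFun (fun (u : G.neighborSet v) (I : Set V) => I ∩ branch G v u)
      (ρ.map fun I => φ '' I) := by
  refine iIndepFun_map (measurable_image_iso φ) (fun u => measurable_inter_const _) ?_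
  have hinj : Function.Injective (fun u : G.neighborSet v =>
      (⟨φ.symm u, φ.symm.map_adj_iff.2 u.2⟩ : G.neighborSet (φ.symm v))) :=
    fun u u' huu' => Subtype.ext (φ.symm.injective (congrArg Subtype.val huu'))
  convert (h.precomp hinj).comp (fun _ J => φ '' J) fun _ => measurable_image_iso φ using 2 with u
  ext1 I
  exact image_iso_inter_branch hG φ v u I

lemma IsSimpleMeasure.map_iso (hG : G.Connected) {μ : Measure (Set V)} (hs : IsSimpleMeasure G μ)
    (φ : G ≃g G) : IsSimpleMeasure G (μ.map fun I => φ '' I) := by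
  intro v
  have preimage_notMem : (fun I : Set V => φ '' I) ⁻¹' {I | v ∉ I} = {I | φ.symm v ∉ I} :=
    congrArg compl (preimage_image_iso_mem φ v)
  rw [cond_map _ (measurable_image_iso φ) (measurableSet_mem v),
    cond_map _ (measurable_image_iso φ) (measurableSet_notMem v), preimage_image_iso_mem,
    preimage_notMem]
  exact (hs (φ.symm v)).imp (iIndepFun_inter_branch_map_iso hG φ)
    (iIndepFun_inter_branch_map_iso hG φ)

lemma ae_isIndepSet_map_iso {μ : Measure (Set V)} [Countable V]
    (hindep : ∀ᵐ I ∂μ, G.IsIndepSet I) (φ : G ≃g G) :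
    ∀ᵐ I ∂(μ.map fun I => φ '' I), G.IsIndepSet I := by
  rw [ae_map_iff (measurable_image_iso φ).aemeasurable (measurableSet_isIndepSet G)]
  filter_upwards [hindep] with I hI
  rintro _ ⟨x, hx, rfl⟩ _ ⟨y, hy, rfl⟩ hne hadj
  exact hI hx hy (ne_of_apply_ne φ hne) (φ.map_adj_iff.1 hadj)

lemma IsSimpleMeasure.map_iso_eq [G.LocallyFinite] (hG : G.IsTree) {μ : Measure (Set V)}
    [IsProbabilityMeasure μ] (hindep : ∀ᵐ I ∂μ, G.IsIndepSet I) (hs : IsSimpleMeasure G μ)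
    (hlt : ∀ v, μ.real {I | v ∈ I} < 1) (φ : G ≃g G)
    (hφ : ∀ v, μ.real {I | φ v ∈ I} = μ.real {I | v ∈ I}) : μ.map (fun I => φ '' I) = μ := by
  have := countable_of_connected_of_locallyFinite hG.connected
  have := Measure.isProbabilityMeasure_map (μ := μ) (measurable_image_iso φ).aemeasurable
  have heq (v : V) : (μ.map fun I => φ '' I).real {I | v ∈ I} = μ.real {I | v ∈ I} := by
    rw [map_image_iso_real_mem, ← hφ (φ.symm v), φ.apply_symm_apply]
  exact IsSimpleMeasure.ext hG (ae_isIndepSet_map_iso hindep φ) hindep (hs.map_iso hG.connected φ)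
    hs heq fun v => heq v ▸ hlt v

lemma real_mem_iso_apply {μ : Measure (Set V)} (φ : G ≃g G) (h : μ.map (fun I => φ '' I) = μ)
    (v : V) : μ.real {I | φ v ∈ I} = μ.real {I | v ∈ I} := by
  conv_lhs => rw [← h]
  rw [map_image_iso_real_mem, φ.symm_apply_apply]

lemma IsTranslationInvariant.real_mem_eq [G.LocallyFinite] (hG : G.IsTree) {d : ℕ}
    (hreg : G.IsRegularOfDegree d) {μ : Measure (Set V)} (h : IsTranslationInvariant G μ)
    (v w : V) : μ.real {I | v ∈ I} = μ.real {I | w ∈ I} := by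
  obtain ⟨φ, rfl⟩ := exists_iso_apply_eq_of_isRegularOfDegree hG hG hreg hreg w v
  exact real_mem_iso_apply φ (h φ) w

lemma IsSemiTranslationInvariant.real_mem_eq [G.LocallyFinite] (hG : G.IsTree) {d : ℕ}
    (hreg : G.IsRegularOfDegree d) {o : V} {μ : Measure (Set V)}
    (h : IsSemiTranslationInvariant G o μ) {v w : V}
    (hvw : IsEvenVertex G o v ↔ IsEvenVertex G o w) :
    μ.real {I | v ∈ I} = μ.real {I | w ∈ I} := by
  obtain ⟨φ, rfl⟩ := exists_iso_apply_eq_of_isRegularOfDegree hG hG hreg hreg w v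
  exact real_mem_iso_apply φ (h φ (isEvenVertex_apply_iff hG o φ hvw)) w

end Invariance

/-! ### The recursion for the densities of a simple Gibbs measure -/

section GibbsEquations

variable {V : Type*} {G : SimpleGraph V}

lemma partitionFunction_singleton (G : SimpleGraph V) (lam : ℝ) (v : V) :
    partitionFunction G lam {v} = 1 + lam := by
  classical
  have isIndepSet_of_subset : ∀ S ∈ ({v} : Finset V).powerset, G.IsIndepSet (S : Set V) := by
    intro S hS
    exact Set.Subsingleton.pairwise
      (subsingleton_singleton.anti (by exact_mod_cast Finset.mem_powerset.1 hS)) _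
  rw [partitionFunction, Finset.filter_true_of_mem isIndepSet_of_subset,
    ← insert_empty_eq, Finset.sum_powerset_insert (by simp)]
  simp

lemma setOf_disjoint_outerBoundary_singleton (G : SimpleGraph V) (v : V) :
    {I | Disjoint I (outerBoundary G {v})} = {I : Set V | ∀ u, G.Adj v u → u ∉ I} := by
  ext I
  simp only [mem_ofPred_eq, Set.disjoint_right, outerBoundary, mem_singleton_iff, exists_eq_left]
  exact ⟨fun h u hu => h ⟨hu.ne', hu⟩, fun h u hu => h u hu.2⟩

section Gibbs

variable [Countable V] {lam : ℝ} {μ : Measure (Set V)}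

lemma IsGibbs.cond_inter_singleton_eq (hμ : IsGibbs G lam μ) (v : V) {S : Finset V}
    (hS : S ⊆ {v}) :
    (μ.real {I | ∀ u, G.Adj v u → u ∉ I})⁻¹ *
      μ.real ({I | ∀ u, G.Adj v u → u ∉ I} ∩ {I | I ∩ {v} = S}) = lam ^ S.card / (1 + lam) := by
  have isTree_singleton : (G.induce (({v} : Finset V) : Set V)).IsTree := by
    have : Subsingleton (({v} : Finset V) : Set V) := by simp
    have : Nonempty (({v} : Finset V) : Set V) := by simp
    exact SimpleGraph.IsTree.of_subsingleton
  have isIndepSet : G.IsIndepSet (S : Set V) :=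
    Set.Subsingleton.pairwise (subsingleton_singleton.anti (by exact_mod_cast hS)) _
  have hcond := hμ.cond_eq {v} isTree_singleton S hS isIndepSet
  rwa [cond_real_apply _ (measurableSet_disjoint _), Finset.coe_singleton,
    setOf_disjoint_outerBoundary_singleton, partitionFunction_singleton] at hcond

lemma IsGibbs.real_forall_adj_notMem_pos (hlam : 0 < lam) (hμ : IsGibbs G lam μ) (v : V) :
    0 < μ.real {I | ∀ u, G.Adj v u → u ∉ I} := by
  refine measureReal_nonneg.lt_of_ne fun hzero => ?_
  have hcond := hμ.cond_inter_singleton_eq v (Finset.empty_subset _)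
  rw [← hzero, inv_zero, zero_mul] at hcond
  exact absurd hcond (by positivity)

lemma IsGibbs.real_notMem_inter_forall_adj_notMem (hlam : 0 < lam) (hμ : IsGibbs G lam μ) (v : V) :
    μ.real ({I | v ∉ I} ∩ {I | ∀ u, G.Adj v u → u ∉ I}) =
      μ.real {I | ∀ u, G.Adj v u → u ∉ I} / (1 + lam) := by
  have hcond := hμ.cond_inter_singleton_eq v (Finset.empty_subset _)
  rw [inv_mul_eq_iff_eq_mul₀ (hμ.real_forall_adj_notMem_pos hlam v).ne', inter_comm] at hcond
  simpa [div_eq_mul_inv] using hcond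

lemma IsGibbs.real_mem_eq_mul (hlam : 0 < lam) (hμ : IsGibbs G lam μ) (v : V) :
    μ.real {I | v ∈ I} = lam * μ.real ({I | v ∉ I} ∩ {I | ∀ u, G.Adj v u → u ∉ I}) := by
  have hcond := hμ.cond_inter_singleton_eq v subset_rfl
  have inter_eq_mem : μ.real ({I | ∀ u, G.Adj v u → u ∉ I} ∩
      {I | I ∩ {v} = (({v} : Finset V) : Set V)}) = μ.real {I | v ∈ I} := by
    refine measureReal_congr ?_
    filter_upwards [hμ.ae_isIndepSet] with I hI
    refine propext ⟨fun h => ?_, fun h => ⟨fun u hu hu' => hI h hu' hu.ne hu, ?_⟩⟩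
    · exact (h.2.symm ▸ (by simp) : v ∈ I ∩ {v}).1
    · simpa using show v ∈ I from h
  rw [inv_mul_eq_iff_eq_mul₀ (hμ.real_forall_adj_notMem_pos hlam v).ne', inter_eq_mem] at hcond
  rw [hcond, hμ.real_notMem_inter_forall_adj_notMem hlam]
  simp
  ring

lemma IsGibbs.real_mem_pos (hlam : 0 < lam) (hμ : IsGibbs G lam μ) (v : V) :
    0 < μ.real {I | v ∈ I} := by
  have hpos := hμ.real_forall_adj_notMem_pos hlam v
  rw [hμ.real_mem_eq_mul hlam, hμ.real_notMem_inter_forall_adj_notMem hlam]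
  positivity

lemma IsGibbs.real_mem_lt_one (hlam : 0 < lam) (hμ : IsGibbs G lam μ) (v : V) :
    μ.real {I | v ∈ I} < 1 := by
  have := hμ.isProbabilityMeasure
  have hle : μ.real ({I | v ∉ I} ∩ {I | ∀ u, G.Adj v u → u ∉ I}) ≤ μ.real {I | v ∉ I} :=
    measureReal_mono inter_subset_left
  have hpos := hμ.real_mem_pos hlam v
  rw [hμ.real_mem_eq_mul hlam] at hpos
  linarith [pos_of_mul_pos_right hpos hlam.le, real_notMem (μ := μ) v]

lemma IsGibbs.real_mem_add_real_mem_lt_one (hlam : 0 < lam) (hμ : IsGibbs G lam μ) {v u : V}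
    (h : G.Adj v u) : μ.real {I | v ∈ I} + μ.real {I | u ∈ I} < 1 := by
  have := hμ.isProbabilityMeasure
  have hle : μ.real ({I | v ∉ I} ∩ {I | ∀ u, G.Adj v u → u ∉ I}) ≤
      μ.real ({I | v ∉ I} \ {I | u ∈ I}) :=
    measureReal_mono fun I hI => ⟨hI.1, hI.2 u h⟩
  have hsplit := measureReal_inter_add_sdiff (μ := μ) (s := {I | v ∉ I}) (measurableSet_mem u)
  rw [real_notMem_inter_mem hμ.ae_isIndepSet h, real_notMem] at hsplit
  have hpos := hμ.real_mem_pos hlam v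
  rw [hμ.real_mem_eq_mul hlam] at hpos
  linarith [pos_of_mul_pos_right hpos hlam.le]

end Gibbs

lemma IsSimpleMeasure.real_notMem_inter_forall_adj_notMem [G.LocallyFinite]
    {μ : Measure (Set V)} [IsProbabilityMeasure μ] (hindep : ∀ᵐ I ∂μ, G.IsIndepSet I)
    (hs : IsSimpleMeasure G μ) {v : V} (hv : μ.real {I | v ∈ I} < 1) :
    μ.real ({I | v ∉ I} ∩ {I | ∀ u, G.Adj v u → u ∉ I}) = (1 - μ.real {I | v ∈ I}) *
      ∏ u ∈ G.neighborFinset v, (1 - μ.real {I | u ∈ I} / (1 - μ.real {I | v ∈ I})) := by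
  have measurable_branch (u : G.neighborSet v) :
      MeasurableSet[.comap (fun I => I ∩ branch G v u) inferInstance]
        {I : Set V | (u : V) ∉ I} := by
    refine ⟨{J | (u : V) ∉ J}, measurableSet_notMem _, ?_⟩
    ext I
    simp [self_mem_branch u.2]
  have cond_notMem (u : G.neighborSet v) : (cond μ {I | v ∉ I}).real {I | (u : V) ∉ I} =
      1 - μ.real {I | (u : V) ∈ I} / (1 - μ.real {I | v ∈ I}) := by
    have := (hs v).2.isProbabilityMeasure
    rw [real_notMem, cond_real_apply _ (measurableSet_notMem v),
      real_notMem_inter_mem hindep u.2, real_notMem, inv_mul_eq_div]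
  have iInter_eq : (⋂ u : G.neighborSet v, {I : Set V | (u : V) ∉ I}) =
      {I : Set V | ∀ u, G.Adj v u → u ∉ I} := by
    ext I
    simp
  have hprod := congrArg ENNReal.toReal ((hs v).2.meas_iInter measurable_branch)
  simp only [ENNReal.toReal_prod, ← measureReal_def, iInter_eq, cond_notMem] at hprod
  rw [cond_real_apply _ (measurableSet_notMem v), real_notMem,
    inv_mul_eq_iff_eq_mul₀ (sub_pos.2 hv).ne'] at hprod
  rw [hprod, Finset.prod_subtype (G.neighborFinset v) (p := (· ∈ G.neighborSet v)) (by simp)]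

theorem IsGibbs.real_mem_eq_mul_prod [G.LocallyFinite] [Countable V] {lam : ℝ} (hlam : 0 < lam)
    {μ : Measure (Set V)} (hμ : IsGibbs G lam μ) (hs : IsSimpleMeasure G μ) (v : V) :
    μ.real {I | v ∈ I} = lam * (1 - μ.real {I | v ∈ I}) *
      ∏ u ∈ G.neighborFinset v, (1 - μ.real {I | u ∈ I} / (1 - μ.real {I | v ∈ I})) := by
  have := hμ.isProbabilityMeasure
  rw [mul_assoc, ← hs.real_notMem_inter_forall_adj_notMem hμ.ae_isIndepSet
    (hμ.real_mem_lt_one hlam v)]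
  exact hμ.real_mem_eq_mul hlam v

end GibbsEquations

/-! ### The density equations -/

section DensityEquations

/-- A pair of densities of the two parity classes that solves the hard-core recursion on the
`(k + 1)`-regular tree. These are the interior stationary points of the exponent. -/
structure IsDensityPair (k : ℕ) (lam α β : ℝ) : Prop where
  pos_left : 0 < α
  pos_right : 0 < β
  add_lt_one : α + β < 1
  eq_left : α * (1 - α) ^ k = lam * (1 - α - β) ^ (k + 1)
  eq_right : β * (1 - β) ^ k = lam * (1 - α - β) ^ (k + 1)

variable {k : ℕ} {lam α β : ℝ}

lemma IsDensityPair.symm (h : IsDensityPair k lam α β) : IsDensityPair k lam β α where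
  pos_left := h.pos_right
  pos_right := h.pos_left
  add_lt_one := by linarith [h.add_lt_one]
  eq_left := by rw [h.eq_right]; ring
  eq_right := by rw [h.eq_left]; ring

/-- Dividing by the probability `1 - α - β` that an edge is vacant decouples the equations. -/
lemma IsDensityPair.exists_ratio (h : IsDensityPair k lam α β) :
    ∃ x y : ℝ, 0 < x ∧ 0 < y ∧ x * (1 + y) ^ k = lam ∧ y * (1 + x) ^ k = lam ∧
      α = x / (1 + x + y) ∧ β = y / (1 + x + y) := by
  obtain ⟨hα, hβ, hlt, hleft, hright⟩ := h
  have hz : 0 < 1 - α - β := by linarith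
  set z := 1 - α - β with hzdef
  have one_add_right : 1 + β / z = (1 - α) / z := by field_simp; rw [hzdef]; ring
  have one_add_left : 1 + α / z = (1 - β) / z := by field_simp; rw [hzdef]; ring
  have one_add_add : 1 + α / z + β / z = 1 / z := by field_simp; rw [hzdef]; ring
  refine ⟨α / z, β / z, div_pos hα hz, div_pos hβ hz, ?_, ?_, ?_, ?_⟩
  · rw [one_add_right, div_pow, div_mul_div_comm, hleft, ← pow_succ', mul_div_cancel_right₀]
    positivity
  · rw [one_add_left, div_pow, div_mul_div_comm, hright, ← pow_succ', mul_div_cancel_right₀]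
    positivity
  · rw [one_add_add]; field_simp
  · rw [one_add_add]; field_simp

lemma isDensityPair_of_ratio {x y : ℝ} (hx : 0 < x) (hy : 0 < y) (hxy : x * (1 + y) ^ k = lam)
    (hyx : y * (1 + x) ^ k = lam) :
    IsDensityPair k lam (x / (1 + x + y)) (y / (1 + x + y)) := by
  have hs : 0 < 1 + x + y := by positivity
  have one_sub_sub : 1 - x / (1 + x + y) - y / (1 + x + y) = 1 / (1 + x + y) := by
    field_simp; ring
  have one_sub_left : 1 - x / (1 + x + y) = (1 + y) / (1 + x + y) := by field_simp; ring
  have one_sub_right : 1 - y / (1 + x + y) = (1 + x) / (1 + x + y) := by field_simp; ring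
  refine ⟨by positivity, by positivity, ?_, ?_, ?_⟩
  · rw [← add_div, div_lt_one hs]; linarith
  · rw [one_sub_sub, one_sub_left, ← hxy, div_pow, div_pow, div_mul_div_comm, ← pow_succ',
      one_pow, mul_one_div]
  · rw [one_sub_sub, one_sub_right, ← hyx, div_pow, div_pow, div_mul_div_comm, ← pow_succ',
      one_pow, mul_one_div]

end DensityEquations

/-! ### The symmetric solution -/

section SymmetricSolution

lemma exists_continuousOn_inverse {f : ℝ → ℝ} {c : ℝ}
    (hmono : StrictMonoOn f (Ici c)) (hf : ContinuousOn f (Ici c)) (hlim : Tendsto f atTop atTop) :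
    ∃ g : ℝ → ℝ, ContinuousOn g (Ici (f c)) ∧ ∀ y ∈ Ici (f c), g y ∈ Ici c ∧ f (g y) = y := by
  classical
  have image_eq : f '' Ici c = Ici (f c) := by
    refine Subset.antisymm ?_ fun y hy => ?_
    · rintro _ ⟨x, hx, rfl⟩
      exact hmono.monotoneOn self_mem_Ici hx hx
    · obtain ⟨b, hyb, hcb⟩ := (hlim.eventually_ge_atTop y |>.and (eventually_ge_atTop c)).exists
      exact image_mono Icc_subset_Ici_self
        (intermediate_value_Icc hcb (hf.mono Icc_subset_Ici_self) ⟨hy, hyb⟩)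
  let e : Ici c ≃o Ici (f c) := (hmono.orderIso f (Ici c)).trans (OrderIso.setCongr _ _ image_eq)
  refine ⟨fun y => if h : y ∈ Ici (f c) then e.symm ⟨y, h⟩ else c, ?_, fun y hy => ?_⟩
  · have domRestrict_eq : (Ici (f c)).domRestrict
        (fun y => if h : y ∈ Ici (f c) then (e.symm ⟨y, h⟩ : ℝ) else c) =
        fun y => (e.symm y : ℝ) := funext fun y => dif_pos y.2
    rw [continuousOn_iff_continuous_domRestrict, domRestrict_eq]
    exact continuous_subtype_val.comp e.symm.continuous
  · simp only [dif_pos hy]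
    exact ⟨(e.symm ⟨y, hy⟩).2, congrArg Subtype.val (e.apply_symm_apply ⟨y, hy⟩)⟩

lemma strictMonoOn_mul_one_add_pow (k : ℕ) :
    StrictMonoOn (fun x : ℝ => x * (1 + x) ^ k) (Ici 0) := by
  intro x (hx : 0 ≤ x) y _ hxy
  have hpow : (1 + x) ^ k ≤ (1 + y) ^ k := by gcongr
  have hpos : 0 < (1 + y) ^ k := pow_pos (by linarith) k
  exact (mul_le_mul_of_nonneg_left hpow hx).trans_lt (mul_lt_mul_of_pos_right hxy hpos)

lemma exists_symmetricRatio (k : ℕ) : ∃ g : ℝ → ℝ, ContinuousOn g (Ici 0) ∧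
    ∀ lam, 0 ≤ lam → 0 ≤ g lam ∧ g lam * (1 + g lam) ^ k = lam := by
  have tendsto_atTop : Tendsto (fun x : ℝ => x * (1 + x) ^ k) atTop atTop := by
    refine tendsto_atTop_mono' _ ?_ tendsto_id
    filter_upwards [eventually_ge_atTop 0] with x hx
    exact le_mul_of_one_le_right hx (one_le_pow₀ (by linarith))
  simpa using exists_continuousOn_inverse (strictMonoOn_mul_one_add_pow k) (by fun_prop)
    tendsto_atTop

/-- The ratio of the density to the probability of a vacant edge in the symmetric solution, that
is the nonnegative root `x` of `x * (1 + x) ^ k = lam`. -/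
noncomputable def symmetricRatio (k : ℕ) : ℝ → ℝ := (exists_symmetricRatio k).choose

lemma continuousOn_symmetricRatio (k : ℕ) : ContinuousOn (symmetricRatio k) (Ici 0) :=
  (exists_symmetricRatio k).choose_spec.1

lemma symmetricRatio_nonneg (k : ℕ) {lam : ℝ} (h : 0 ≤ lam) : 0 ≤ symmetricRatio k lam :=
  ((exists_symmetricRatio k).choose_spec.2 lam h).1

lemma symmetricRatio_mul_pow (k : ℕ) {lam : ℝ} (h : 0 ≤ lam) :
    symmetricRatio k lam * (1 + symmetricRatio k lam) ^ k = lam :=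
  ((exists_symmetricRatio k).choose_spec.2 lam h).2

lemma symmetricRatio_pos (k : ℕ) {lam : ℝ} (h : 0 < lam) : 0 < symmetricRatio k lam := by
  refine (symmetricRatio_nonneg k h.le).lt_of_ne fun hzero => h.ne ?_
  rw [← symmetricRatio_mul_pow k h.le, ← hzero, zero_mul]

lemma symmetricRatio_eq {k : ℕ} {x lam : ℝ} (hx : 0 ≤ x) (h : x * (1 + x) ^ k = lam) :
    symmetricRatio k lam = x := by
  have hlam : 0 ≤ lam := by rw [← h]; positivity
  refine (strictMonoOn_mul_one_add_pow k).injOn (symmetricRatio_nonneg k hlam) hx ?_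
  simp only [symmetricRatio_mul_pow k hlam, h]

/-- The density of the translation-invariant simple Gibbs measure on the `(k + 1)`-regular
tree. -/
noncomputable def symmetricDensity (k : ℕ) (lam : ℝ) : ℝ :=
  symmetricRatio k lam / (1 + symmetricRatio k lam + symmetricRatio k lam)

lemma isDensityPair_symmetricDensity (k : ℕ) {lam : ℝ} (h : 0 < lam) :
    IsDensityPair k lam (symmetricDensity k lam) (symmetricDensity k lam) :=
  isDensityPair_of_ratio (symmetricRatio_pos k h) (symmetricRatio_pos k h)
    (symmetricRatio_mul_pow k h.le) (symmetricRatio_mul_pow k h.le)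

lemma IsDensityPair.eq_symmetricDensity {k : ℕ} {lam α : ℝ} (h : IsDensityPair k lam α α) :
    α = symmetricDensity k lam := by
  obtain ⟨x, y, hx, hy, hxy, -, hα, hα'⟩ := h.exists_ratio
  obtain rfl : x = y := by
    rw [hα] at hα'
    field_simp at hα'
    exact hα'
  rwa [symmetricDensity, symmetricRatio_eq hx.le hxy]

lemma continuousOn_symmetricDensity (k : ℕ) : ContinuousOn (symmetricDensity k) (Ici 0) := by
  have hcont := continuousOn_symmetricRatio k
  refine hcont.div (by fun_prop) fun lam hlam => ?_
  have hnonneg := symmetricRatio_nonneg k hlam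
  positivity

end SymmetricSolution

/-! ### The asymmetric solutions -/

section AsymmetricActivity

/-- The geometric sum `1 + t + ⋯ + t ^ m`, which has `m + 1` terms. -/
def geomSum (m : ℕ) (t : ℝ) : ℝ := ∑ i ∈ Finset.range (m + 1), t ^ i

lemma geomSum_pos (m : ℕ) {t : ℝ} (ht : 0 < t) : 0 < geomSum m t :=
  Finset.sum_pos (fun i _ => pow_pos ht i) (by simp)

lemma continuous_geomSum (m : ℕ) : Continuous (geomSum m) := by
  unfold geomSum; fun_prop

lemma geomSum_one (m : ℕ) : geomSum m 1 = m + 1 := by simp [geomSum]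

lemma geomSum_succ (m : ℕ) (t : ℝ) : geomSum (m + 1) t = geomSum m t + t ^ (m + 1) :=
  Finset.sum_range_succ _ _

lemma geomSum_succ' (m : ℕ) (t : ℝ) : geomSum (m + 1) t = t * geomSum m t + 1 :=
  geom_sum_succ

lemma geomSum_mul_sub_one (m : ℕ) (t : ℝ) : geomSum m t * (t - 1) = t ^ (m + 1) - 1 :=
  geom_sum_mul t (m + 1)

lemma geomSum_le_mul_pow (m : ℕ) {t : ℝ} (ht : 1 ≤ t) : geomSum m t ≤ (m + 1) * t ^ m := by
  have hle : geomSum m t ≤ ∑ _i ∈ Finset.range (m + 1), t ^ m :=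
    Finset.sum_le_sum fun i hi => pow_le_pow_right₀ ht (Finset.mem_range_succ_iff.1 hi)
  simpa using hle

lemma add_one_mul_pow_le {r : ℝ} (hr : 0 ≤ r) (n : ℕ) :
    (n + 1) * r ^ n ≤ n * r ^ (n + 1) + 1 := by
  induction n with
  | zero => simp
  | succ n ih =>
    have same_sign : 0 ≤ (r ^ (n + 1) - 1) * (r - 1) := by
      rcases le_total 1 r with h | h
      · exact mul_nonneg (sub_nonneg.2 (one_le_pow₀ h)) (sub_nonneg.2 h)
      · exact mul_nonneg_of_nonpos_of_nonpos (sub_nonpos.2 (pow_le_one₀ hr h)) (sub_nonpos.2 h)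
    have ih_mul := mul_le_mul_of_nonneg_left ih hr
    push_cast
    ring_nf at ih_mul same_sign ⊢
    linarith

lemma add_two_mul_pow_lt_geomSum_sq {r : ℝ} (hr : 0 < r) (hr1 : r ≠ 1) (n : ℕ) :
    (n + 2) * r ^ (n + 1) < geomSum (n + 1) (r ^ 2) := by
  induction n with
  | zero =>
    have hsq := sq_pos_of_ne_zero (sub_ne_zero.2 hr1)
    simp only [geomSum, Finset.sum_range_succ, Finset.sum_range_zero, Nat.cast_zero,
      zero_add, pow_zero, pow_one]
    linarith
  | succ n ih =>
    have hpow := add_one_mul_pow_le hr.le (n + 2)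
    have ih_mul := mul_lt_mul_of_pos_left ih (sq_pos_of_pos hr)
    rw [geomSum_succ']
    push_cast at hpow ⊢
    ring_nf at hpow ih_mul ⊢
    linarith

lemma sq_mul_pow_lt_geomSum_sq {t : ℝ} (ht : 0 < t) (ht1 : t ≠ 1) (n : ℕ) :
    (n + 2 : ℝ) ^ 2 * t ^ (n + 1) < geomSum (n + 1) t ^ 2 := by
  have hlt := add_two_mul_pow_lt_geomSum_sq (Real.sqrt_pos.2 ht)
    (fun h => ht1 (Real.sqrt_eq_one.1 h)) n
  rw [Real.sq_sqrt ht.le] at hlt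
  calc (n + 2 : ℝ) ^ 2 * t ^ (n + 1) = ((n + 2) * √t ^ (n + 1)) ^ 2 := by
        rw [mul_pow, ← pow_mul, mul_comm (n + 1) 2, pow_mul, Real.sq_sqrt ht.le]
    _ < geomSum (n + 1) t ^ 2 := by gcongr

/-- The smaller of the two ratios of an asymmetric solution on the `(m + 3)`-regular tree, in terms
of the parameter `t = (1 + y) / (1 + x)` of a pair of ratios `x < y`. -/
noncomputable def smallRatio (m : ℕ) (t : ℝ) : ℝ := 1 / (t * geomSum m t)

/-- The larger of the two ratios of an asymmetric solution, in terms of the same parameter as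
`smallRatio`. -/
noncomputable def largeRatio (m : ℕ) (t : ℝ) : ℝ := t ^ (m + 1) / geomSum m t

/-- The activity of the asymmetric solution with ratios `smallRatio m t` and `largeRatio m t`. -/
noncomputable def asymmetricActivity (m : ℕ) (t : ℝ) : ℝ :=
  geomSum (m + 1) t ^ (m + 2) / (t * geomSum m t ^ (m + 3))

lemma smallRatio_pos (m : ℕ) {t : ℝ} (ht : 0 < t) : 0 < smallRatio m t :=
  one_div_pos.2 (mul_pos ht (geomSum_pos m ht))

lemma largeRatio_pos (m : ℕ) {t : ℝ} (ht : 0 < t) : 0 < largeRatio m t :=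
  div_pos (pow_pos ht _) (geomSum_pos m ht)

lemma asymmetricActivity_pos (m : ℕ) {t : ℝ} (ht : 0 < t) : 0 < asymmetricActivity m t :=
  div_pos (pow_pos (geomSum_pos _ ht) _) (mul_pos ht (pow_pos (geomSum_pos _ ht) _))

lemma smallRatio_one (m : ℕ) : smallRatio m 1 = 1 / (m + 1) := by
  simp [smallRatio, geomSum_one]

lemma largeRatio_one (m : ℕ) : largeRatio m 1 = 1 / (m + 1) := by
  simp [largeRatio, geomSum_one]

lemma asymmetricActivity_one (m : ℕ) : asymmetricActivity m 1 = criticalActivity (m + 3) := by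
  rw [asymmetricActivity, geomSum_one, geomSum_one, criticalActivity]
  push_cast
  rw [one_mul, show (m : ℝ) + 3 - 1 = m + 1 + 1 by ring, show (m : ℝ) + 3 - 2 = m + 1 by ring]

lemma smallRatio_mul_pow (m : ℕ) {t : ℝ} (ht : 0 < t) :
    smallRatio m t * (1 + largeRatio m t) ^ (m + 2) = asymmetricActivity m t := by
  have hpos := geomSum_pos m ht
  have one_add : 1 + largeRatio m t = geomSum (m + 1) t / geomSum m t := by
    rw [largeRatio, geomSum_succ]; field_simp
  rw [one_add, smallRatio, asymmetricActivity, div_pow, div_mul_div_comm, one_mul, mul_assoc,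
    ← pow_succ']

lemma largeRatio_mul_pow (m : ℕ) {t : ℝ} (ht : 0 < t) :
    largeRatio m t * (1 + smallRatio m t) ^ (m + 2) = asymmetricActivity m t := by
  have hpos := geomSum_pos m ht
  have one_add : 1 + smallRatio m t = geomSum (m + 1) t / (t * geomSum m t) := by
    rw [smallRatio, geomSum_succ']; field_simp
  rw [one_add, largeRatio, asymmetricActivity, div_pow, div_mul_div_comm,
    div_eq_div_iff (by positivity) (by positivity)]
  ring

lemma continuousOn_smallRatio (m : ℕ) : ContinuousOn (smallRatio m) (Ici 1) := by
  have hcont := continuous_geomSum m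
  refine ContinuousOn.div (by fun_prop) (by fun_prop) fun t ht => ?_
  have ht0 : 0 < t := zero_lt_one.trans_le ht
  exact (mul_pos ht0 (geomSum_pos m ht0)).ne'

lemma continuousOn_largeRatio (m : ℕ) : ContinuousOn (largeRatio m) (Ici 1) := by
  have hcont := continuous_geomSum m
  refine ContinuousOn.div (by fun_prop) (by fun_prop) fun t ht => ?_
  exact (geomSum_pos m (zero_lt_one.trans_le ht)).ne'

lemma continuousOn_asymmetricActivity (m : ℕ) :
    ContinuousOn (asymmetricActivity m) (Ici 1) := by
  have hcont := continuous_geomSum m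
  have hcont' := continuous_geomSum (m + 1)
  refine ContinuousOn.div (by fun_prop) (by fun_prop) fun t ht => ?_
  have ht0 : 0 < t := zero_lt_one.trans_le ht
  exact (mul_pos ht0 (pow_pos (geomSum_pos m ht0) _)).ne'

lemma tendsto_asymmetricActivity (m : ℕ) : Tendsto (asymmetricActivity m) atTop atTop := by
  refine tendsto_atTop_mono' _ ?_
    (tendsto_id.atTop_div_const (by positivity : (0 : ℝ) < m + 1))
  filter_upwards [eventually_ge_atTop 1] with t ht
  have ht0 : 0 < t := zero_lt_one.trans_le ht
  have hpos := geomSum_pos m ht0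
  have mul_geomSum_le : t * geomSum m t ≤ geomSum (m + 1) t := by
    rw [geomSum_succ']; linarith
  rw [asymmetricActivity, id, div_le_div_iff₀ (by positivity) (by positivity)]
  calc t * (t * geomSum m t ^ (m + 3)) = geomSum m t * (t ^ 2 * geomSum m t ^ (m + 2)) := by ring
    _ ≤ (m + 1) * t ^ m * (t ^ 2 * geomSum m t ^ (m + 2)) := by
        gcongr; exact geomSum_le_mul_pow m ht
    _ = (t * geomSum m t) ^ (m + 2) * (m + 1) := by ring
    _ ≤ geomSum (m + 1) t ^ (m + 2) * (m + 1) := by gcongr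

lemma log_asymmetricActivity (m : ℕ) {t : ℝ} (ht : 1 < t) :
    Real.log (asymmetricActivity m t) = (m + 2) * Real.log (t ^ (m + 2) - 1) -
      (m + 3) * Real.log (t ^ (m + 1) - 1) + Real.log (t - 1) - Real.log t := by
  have ht0 : 0 < t := by linarith
  have hpos (n : ℕ) := geomSum_pos n ht0
  have log_geomSum (n : ℕ) :
      Real.log (geomSum n t) = Real.log (t ^ (n + 1) - 1) - Real.log (t - 1) := by
    rw [← geomSum_mul_sub_one, Real.log_mul (hpos n).ne' (by linarith), add_sub_cancel_right]
  rw [asymmetricActivity, Real.log_div (pow_pos (hpos _) _).ne'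
    (mul_pos ht0 (pow_pos (hpos _) _)).ne', Real.log_mul ht0.ne' (pow_pos (hpos _) _).ne',
    Real.log_pow, Real.log_pow, log_geomSum, log_geomSum]
  push_cast
  ring

lemma hasDerivAt_log_asymmetricActivity (m : ℕ) {t : ℝ} (ht : 1 < t) :
    HasDerivAt (fun s => Real.log (asymmetricActivity m s))
      (((t ^ (m + 2) - 1) ^ 2 - (m + 2 : ℝ) ^ 2 * (t - 1) ^ 2 * t ^ (m + 1)) /
        (t * (t ^ (m + 2) - 1) * (t ^ (m + 1) - 1) * (t - 1))) t := by
  have ht0 : 0 < t := by linarith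
  have ht1 : 0 < t - 1 := by linarith
  have pow_sub_one_pos (n : ℕ) : 0 < t ^ (n + 1) - 1 := sub_pos.2 (one_lt_pow₀ ht (by simp))
  have hasDerivAt_log_pow (n : ℕ) : HasDerivAt (fun s : ℝ => Real.log (s ^ (n + 1) - 1))
      ((n + 1) * t ^ n / (t ^ (n + 1) - 1)) t := by
    simpa using ((hasDerivAt_pow (n + 1) t).sub_const 1).log (pow_sub_one_pos n).ne'
  have hderiv := (((hasDerivAt_log_pow (m + 1)).const_mul (m + 2 : ℝ)).sub
    ((hasDerivAt_log_pow m).const_mul (m + 3 : ℝ))).add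
    (((hasDerivAt_id t).sub_const 1).log ht1.ne') |>.sub (Real.hasDerivAt_log ht0.ne')
  have eventually_eq : (fun s => Real.log (asymmetricActivity m s)) =ᶠ[𝓝 t] fun s =>
      (m + 2) * Real.log (s ^ (m + 2) - 1) -
        (m + 3) * Real.log (s ^ (m + 1) - 1) + Real.log (s - 1) - Real.log s := by
    filter_upwards [lt_mem_nhds ht] with s hs using log_asymmetricActivity m hs
  refine HasDerivAt.congr_of_eventuallyEq (hderiv.congr_deriv ?_) eventually_eq
  have hpos := pow_sub_one_pos m
  have hpos' := pow_sub_one_pos (m + 1)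
  push_cast
  simp only [id]
  field_simp
  ring

lemma strictMonoOn_asymmetricActivity (m : ℕ) :
    StrictMonoOn (asymmetricActivity m) (Ici 1) := by
  have activity_pos : ∀ t ∈ Ici (1 : ℝ), 0 < asymmetricActivity m t :=
    fun t ht => asymmetricActivity_pos m (zero_lt_one.trans_le ht)
  suffices hlog : StrictMonoOn (fun t => Real.log (asymmetricActivity m t)) (Ici 1) from
    fun t ht s hs hts =>
      (Real.log_lt_log_iff (activity_pos t ht) (activity_pos s hs)).1 (hlog ht hs hts)
  refine strictMonoOn_of_deriv_pos (convex_Ici 1)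
    ((continuousOn_asymmetricActivity m).log fun t ht => (activity_pos t ht).ne') fun t ht => ?_
  replace ht : 1 < t := by rwa [interior_Ici] at ht
  have ht0 : 0 < t := by linarith
  have ht1 : 0 < t - 1 := by linarith
  have pow_sub_one_pos (n : ℕ) : 0 < t ^ (n + 1) - 1 := sub_pos.2 (one_lt_pow₀ ht (by simp))
  have numerator_pos :
      0 < (t ^ (m + 2) - 1) ^ 2 - (m + 2 : ℝ) ^ 2 * (t - 1) ^ 2 * t ^ (m + 1) := by
    have hlt := mul_lt_mul_of_pos_right (sq_mul_pow_lt_geomSum_sq ht0 ht.ne' m) (pow_pos ht1 2)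
    rw [← mul_pow, geomSum_mul_sub_one] at hlt
    linarith
  rw [(hasDerivAt_log_asymmetricActivity m ht).deriv]
  exact div_pos numerator_pos
    (mul_pos (mul_pos (mul_pos ht0 (pow_sub_one_pos (m + 1))) (pow_sub_one_pos m)) ht1)

lemma smallRatio_lt_largeRatio (m : ℕ) {t : ℝ} (ht : 1 < t) : smallRatio m t < largeRatio m t := by
  have ht0 : 0 < t := by linarith
  have hpos := geomSum_pos m ht0
  rw [smallRatio, largeRatio, div_lt_div_iff₀ (by positivity) hpos]
  calc 1 * geomSum m t < t * geomSum m t := mul_lt_mul_of_pos_right ht hpos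
    _ ≤ t ^ (m + 1) * (t * geomSum m t) :=
        le_mul_of_one_le_left (by positivity) (one_le_pow₀ ht.le)

theorem exists_eq_smallRatio_and_eq_largeRatio (m : ℕ) {x y lam : ℝ} (hx : 0 < x) (hlt : x < y)
    (hxy : x * (1 + y) ^ (m + 2) = lam) (hyx : y * (1 + x) ^ (m + 2) = lam) :
    ∃ t, 1 < t ∧ x = smallRatio m t ∧ y = largeRatio m t ∧ lam = asymmetricActivity m t := by
  have hx1 : 0 < 1 + x := by linarith
  obtain ⟨t, hty⟩ : ∃ t, 1 + y = t * (1 + x) := ⟨(1 + y) / (1 + x), by field_simp⟩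
  have ht : 1 < t := by by_contra! h; nlinarith
  have ht0 : 0 < t := by linarith
  have hpos := geomSum_pos m ht0
  have y_eq : y = x * t ^ (m + 2) := by
    refine mul_right_cancel₀ (pow_pos hx1 (m + 2)).ne' ?_
    rw [hyx, ← hxy, hty, mul_pow, mul_assoc]
  have mul_eq_one : x * (t * geomSum m t) = 1 := by
    refine mul_right_cancel₀ (by linarith : t - 1 ≠ 0) ?_
    rw [mul_assoc, mul_assoc, geomSum_mul_sub_one]
    rw [y_eq] at hty
    ring_nf at hty ⊢
    linarith
  have x_eq : x = smallRatio m t := eq_one_div_of_mul_eq_one_left mul_eq_one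
  have y_eq' : y = largeRatio m t := by
    rw [y_eq, x_eq, smallRatio, largeRatio]
    field_simp
    ring
  exact ⟨t, ht, x_eq, y_eq', by rw [← hxy, x_eq, y_eq', smallRatio_mul_pow m ht0]⟩

end AsymmetricActivity

section AsymmetricDensity

lemma exists_asymmetryParameter (m : ℕ) : ∃ g : ℝ → ℝ,
    ContinuousOn g (Ici (criticalActivity (m + 3))) ∧
    ∀ lam ∈ Ici (criticalActivity (m + 3)), g lam ∈ Ici 1 ∧ asymmetricActivity m (g lam) = lam := by
  simpa only [asymmetricActivity_one] using
    exists_continuousOn_inverse (strictMonoOn_asymmetricActivity m)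
      (continuousOn_asymmetricActivity m) (tendsto_asymmetricActivity m)

/-- The parameter `t = (1 + y) / (1 + x)` of the ratios `x < y` of the asymmetric solution at a
given activity; only meaningful from the critical activity on. -/
noncomputable def asymmetryParameter (m : ℕ) : ℝ → ℝ := (exists_asymmetryParameter m).choose

lemma continuousOn_asymmetryParameter (m : ℕ) :
    ContinuousOn (asymmetryParameter m) (Ici (criticalActivity (m + 3))) :=
  (exists_asymmetryParameter m).choose_spec.1

lemma one_le_asymmetryParameter (m : ℕ) {lam : ℝ} (h : criticalActivity (m + 3) ≤ lam) :
    1 ≤ asymmetryParameter m lam :=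
  ((exists_asymmetryParameter m).choose_spec.2 lam h).1

lemma asymmetricActivity_asymmetryParameter (m : ℕ) {lam : ℝ}
    (h : criticalActivity (m + 3) ≤ lam) :
    asymmetricActivity m (asymmetryParameter m lam) = lam :=
  ((exists_asymmetryParameter m).choose_spec.2 lam h).2

lemma asymmetryParameter_asymmetricActivity (m : ℕ) {t : ℝ} (ht : 1 ≤ t) :
    asymmetryParameter m (asymmetricActivity m t) = t := by
  have critical_le : criticalActivity (m + 3) ≤ asymmetricActivity m t := by
    rw [← asymmetricActivity_one]
    exact (strictMonoOn_asymmetricActivity m).monotoneOn self_mem_Ici ht ht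
  exact (strictMonoOn_asymmetricActivity m).injOn (one_le_asymmetryParameter m critical_le) ht
    (asymmetricActivity_asymmetryParameter m critical_le)

lemma one_lt_asymmetryParameter (m : ℕ) {lam : ℝ} (h : criticalActivity (m + 3) < lam) :
    1 < asymmetryParameter m lam := by
  refine (one_le_asymmetryParameter m h.le).lt_of_ne fun hone => h.ne ?_
  rw [← asymmetricActivity_asymmetryParameter m h.le, ← hone, asymmetricActivity_one]

lemma criticalActivity_pos (m : ℕ) : 0 < criticalActivity (m + 3) := by
  rw [← asymmetricActivity_one]
  exact asymmetricActivity_pos m one_pos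

lemma symmetricRatio_criticalActivity (m : ℕ) :
    symmetricRatio (m + 2) (criticalActivity (m + 3)) = 1 / (m + 1) := by
  refine symmetricRatio_eq (by positivity) ?_
  have hone := smallRatio_mul_pow m one_pos
  rwa [smallRatio_one, largeRatio_one, asymmetricActivity_one] at hone

lemma one_div_lt_symmetricRatio (m : ℕ) {lam : ℝ} (h : criticalActivity (m + 3) < lam) :
    1 / (m + 1) < symmetricRatio (m + 2) lam := by
  have hc := (criticalActivity_pos m).le
  rw [← symmetricRatio_criticalActivity]
  refine (strictMonoOn_mul_one_add_pow (m + 2)).lt_iff_lt (symmetricRatio_nonneg _ hc)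
    (symmetricRatio_nonneg _ (hc.trans h.le)) |>.1 ?_
  simpa only [symmetricRatio_mul_pow _ hc, symmetricRatio_mul_pow _ (hc.trans h.le)] using h

/-- The smaller density of the asymmetric solution on the `(m + 3)`-regular tree. -/
noncomputable def smallDensity (m : ℕ) (lam : ℝ) : ℝ :=
  smallRatio m (asymmetryParameter m lam) /
    (1 + smallRatio m (asymmetryParameter m lam) + largeRatio m (asymmetryParameter m lam))

/-- The larger density of the asymmetric solution on the `(m + 3)`-regular tree. -/
noncomputable def largeDensity (m : ℕ) (lam : ℝ) : ℝ :=
  largeRatio m (asymmetryParameter m lam) /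
    (1 + smallRatio m (asymmetryParameter m lam) + largeRatio m (asymmetryParameter m lam))

lemma isDensityPair_smallDensity_largeDensity (m : ℕ) {lam : ℝ}
    (h : criticalActivity (m + 3) < lam) :
    IsDensityPair (m + 2) lam (smallDensity m lam) (largeDensity m lam) := by
  have ht := zero_lt_one.trans (one_lt_asymmetryParameter m h)
  refine isDensityPair_of_ratio (smallRatio_pos m ht) (largeRatio_pos m ht) ?_ ?_
  · rw [smallRatio_mul_pow m ht, asymmetricActivity_asymmetryParameter m h.le]
  · rw [largeRatio_mul_pow m ht, asymmetricActivity_asymmetryParameter m h.le]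

lemma smallRatio_lt_symmetricRatio (m : ℕ) {lam : ℝ} (h : criticalActivity (m + 3) < lam) :
    smallRatio m (asymmetryParameter m lam) < symmetricRatio (m + 2) lam := by
  have hlam := (criticalActivity_pos m).trans h
  have ht := one_lt_asymmetryParameter m h
  have hlt := smallRatio_lt_largeRatio m ht
  have hx := smallRatio_pos m (zero_lt_one.trans ht)
  by_contra! hle
  refine lt_irrefl lam ?_
  calc lam = symmetricRatio (m + 2) lam * (1 + symmetricRatio (m + 2) lam) ^ (m + 2) :=
        (symmetricRatio_mul_pow _ hlam.le).symm
    _ ≤ smallRatio m (asymmetryParameter m lam) *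
          (1 + smallRatio m (asymmetryParameter m lam)) ^ (m + 2) := by
        have hs := symmetricRatio_nonneg (m + 2) hlam.le
        gcongr
    _ < smallRatio m (asymmetryParameter m lam) *
          (1 + largeRatio m (asymmetryParameter m lam)) ^ (m + 2) := by gcongr
    _ = lam := by
        rw [smallRatio_mul_pow m (zero_lt_one.trans ht),
          asymmetricActivity_asymmetryParameter m h.le]

lemma symmetricRatio_lt_largeRatio (m : ℕ) {lam : ℝ} (h : criticalActivity (m + 3) < lam) :
    symmetricRatio (m + 2) lam < largeRatio m (asymmetryParameter m lam) := by
  have hlam := (criticalActivity_pos m).trans h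
  have hs := symmetricRatio_nonneg (m + 2) hlam.le
  have ht := one_lt_asymmetryParameter m h
  have hlt := smallRatio_lt_largeRatio m ht
  have hx := smallRatio_pos m (zero_lt_one.trans ht)
  have hy := largeRatio_pos m (zero_lt_one.trans ht)
  by_contra! hle
  refine lt_irrefl lam ?_
  calc lam = largeRatio m (asymmetryParameter m lam) *
          (1 + smallRatio m (asymmetryParameter m lam)) ^ (m + 2) := by
        rw [largeRatio_mul_pow m (zero_lt_one.trans ht),
          asymmetricActivity_asymmetryParameter m h.le]
    _ < largeRatio m (asymmetryParameter m lam) *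
          (1 + largeRatio m (asymmetryParameter m lam)) ^ (m + 2) := by gcongr
    _ ≤ symmetricRatio (m + 2) lam * (1 + symmetricRatio (m + 2) lam) ^ (m + 2) := by gcongr
    _ = lam := symmetricRatio_mul_pow _ hlam.le

lemma smallDensity_lt_symmetricDensity (m : ℕ) {lam : ℝ} (h : criticalActivity (m + 3) < lam) :
    smallDensity m lam < symmetricDensity (m + 2) lam := by
  have hs := symmetricRatio_pos (m + 2) ((criticalActivity_pos m).trans h)
  have ht := one_lt_asymmetryParameter m h
  have hx := smallRatio_pos m (zero_lt_one.trans ht)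
  have hlt := smallRatio_lt_largeRatio m ht
  rw [smallDensity, symmetricDensity, div_lt_div_iff₀ (by linarith) (by positivity)]
  linarith [smallRatio_lt_symmetricRatio m h, mul_lt_mul_of_pos_left hlt hs]

lemma symmetricDensity_lt_largeDensity (m : ℕ) {lam : ℝ} (h : criticalActivity (m + 3) < lam) :
    symmetricDensity (m + 2) lam < largeDensity m lam := by
  have hs := symmetricRatio_pos (m + 2) ((criticalActivity_pos m).trans h)
  have ht := one_lt_asymmetryParameter m h
  have hx := smallRatio_pos m (zero_lt_one.trans ht)
  have hlt := smallRatio_lt_largeRatio m ht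
  rw [largeDensity, symmetricDensity, div_lt_div_iff₀ (by positivity) (by linarith)]
  linarith [symmetricRatio_lt_largeRatio m h, mul_lt_mul_of_pos_left hlt hs]

lemma IsDensityPair.of_lt {m : ℕ} {lam α β : ℝ} (h : IsDensityPair (m + 2) lam α β) (hlt : α < β) :
    criticalActivity (m + 3) < lam ∧ α = smallDensity m lam ∧ β = largeDensity m lam := by
  obtain ⟨x, y, hx, hy, hxy, hyx, rfl, rfl⟩ := h.exists_ratio
  rw [div_lt_div_iff_of_pos_right (by positivity)] at hlt
  obtain ⟨t, ht, rfl, rfl, rfl⟩ := exists_eq_smallRatio_and_eq_largeRatio m hx hlt hxy hyx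
  refine ⟨?_, ?_, ?_⟩
  · rw [← asymmetricActivity_one]
    exact strictMonoOn_asymmetricActivity m self_mem_Ici ht.le ht
  · rw [smallDensity, asymmetryParameter_asymmetricActivity m ht.le]
  · rw [largeDensity, asymmetryParameter_asymmetricActivity m ht.le]

lemma IsDensityPair.eq_of_le {m : ℕ} {lam α β : ℝ} (h : IsDensityPair (m + 2) lam α β)
    (hlam : lam ≤ criticalActivity (m + 3)) :
    α = symmetricDensity (m + 2) lam ∧ β = symmetricDensity (m + 2) lam := by
  rcases lt_trichotomy α β with hlt | rfl | hlt
  · exact absurd (h.of_lt hlt).1 hlam.not_gt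
  · exact ⟨h.eq_symmetricDensity, h.eq_symmetricDensity⟩
  · exact absurd (h.symm.of_lt hlt).1 hlam.not_gt

lemma IsDensityPair.eq_or {m : ℕ} {lam α β : ℝ} (h : IsDensityPair (m + 2) lam α β) :
    (α = β ∧ α = symmetricDensity (m + 2) lam) ∨
      (α = smallDensity m lam ∧ β = largeDensity m lam) ∨
      (α = largeDensity m lam ∧ β = smallDensity m lam) := by
  rcases lt_trichotomy α β with hlt | rfl | hlt
  · exact Or.inr (Or.inl (h.of_lt hlt).2)
  · exact Or.inl ⟨rfl, h.eq_symmetricDensity⟩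
  · exact Or.inr (Or.inr (h.symm.of_lt hlt).2.symm)

lemma continuousOn_smallDensity_and_largeDensity (m : ℕ) :
    ContinuousOn (smallDensity m) (Ici (criticalActivity (m + 3))) ∧
      ContinuousOn (largeDensity m) (Ici (criticalActivity (m + 3))) := by
  have mapsTo : MapsTo (asymmetryParameter m) (Ici (criticalActivity (m + 3))) (Ici 1) :=
    fun lam h => one_le_asymmetryParameter m h
  have hsmall := (continuousOn_smallRatio m).comp (continuousOn_asymmetryParameter m) mapsTo
  have hlarge := (continuousOn_largeRatio m).comp (continuousOn_asymmetryParameter m) mapsTo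
  have denominator_ne : ∀ lam ∈ Ici (criticalActivity (m + 3)),
      1 + smallRatio m (asymmetryParameter m lam) +
        largeRatio m (asymmetryParameter m lam) ≠ 0 := by
    intro lam h
    have ht : 0 < asymmetryParameter m lam := zero_lt_one.trans_le (mapsTo h)
    have hx := smallRatio_pos m ht
    have hy := largeRatio_pos m ht
    positivity
  exact ⟨hsmall.div ((continuousOn_const.add hsmall).add hlarge) denominator_ne,
    hlarge.div ((continuousOn_const.add hsmall).add hlarge) denominator_ne⟩

lemma asymmetryParameter_criticalActivity (m : ℕ) :
    asymmetryParameter m (criticalActivity (m + 3)) = 1 := by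
  rw [← asymmetricActivity_one, asymmetryParameter_asymmetricActivity m le_rfl]

lemma smallDensity_criticalActivity (m : ℕ) : smallDensity m (criticalActivity (m + 3)) =
    symmetricDensity (m + 2) (criticalActivity (m + 3)) := by
  rw [smallDensity, symmetricDensity, symmetricRatio_criticalActivity,
    asymmetryParameter_criticalActivity, smallRatio_one, largeRatio_one]

lemma largeDensity_criticalActivity (m : ℕ) : largeDensity m (criticalActivity (m + 3)) =
    symmetricDensity (m + 2) (criticalActivity (m + 3)) := by
  rw [largeDensity, symmetricDensity, symmetricRatio_criticalActivity,
    asymmetryParameter_criticalActivity, smallRatio_one, largeRatio_one]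

lemma tendsto_sub_symmetricDensity {m : ℕ} {p : ℝ → ℝ}
    (hp : ContinuousOn p (Ici (criticalActivity (m + 3))))
    (heq : p (criticalActivity (m + 3)) = symmetricDensity (m + 2) (criticalActivity (m + 3))) :
    Tendsto (fun lam => p lam - symmetricDensity (m + 2) lam)
      (𝓝[>] criticalActivity (m + 3)) (𝓝 0) := by
  have hc := (criticalActivity_pos m).le
  have hcont := (hp.sub ((continuousOn_symmetricDensity (m + 2)).mono (Ici_subset_Ici.2 hc))) _
    self_mem_Ici
  have htendsto := (hcont.mono Ioi_subset_Ici_self).tendsto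
  rwa [Pi.sub_apply, heq, sub_self] at htendsto

end AsymmetricDensity

/-! ### The exponent and its local maxima -/

section Exponent

open Real (negMulLog)

lemma eventually_lt_mul_negMulLog_add {c : ℝ} (hc : 0 < c) {r : ℝ → ℝ}
    (hr : DifferentiableAt ℝ r 0) : ∀ᶠ t in 𝓝[>] (0 : ℝ), r 0 < c * negMulLog t + r t := by
  have slope_tendsto : Tendsto (fun t => t⁻¹ * (r t - r 0)) (𝓝[>] 0) (𝓝 (deriv r 0)) := by
    simpa using hr.hasDerivAt.tendsto_slope_zero_right
  have log_tendsto : Tendsto (fun t => -c * Real.log t) (𝓝[>] 0) atTop :=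
    Real.tendsto_log_nhdsGT_zero.const_mul_atBot_of_neg (by linarith)
  filter_upwards [(log_tendsto.atTop_add slope_tendsto).eventually_gt_atTop 0,
    self_mem_nhdsWithin] with t hslope ht
  have ht : 0 < t := ht
  have hincrement := mul_pos ht hslope
  rw [mul_add, mul_inv_cancel_left₀ ht.ne'] at hincrement
  rw [negMulLog]
  linarith

lemma not_isLocalMaxOn_of_eq_mul_negMulLog_add {X : Type*} [TopologicalSpace X] {f : X → ℝ}
    {s : Set X} {x : X} {γ : ℝ → X} (hγ : ContinuousAt γ 0) (hx : γ 0 = x)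
    (hs : ∀ᶠ t in 𝓝[>] (0 : ℝ), γ t ∈ s) {c : ℝ} (hc : 0 < c) {r : ℝ → ℝ}
    (hr : DifferentiableAt ℝ r 0) (heq : ∀ t, f (γ t) = c * negMulLog t + r t) :
    ¬ IsLocalMaxOn f s x := by
  intro hmax
  have hfx : f x = r 0 := by rw [← hx, heq]; simp
  have hγ' : Tendsto γ (𝓝[>] 0) (𝓝[s] x) :=
    tendsto_nhdsWithin_iff.2 ⟨hx ▸ hγ.tendsto.mono_left nhdsWithin_le_nhds, hs⟩
  obtain ⟨t, hle, hlt⟩ :=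
    ((hγ'.eventually hmax).and (eventually_lt_mul_negMulLog_add hc hr)).exists
  rw [heq, hfx] at hle
  exact hle.not_gt hlt

lemma differentiableAt_negMulLog_comp {E : Type*} [NormedAddCommGroup E] [NormedSpace ℝ E]
    {f : E → ℝ} {x : E} (hf : DifferentiableAt ℝ f x) (hx : f x ≠ 0) :
    DifferentiableAt ℝ (fun z => negMulLog (f z)) x :=
  DifferentiableAt.comp (g := negMulLog) x (Real.differentiableAt_negMulLog_iff.2 hx) hf

lemma deriv_deriv_nonpos_of_isLocalMax {f : ℝ → ℝ} {x : ℝ} (h : IsLocalMax f x)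
    (hf : ContinuousAt f x) : deriv (deriv f) x ≤ 0 := by
  by_contra! hpos
  have hmin := isLocalMin_of_deriv_deriv_pos hpos h.deriv_eq_zero hf
  have hconst : f =ᶠ[𝓝 x] fun _ => f x := by
    filter_upwards [hmin, h] with z hge hle using le_antisymm hle hge
  rw [hconst.deriv.deriv_eq] at hpos
  simp at hpos

/-- The exponent `Φ₁` for degree `k + 1`, written with `negMulLog x = -x ln x`. It is manifestly
symmetric, and it agrees with `Φ₁` wherever the quotient in `Φ₁` has nonzero denominator. -/
noncomputable def symmetricExponent (k : ℕ) (lam : ℝ) (q : ℝ × ℝ) : ℝ :=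
  (q.1 + q.2) * Real.log lam + negMulLog q.1 + negMulLog q.2 -
    k * (negMulLog (1 - q.1) + negMulLog (1 - q.2)) + (k + 1) * negMulLog (1 - q.1 - q.2)

/-- The partial derivative of the exponent with respect to its first variable. -/
noncomputable def exponentSlope (k : ℕ) (lam α β : ℝ) : ℝ :=
  Real.log lam - Real.log α - k * Real.log (1 - α) + (k + 1) * Real.log (1 - α - β)

variable {k : ℕ} {lam : ℝ}

lemma symmetricExponent_swap (q : ℝ × ℝ) :
    symmetricExponent k lam q.swap = symmetricExponent k lam q := by
  simp only [symmetricExponent, Prod.fst_swap, Prod.snd_swap, sub_right_comm 1 q.2 q.1]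
  ring

lemma continuous_symmetricExponent : Continuous (symmetricExponent k lam) := by
  unfold symmetricExponent
  fun_prop

lemma Phi1_eq_symmetricExponent_of_snd_ne_one {q : ℝ × ℝ} (hq : q.2 ≠ 1) :
    Phi1 (k + 1) lam q = symmetricExponent k lam q := by
  obtain ⟨α, β⟩ := q
  have hβ : 1 - β ≠ 0 := sub_ne_zero.2 (Ne.symm hq)
  have expand_left := Real.negMulLog_mul (α / (1 - β)) (1 - β)
  have expand_right := Real.negMulLog_mul (1 - α / (1 - β)) (1 - β)
  rw [div_mul_cancel₀ _ hβ] at expand_left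
  rw [sub_mul, div_mul_cancel₀ _ hβ, one_mul, sub_right_comm] at expand_right
  simp only [Phi1, Psi1, symmetricExponent, Real.binEntropy_eq_negMulLog_add_negMulLog_one_sub]
  push_cast
  linear_combination (-(k : ℝ) - 1) * expand_left + (-(k : ℝ) - 1) * expand_right

lemma eqOn_Phi1_symmetricExponent :
    EqOn (Phi1 (k + 1) lam) (symmetricExponent k lam) triangle := by
  rintro ⟨α, β⟩ ⟨hα, hβ, hle⟩
  rcases eq_or_ne β 1 with rfl | hne
  · obtain rfl : α = 0 := by simp only at hα hle; linarith
    simp [Phi1, Psi1, symmetricExponent, Real.binEntropy]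
  · exact Phi1_eq_symmetricExponent_of_snd_ne_one hne

lemma isCompact_triangle : IsCompact triangle := by
  refine (isCompact_Icc (a := ((0 : ℝ), (0 : ℝ))) (b := ((1 : ℝ), (1 : ℝ))))
    |>.of_isClosed_subset ?_ ?_
  · exact (isClosed_le continuous_const continuous_fst).inter
      ((isClosed_le continuous_const continuous_snd).inter
        (isClosed_le (continuous_fst.add continuous_snd) continuous_const))
  · rintro ⟨α, β⟩ ⟨hα, hβ, hle⟩
    simp only at hα hβ hle
    exact ⟨⟨hα, hβ⟩, ⟨by simp only; linarith, by simp only; linarith⟩⟩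

lemma swap_mem_triangle {q : ℝ × ℝ} (hq : q ∈ triangle) : q.swap ∈ triangle :=
  ⟨hq.2.1, hq.1, by simpa [add_comm] using hq.2.2⟩

lemma triangle_mem_nhds {q : ℝ × ℝ} (hα : 0 < q.1) (hβ : 0 < q.2) (hlt : q.1 + q.2 < 1) :
    triangle ∈ 𝓝 q := by
  filter_upwards [continuous_fst.continuousAt.eventually (lt_mem_nhds hα),
    continuous_snd.continuousAt.eventually (lt_mem_nhds hβ),
    (continuous_fst.add continuous_snd).continuousAt.eventually (gt_mem_nhds hlt)]
    with z h₁ h₂ h₃ using ⟨h₁.le, h₂.le, h₃.le⟩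

lemma not_isLocalMaxOn_zero_left {β : ℝ} (hβ : 0 ≤ β) (hβ1 : β < 1) :
    ¬ IsLocalMaxOn (symmetricExponent k lam) triangle (0, β) := by
  refine not_isLocalMaxOn_of_eq_mul_negMulLog_add (γ := fun t => (t, β)) (by fun_prop) rfl ?_
    one_pos (r := fun t => (t + β) * Real.log lam + negMulLog β -
      k * (negMulLog (1 - t) + negMulLog (1 - β)) + (k + 1) * negMulLog (1 - t - β)) ?_ ?_
  · filter_upwards [Ioo_mem_nhdsGT (sub_pos.2 hβ1)] with t ht
    exact ⟨ht.1.le, hβ, by linarith [ht.2]⟩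
  · have h₁ : DifferentiableAt ℝ (fun t : ℝ => negMulLog (1 - t)) 0 :=
      differentiableAt_negMulLog_comp (by fun_prop) (by simp)
    have h₂ : DifferentiableAt ℝ (fun t : ℝ => negMulLog (1 - t - β)) 0 :=
      differentiableAt_negMulLog_comp (by fun_prop) (by linarith)
    fun_prop
  · intro t
    simp only [symmetricExponent]
    ring

lemma not_isLocalMaxOn_of_add_eq_one {α β : ℝ} (hα : 0 < α) (hβ : 0 < β) (h : α + β = 1) :
    ¬ IsLocalMaxOn (symmetricExponent k lam) triangle (α, β) := by
  refine not_isLocalMaxOn_of_eq_mul_negMulLog_add (γ := fun t => (α - t, β)) (by fun_prop)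
    (by simp) ?_ (c := k + 1) (by positivity)
    (r := fun t => (α - t + β) * Real.log lam + negMulLog (α - t) + negMulLog β -
      k * (negMulLog (1 - (α - t)) + negMulLog (1 - β))) ?_ ?_
  · filter_upwards [Ioo_mem_nhdsGT hα] with t ht
    exact ⟨by simp only; linarith [ht.2], hβ.le, by simp only; linarith [ht.1]⟩
  · have h₁ : DifferentiableAt ℝ (fun t : ℝ => negMulLog (α - t)) 0 :=
      differentiableAt_negMulLog_comp (by fun_prop) (by linarith)
    have h₂ : DifferentiableAt ℝ (fun t : ℝ => negMulLog (1 - (α - t))) 0 :=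
      differentiableAt_negMulLog_comp (by fun_prop) (by linarith)
    fun_prop
  · intro t
    simp only [symmetricExponent]
    rw [show 1 - (α - t) - β = t by linarith]
    ring

lemma not_isLocalMaxOn_zero_one :
    ¬ IsLocalMaxOn (symmetricExponent k lam) triangle (0, 1) := by
  refine not_isLocalMaxOn_of_eq_mul_negMulLog_add (γ := fun t => (0, 1 - t)) (by fun_prop)
    (by simp) ?_ one_pos (r := fun t => (1 - t) * Real.log lam + negMulLog (1 - t)) ?_ ?_
  · filter_upwards [Ioo_mem_nhdsGT (zero_lt_one' ℝ)] with t ht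
    exact ⟨le_rfl, by simp only; linarith [ht.2], by simp only; linarith [ht.1]⟩
  · have : DifferentiableAt ℝ (fun t : ℝ => negMulLog (1 - t)) 0 :=
      differentiableAt_negMulLog_comp (by fun_prop) (by simp)
    fun_prop
  · intro t
    simp only [symmetricExponent, sub_zero, sub_sub_cancel, Real.negMulLog_zero,
      Real.negMulLog_one]
    ring

lemma not_isLocalMaxOn_diagonal_zero :
    ¬ IsLocalMaxOn (symmetricExponent k lam) (triangle ∩ {q | q.1 = q.2}) (0, 0) := by
  refine not_isLocalMaxOn_of_eq_mul_negMulLog_add (γ := fun t => (t, t)) (by fun_prop) rfl ?_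
    two_pos (r := fun t => (t + t) * Real.log lam - k * (negMulLog (1 - t) + negMulLog (1 - t)) +
      (k + 1) * negMulLog (1 - t - t)) ?_ ?_
  · filter_upwards [Ioo_mem_nhdsGT (one_half_pos (α := ℝ))] with t ht
    exact ⟨⟨ht.1.le, ht.1.le, by simp only; linarith [ht.2]⟩, rfl⟩
  · have h₁ : DifferentiableAt ℝ (fun t : ℝ => negMulLog (1 - t)) 0 :=
      differentiableAt_negMulLog_comp (by fun_prop) (by simp)
    have h₂ : DifferentiableAt ℝ (fun t : ℝ => negMulLog (1 - t - t)) 0 :=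
      differentiableAt_negMulLog_comp (by fun_prop) (by simp)
    fun_prop
  · intro t
    simp only [symmetricExponent]
    ring

lemma not_isLocalMaxOn_diagonal_one_half :
    ¬ IsLocalMaxOn (symmetricExponent k lam) (triangle ∩ {q | q.1 = q.2}) (1 / 2, 1 / 2) := by
  refine not_isLocalMaxOn_of_eq_mul_negMulLog_add
    (γ := fun t => (1 / 2 - t / 2, 1 / 2 - t / 2)) (by fun_prop) (by simp) ?_
    (c := k + 1) (by positivity)
    (r := fun t => (1 / 2 - t / 2 + (1 / 2 - t / 2)) * Real.log lam +
      negMulLog (1 / 2 - t / 2) + negMulLog (1 / 2 - t / 2) -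
      k * (negMulLog (1 - (1 / 2 - t / 2)) + negMulLog (1 - (1 / 2 - t / 2)))) ?_ ?_
  · filter_upwards [Ioo_mem_nhdsGT (zero_lt_one' ℝ)] with t ht
    exact ⟨⟨by simp only; linarith [ht.2], by simp only; linarith [ht.2],
      by simp only; linarith [ht.1]⟩, rfl⟩
  · have h₁ : DifferentiableAt ℝ (fun t : ℝ => negMulLog (1 / 2 - t / 2)) 0 :=
      differentiableAt_negMulLog_comp (by fun_prop) (by norm_num)
    have h₂ : DifferentiableAt ℝ (fun t : ℝ => negMulLog (1 - (1 / 2 - t / 2))) 0 :=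
      differentiableAt_negMulLog_comp (by fun_prop) (by norm_num)
    fun_prop
  · intro t
    simp only [symmetricExponent]
    rw [show 1 - (1 / 2 - t / 2) - (1 / 2 - t / 2) = t by ring]
    ring

lemma isLocalMaxOn_swap {q : ℝ × ℝ} (h : IsLocalMaxOn (symmetricExponent k lam) triangle q) :
    IsLocalMaxOn (symmetricExponent k lam) triangle q.swap := by
  have htendsto : Tendsto Prod.swap (𝓝[triangle] q.swap) (𝓝[triangle] q) :=
    continuous_swap.continuousWithinAt.tendsto_nhdsWithin fun _ => swap_mem_triangle
  have hcomp : symmetricExponent k lam ∘ Prod.swap = symmetricExponent k lam :=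
    funext symmetricExponent_swap
  have hmax := IsMaxFilter.comp_tendsto (g := Prod.swap) (b := q.swap) h htendsto
  rwa [hcomp] at hmax

lemma fst_pos_of_isLocalMaxOn {q : ℝ × ℝ} (hq : q ∈ triangle)
    (h : IsLocalMaxOn (symmetricExponent k lam) triangle q) : 0 < q.1 := by
  obtain ⟨α, β⟩ := q
  obtain ⟨hα, hβ, hle⟩ := hq
  simp only at hα hβ hle ⊢
  refine lt_of_le_of_ne hα ?_
  rintro rfl
  rcases lt_or_eq_of_le (by linarith : β ≤ 1) with hlt | rfl
  · exact not_isLocalMaxOn_zero_left hβ hlt h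
  · exact not_isLocalMaxOn_zero_one h

lemma interior_of_isLocalMaxOn {q : ℝ × ℝ} (hq : q ∈ triangle)
    (h : IsLocalMaxOn (symmetricExponent k lam) triangle q) :
    0 < q.1 ∧ 0 < q.2 ∧ q.1 + q.2 < 1 := by
  have hα := fst_pos_of_isLocalMaxOn hq h
  have hβ := fst_pos_of_isLocalMaxOn (swap_mem_triangle hq) (isLocalMaxOn_swap h)
  exact ⟨hα, hβ, lt_of_le_of_ne hq.2.2 fun heq => not_isLocalMaxOn_of_add_eq_one hα hβ heq h⟩

lemma exponentSlope_eq_zero_iff (hlam : 0 < lam) {α β : ℝ} (hα : 0 < α) (hβ : 0 < β)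
    (h : α + β < 1) :
    exponentSlope k lam α β = 0 ↔ α * (1 - α) ^ k = lam * (1 - α - β) ^ (k + 1) := by
  have h₁ : 0 < 1 - α := by linarith
  have h₂ : 0 < 1 - α - β := by linarith
  have hleft : 0 < α * (1 - α) ^ k := by positivity
  have hright : 0 < lam * (1 - α - β) ^ (k + 1) := by positivity
  rw [← Real.log_injOn_pos.eq_iff (mem_Ioi.2 hleft) (mem_Ioi.2 hright),
    Real.log_mul hα.ne' (by positivity), Real.log_mul hlam.ne' (by positivity), Real.log_pow,
    Real.log_pow, exponentSlope]
  push_cast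
  constructor <;> intro h <;> linarith

lemma isDensityPair_iff_exponentSlope_eq_zero (hlam : 0 < lam) {α β : ℝ} (hα : 0 < α)
    (hβ : 0 < β) (h : α + β < 1) :
    IsDensityPair k lam α β ↔ exponentSlope k lam α β = 0 ∧ exponentSlope k lam β α = 0 := by
  rw [exponentSlope_eq_zero_iff hlam hα hβ h,
    exponentSlope_eq_zero_iff hlam hβ hα (by linarith), sub_right_comm 1 β α]
  exact ⟨fun hp => ⟨hp.eq_left, hp.eq_right⟩, fun hp => ⟨hα, hβ, h, hp.1, hp.2⟩⟩

lemma hasFDerivAt_symmetricExponent {q : ℝ × ℝ} (hα : 0 < q.1) (hβ : 0 < q.2)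
    (h : q.1 + q.2 < 1) :
    HasFDerivAt (symmetricExponent k lam)
      (exponentSlope k lam q.1 q.2 • ContinuousLinearMap.fst ℝ ℝ ℝ +
        exponentSlope k lam q.2 q.1 • ContinuousLinearMap.snd ℝ ℝ ℝ) q := by
  have hfst : HasFDerivAt Prod.fst (ContinuousLinearMap.fst ℝ ℝ ℝ) q := hasFDerivAt_fst
  have hsnd : HasFDerivAt Prod.snd (ContinuousLinearMap.snd ℝ ℝ ℝ) q := hasFDerivAt_snd
  have d₁ := (Real.hasDerivAt_negMulLog hα.ne').comp_hasFDerivAt q hfst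
  have d₂ := (Real.hasDerivAt_negMulLog hβ.ne').comp_hasFDerivAt q hsnd
  have d₃ := (Real.hasDerivAt_negMulLog (by linarith : 1 - q.1 ≠ 0)).comp_hasFDerivAt q
    (hfst.const_sub 1)
  have d₄ := (Real.hasDerivAt_negMulLog (by linarith : 1 - q.2 ≠ 0)).comp_hasFDerivAt q
    (hsnd.const_sub 1)
  have d₅ := (Real.hasDerivAt_negMulLog (by linarith : 1 - q.1 - q.2 ≠ 0)).comp_hasFDerivAt q
    ((hfst.const_sub 1).sub hsnd)
  refine ((((((hfst.add hsnd).mul_const (Real.log lam)).add d₁).add d₂).sub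
    ((d₃.add d₄).const_mul (k : ℝ))).add (d₅.const_mul (k + 1 : ℝ))).congr_fderiv ?_
  ext <;> simp [exponentSlope, sub_right_comm 1 q.2 q.1] <;> ring

lemma IsDensityPair.hasFDerivAt_zero (hlam : 0 < lam) {α β : ℝ} (h : IsDensityPair k lam α β) :
    HasFDerivAt (symmetricExponent k lam) (0 : ℝ × ℝ →L[ℝ] ℝ) (α, β) := by
  obtain ⟨hleft, hright⟩ := (isDensityPair_iff_exponentSlope_eq_zero hlam h.pos_left h.pos_right
    h.add_lt_one).1 h
  simpa [hleft, hright] using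
    hasFDerivAt_symmetricExponent (k := k) (lam := lam) (q := (α, β)) h.pos_left h.pos_right
      h.add_lt_one

lemma isDensityPair_of_isLocalMaxOn (hlam : 0 < lam) {q : ℝ × ℝ} (hq : q ∈ triangle)
    (h : IsLocalMaxOn (symmetricExponent k lam) triangle q) : IsDensityPair k lam q.1 q.2 := by
  obtain ⟨hα, hβ, hlt⟩ := interior_of_isLocalMaxOn hq h
  have hzero := (h.isLocalMax (triangle_mem_nhds hα hβ hlt)).hasFDerivAt_eq_zero
    (hasFDerivAt_symmetricExponent hα hβ hlt)
  refine (isDensityPair_iff_exponentSlope_eq_zero hlam hα hβ hlt).2 ⟨?_, ?_⟩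
  · simpa using DFunLike.congr_fun hzero (1, 0)
  · simpa using DFunLike.congr_fun hzero (0, 1)

lemma isDensityPair_of_isLocalMaxOn_diagonal (hlam : 0 < lam) {α : ℝ}
    (hα : (α, α) ∈ triangle)
    (h : IsLocalMaxOn (symmetricExponent k lam) (triangle ∩ {q | q.1 = q.2}) (α, α)) :
    IsDensityPair k lam α α := by
  have hpos : 0 < α := by
    refine lt_of_le_of_ne hα.1 ?_
    rintro rfl
    exact not_isLocalMaxOn_diagonal_zero h
  have hlt : α + α < 1 := by
    refine lt_of_le_of_ne hα.2.2 fun heq => ?_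
    obtain rfl : α = 1 / 2 := by linarith
    exact not_isLocalMaxOn_diagonal_one_half h
  have hcont : Tendsto (fun s : ℝ => (s, s)) (𝓝 α) (𝓝 (α, α)) :=
    (continuous_id.prodMk continuous_id).tendsto α
  have htendsto : Tendsto (fun s : ℝ => (s, s)) (𝓝 α) (𝓝[triangle ∩ {q | q.1 = q.2}] (α, α)) := by
    refine tendsto_nhdsWithin_iff.2 ⟨hcont, ?_⟩
    filter_upwards [hcont.eventually (triangle_mem_nhds hpos hpos hlt)] with s hs using ⟨hs, rfl⟩
  have hmax : IsLocalMax (fun s => symmetricExponent k lam (s, s)) α :=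
    IsMaxFilter.comp_tendsto (g := fun s : ℝ => (s, s)) (b := α) h htendsto
  have hderiv := HasFDerivAt.comp_hasDerivAt (f := fun s : ℝ => (s, s)) α
    (hasFDerivAt_symmetricExponent (k := k) (lam := lam) hpos hpos hlt)
    ((hasDerivAt_id α).prodMk (hasDerivAt_id α))
  have hzero : exponentSlope k lam α α + exponentSlope k lam α α = 0 := by
    simpa using hmax.hasDerivAt_eq_zero hderiv
  have hslope : exponentSlope k lam α α = 0 := by linarith
  exact (isDensityPair_iff_exponentSlope_eq_zero hlam hpos hpos hlt).2 ⟨hslope, hslope⟩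

lemma hasDerivAt_symmetricExponent_antidiagonal {p s : ℝ} (h₁ : 0 < p + s) (h₂ : 0 < p - s)
    (hp : p + p < 1) :
    HasDerivAt (fun s => symmetricExponent k lam (p + s, p - s))
      (exponentSlope k lam (p + s) (p - s) - exponentSlope k lam (p - s) (p + s)) s := by
  have hline : HasDerivAt (fun s : ℝ => (p + s, p - s)) (1, -1) s :=
    ((hasDerivAt_id s).const_add p).prodMk ((hasDerivAt_id s).const_sub p)
  have hlt : p + s + (p - s) < 1 := by linarith
  refine (HasFDerivAt.comp_hasDerivAt s (hasFDerivAt_symmetricExponent h₁ h₂ hlt)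
    hline).congr_deriv ?_
  simp [sub_eq_add_neg]

lemma hasDerivAt_exponentSlope_sub_antidiagonal {p : ℝ} (h₀ : p ≠ 0) (h₁ : 1 - p ≠ 0) :
    HasDerivAt (fun s => exponentSlope k lam (p + s) (p - s) -
      exponentSlope k lam (p - s) (p + s)) (2 * (k / (1 - p) - 1 / p)) 0 := by
  have hsub : (fun s => exponentSlope k lam (p + s) (p - s) -
      exponentSlope k lam (p - s) (p + s)) = fun s => Real.log (p - s) - Real.log (p + s) +
        k * (Real.log (1 - p + s) - Real.log (1 - p - s)) := by
    ext s
    simp only [exponentSlope]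
    ring_nf
  have hid := hasDerivAt_id (0 : ℝ)
  have d₁ := (hid.const_sub p).log (by simpa)
  have d₂ := (hid.const_add p).log (by simpa)
  have d₃ := (hid.const_add (1 - p)).log (by simpa)
  have d₄ := (hid.const_sub (1 - p)).log (by simpa)
  rw [hsub]
  refine ((d₁.sub d₂).add ((d₃.sub d₄).const_mul (k : ℝ))).congr_deriv ?_
  simp only [id, add_zero, sub_zero]
  ring

-- Under `hp` the exponent is strictly convex at `(p, p)` in the antidiagonal direction.
lemma IsDensityPair.not_isLocalMax {p : ℝ} (h : IsDensityPair k lam p p)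
    (hp : 1 - p < k * p) : ¬ IsLocalMax (symmetricExponent k lam) (p, p) := by
  intro hmax
  have hpos := h.pos_left
  have hlt := h.add_lt_one
  have hcont : Continuous fun s : ℝ => (p + s, p - s) := by fun_prop
  have hmax₀ : IsLocalMax (symmetricExponent k lam) (p + 0, p - 0) := by
    simpa only [add_zero, sub_zero] using hmax
  have hmaxline : IsLocalMax (fun s => symmetricExponent k lam (p + s, p - s)) 0 :=
    IsMaxFilter.comp_tendsto (g := fun s : ℝ => (p + s, p - s)) hmax₀ (hcont.tendsto 0)
  have hderiv : deriv (fun s => symmetricExponent k lam (p + s, p - s)) =ᶠ[𝓝 0] fun s =>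
      exponentSlope k lam (p + s) (p - s) - exponentSlope k lam (p - s) (p + s) := by
    filter_upwards [Ioo_mem_nhds (neg_lt_zero.2 hpos) hpos] with s hs
    exact (hasDerivAt_symmetricExponent_antidiagonal (by linarith [hs.1]) (by linarith [hs.2])
      hlt).deriv
  have hnonpos := deriv_deriv_nonpos_of_isLocalMax hmaxline
    (continuous_symmetricExponent.comp hcont).continuousAt
  rw [hderiv.deriv_eq,
    (hasDerivAt_exponentSlope_sub_antidiagonal hpos.ne' (by linarith)).deriv] at hnonpos
  have hgap : 1 / p < k / (1 - p) := by
    rw [div_lt_div_iff₀ hpos (by linarith)]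
    linarith
  linarith

end Exponent

section Maxima

variable {k m : ℕ} {lam : ℝ}

lemma maximaOn_congr {f g : ℝ × ℝ → ℝ} {s : Set (ℝ × ℝ)} (h : EqOn f g s) :
    maximaOn f s = maximaOn g s := by
  ext q
  refine and_congr_right fun hq => ?_
  simp only [isMaxOn_iff]
  exact forall₂_congr fun z hz => by rw [h hz, h hq]

lemma localMaximaOn_congr {f g : ℝ × ℝ → ℝ} {s : Set (ℝ × ℝ)} (h : EqOn f g s) :
    localMaximaOn f s = localMaximaOn g s := by
  ext q
  refine and_congr_right fun hq => eventually_congr ?_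
  filter_upwards [self_mem_nhdsWithin] with z hz
  rw [h hz, h hq]

lemma maximaOn_subset_localMaximaOn (f : ℝ × ℝ → ℝ) (s : Set (ℝ × ℝ)) :
    maximaOn f s ⊆ localMaximaOn f s :=
  fun _ hq => ⟨hq.1, hq.2.localize⟩

lemma maximaOn_nonempty {f : ℝ × ℝ → ℝ} {s : Set (ℝ × ℝ)} (hf : ContinuousOn f s)
    (hs : IsCompact s) (hne : s.Nonempty) : (maximaOn f s).Nonempty :=
  hs.exists_isMaxOn hne hf

lemma zero_mem_triangle : (0, 0) ∈ triangle := by simp [triangle]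

lemma swap_mem_maximaOn_symmetricExponent {q : ℝ × ℝ}
    (hq : q ∈ maximaOn (symmetricExponent k lam) triangle) :
    q.swap ∈ maximaOn (symmetricExponent k lam) triangle := by
  refine ⟨swap_mem_triangle hq.1, isMaxOn_iff.2 fun z hz => ?_⟩
  rw [symmetricExponent_swap]
  exact isMaxOn_iff.1 hq.2 z hz

lemma maximaOn_Phi1_diagonal (k : ℕ) (hlam : 0 < lam) :
    maximaOn (Phi1 (k + 1) lam) (triangle ∩ {q | q.1 = q.2}) =
      {(symmetricDensity k lam, symmetricDensity k lam)} := by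
  rw [maximaOn_congr (eqOn_Phi1_symmetricExponent.mono inter_subset_left)]
  refine (Set.Nonempty.subset_singleton_iff ?_).1 ?_
  · exact maximaOn_nonempty continuous_symmetricExponent.continuousOn
      (isCompact_triangle.inter_right (isClosed_eq continuous_fst continuous_snd))
      ⟨(0, 0), zero_mem_triangle, rfl⟩
  · rintro ⟨α, β⟩ ⟨⟨hα, rfl : α = β⟩, hmax⟩
    rw [mem_singleton_iff,
      (isDensityPair_of_isLocalMaxOn_diagonal hlam hα hmax.localize).eq_symmetricDensity]

lemma maximaOn_localMaximaOn_Phi1_of_le (hlam : 0 < lam) (hc : lam ≤ criticalActivity (m + 3)) :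
    maximaOn (Phi1 (m + 3) lam) triangle =
        {(symmetricDensity (m + 2) lam, symmetricDensity (m + 2) lam)} ∧
      localMaximaOn (Phi1 (m + 3) lam) triangle =
        {(symmetricDensity (m + 2) lam, symmetricDensity (m + 2) lam)} := by
  rw [maximaOn_congr (eqOn_Phi1_symmetricExponent (k := m + 2)),
    localMaximaOn_congr (eqOn_Phi1_symmetricExponent (k := m + 2))]
  have hne : (maximaOn (symmetricExponent (m + 2) lam) triangle).Nonempty :=
    maximaOn_nonempty continuous_symmetricExponent.continuousOn isCompact_triangle
      ⟨_, zero_mem_triangle⟩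
  have hlocal : localMaximaOn (symmetricExponent (m + 2) lam) triangle ⊆
      {(symmetricDensity (m + 2) lam, symmetricDensity (m + 2) lam)} := by
    intro q hq
    obtain ⟨hα, hβ⟩ := (isDensityPair_of_isLocalMaxOn hlam hq.1 hq.2).eq_of_le hc
    exact Prod.ext hα hβ
  have hmax := maximaOn_subset_localMaximaOn (symmetricExponent (m + 2) lam) triangle
  exact ⟨hne.subset_singleton_iff.1 (hmax.trans hlocal),
    (hne.mono hmax).subset_singleton_iff.1 hlocal⟩

lemma not_isLocalMax_symmetricDensity (hc : criticalActivity (m + 3) < lam) :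
    ¬ IsLocalMax (symmetricExponent (m + 2) lam)
      (symmetricDensity (m + 2) lam, symmetricDensity (m + 2) lam) := by
  have hlam := (criticalActivity_pos m).trans hc
  refine (isDensityPair_symmetricDensity (m + 2) hlam).not_isLocalMax ?_
  have hratio := symmetricRatio_pos (m + 2) hlam
  have hlarge := one_div_lt_symmetricRatio m hc
  rw [div_lt_iff₀ (by positivity)] at hlarge
  rw [symmetricDensity, one_sub_div (by positivity), ← mul_div_assoc,
    div_lt_div_iff_of_pos_right (by positivity)]
  push_cast
  linarith

lemma localMaximaOn_symmetricExponent_subset (hc : criticalActivity (m + 3) < lam) :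
    localMaximaOn (symmetricExponent (m + 2) lam) triangle ⊆
      {(smallDensity m lam, largeDensity m lam), (largeDensity m lam, smallDensity m lam)} := by
  rintro ⟨α, β⟩ ⟨hmem, hmax⟩
  have hpair := isDensityPair_of_isLocalMaxOn ((criticalActivity_pos m).trans hc) hmem hmax
  rcases hpair.eq_or with ⟨rfl : α = β, rfl : α = _⟩ | ⟨hα, hβ⟩ | ⟨hα, hβ⟩
  · exact absurd
      (hmax.isLocalMax (triangle_mem_nhds hpair.pos_left hpair.pos_right hpair.add_lt_one))
      (not_isLocalMax_symmetricDensity hc)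
  · exact Or.inl (Prod.ext hα hβ)
  · exact Or.inr (Prod.ext hα hβ)

lemma maximaOn_localMaximaOn_Phi1_of_lt (hc : criticalActivity (m + 3) < lam) :
    maximaOn (Phi1 (m + 3) lam) triangle =
        {(smallDensity m lam, largeDensity m lam), (largeDensity m lam, smallDensity m lam)} ∧
      localMaximaOn (Phi1 (m + 3) lam) triangle =
        {(smallDensity m lam, largeDensity m lam), (largeDensity m lam, smallDensity m lam)} := by
  rw [maximaOn_congr (eqOn_Phi1_symmetricExponent (k := m + 2)),
    localMaximaOn_congr (eqOn_Phi1_symmetricExponent (k := m + 2))]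
  have hlocal := localMaximaOn_symmetricExponent_subset hc
  have hmax := maximaOn_subset_localMaximaOn (symmetricExponent (m + 2) lam) triangle
  have hattained : {(smallDensity m lam, largeDensity m lam),
      (largeDensity m lam, smallDensity m lam)} ⊆
        maximaOn (symmetricExponent (m + 2) lam) triangle := by
    obtain ⟨q, hq⟩ := maximaOn_nonempty (continuous_symmetricExponent (k := m + 2)
      (lam := lam)).continuousOn isCompact_triangle ⟨_, zero_mem_triangle⟩
    have hswap := swap_mem_maximaOn_symmetricExponent hq
    rcases hlocal (hmax hq) with rfl | rfl
    · exact insert_subset hq (singleton_subset_iff.2 hswap)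
    · exact insert_subset hswap (singleton_subset_iff.2 hq)
  exact ⟨(hmax.trans hlocal).antisymm hattained, hlocal.antisymm (hattained.trans hmax)⟩

lemma not_isLocalMin_Phi1_symmetricDensity (k : ℕ) (hlam : 0 < lam) :
    ¬ IsLocalMin (Phi1 (k + 1) lam) (symmetricDensity k lam, symmetricDensity k lam) := by
  intro hmin
  have hpair := isDensityPair_symmetricDensity k hlam
  have hdiagonal := maximaOn_Phi1_diagonal k hlam
  set p := symmetricDensity k lam
  have hmax : (p, p) ∈ maximaOn (Phi1 (k + 1) lam) (triangle ∩ {q | q.1 = q.2}) :=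
    hdiagonal ▸ mem_singleton _
  have hcont : Tendsto (fun s : ℝ => (s, s)) (𝓝 p) (𝓝 (p, p)) :=
    (continuous_id.prodMk continuous_id).tendsto p
  have hnear := (hcont.eventually hmin).and (hcont.eventually
    (triangle_mem_nhds (q := (p, p)) hpair.pos_left hpair.pos_right hpair.add_lt_one))
  obtain ⟨s, ⟨hle, hmem⟩, hne⟩ :=
    ((hnear.filter_mono nhdsWithin_le_nhds).and (self_mem_nhdsWithin (s := {p}ᶜ))).exists
  have hmax' : (s, s) ∈ maximaOn (Phi1 (k + 1) lam) (triangle ∩ {q | q.1 = q.2}) :=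
    ⟨⟨hmem, rfl⟩, isMaxOn_iff.2 fun z hz => (isMaxOn_iff.1 hmax.2 z hz).trans hle⟩
  rw [hdiagonal] at hmax'
  exact hne (congrArg Prod.fst hmax')

lemma isSaddle_Phi1_symmetricDensity (hc : criticalActivity (m + 3) < lam) :
    IsSaddle (Phi1 (m + 3) lam) (symmetricDensity (m + 2) lam, symmetricDensity (m + 2) lam) := by
  have hlam := (criticalActivity_pos m).trans hc
  have hpair := isDensityPair_symmetricDensity (m + 2) hlam
  have heq : Phi1 (m + 3) lam =ᶠ[𝓝 (symmetricDensity (m + 2) lam, symmetricDensity (m + 2) lam)]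
      symmetricExponent (m + 2) lam :=
    eqOn_Phi1_symmetricExponent.eventuallyEq_of_mem
      (triangle_mem_nhds hpair.pos_left hpair.pos_right hpair.add_lt_one)
  refine ⟨(hpair.hasFDerivAt_zero hlam).congr_of_eventuallyEq heq, ?_,
    not_isLocalMin_Phi1_symmetricDensity (m + 2) hlam⟩
  rw [heq.isLocalMax_iff]
  exact not_isLocalMax_symmetricDensity hc

end Maxima

/-! ### Simple Gibbs measures and density pairs -/

section GibbsMeasures

variable {V : Type*} {G : SimpleGraph V} {k : ℕ} {lam α β : ℝ} {o : V} {μ : Measure (Set V)}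

open Classical in
/-- The vertex labelling with value `α` at even and `β` at odd vertices. -/
noncomputable def alternating (G : SimpleGraph V) (o : V) (α β : ℝ) (v : V) : ℝ :=
  if IsEvenVertex G o v then α else β

/-- `μ` is a simple Gibbs measure under which even vertices are occupied with probability `α` and
odd vertices with probability `β`. -/
structure IsSimpleGibbsWithDensities (G : SimpleGraph V) (lam : ℝ) (o : V) (α β : ℝ)
    (μ : Measure (Set V)) : Prop where
  isGibbs : IsGibbs G lam μ
  isSimpleMeasure : IsSimpleMeasure G μ
  real_mem (v : V) : μ.real {I | v ∈ I} = alternating G o α β v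

lemma alternating_of_isEvenVertex {v : V} (hv : IsEvenVertex G o v) :
    alternating G o α β v = α :=
  if_pos hv

lemma alternating_of_not_isEvenVertex {v : V} (hv : ¬ IsEvenVertex G o v) :
    alternating G o α β v = β :=
  if_neg hv

lemma alternating_self (v : V) : alternating G o α α v = α :=
  ite_self α

lemma alternating_congr {v w : V} (h : IsEvenVertex G o v ↔ IsEvenVertex G o w) :
    alternating G o α β v = alternating G o α β w := by
  by_cases hv : IsEvenVertex G o v
  · rw [alternating_of_isEvenVertex hv, alternating_of_isEvenVertex (h.1 hv)]
  · rw [alternating_of_not_isEvenVertex hv, alternating_of_not_isEvenVertex (mt h.2 hv)]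

lemma alternating_of_adj (hG : G.IsTree) {v w : V} (h : G.Adj v w) :
    alternating G o α β w = alternating G o β α v := by
  have hvw := isEvenVertex_iff_not_of_adj hG o h
  by_cases hw : IsEvenVertex G o w
  · rw [alternating_of_isEvenVertex hw, alternating_of_not_isEvenVertex fun hv => hvw.1 hv hw]
  · rw [alternating_of_not_isEvenVertex hw, alternating_of_isEvenVertex (hvw.2 hw)]

lemma IsDensityPair.alternating (h : IsDensityPair k lam α β) (o v : V) :
    IsDensityPair k lam (alternating G o α β v) (alternating G o β α v) := by
  by_cases hv : IsEvenVertex G o v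
  · simpa only [alternating_of_isEvenVertex hv] using h
  · simpa only [alternating_of_not_isEvenVertex hv] using h.symm

lemma eq_mul_one_sub_div_pow_iff (hα : α < 1) :
    α = lam * (1 - α) * (1 - β / (1 - α)) ^ (k + 1) ↔
      α * (1 - α) ^ k = lam * (1 - α - β) ^ (k + 1) := by
  have hne : 1 - α ≠ 0 := by linarith
  rw [one_sub_div hne, div_pow, ← mul_div_assoc, eq_div_iff (pow_ne_zero _ hne), pow_succ,
    mul_right_comm lam, ← mul_assoc, mul_left_inj' hne]

lemma exists_adj_of_isRegularOfDegree_succ [G.LocallyFinite]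
    (hreg : G.IsRegularOfDegree (k + 1)) (v : V) : ∃ w, G.Adj v w := by
  rw [← G.degree_pos_iff_exists_adj, hreg.degree_eq]
  exact k.succ_pos

lemma exists_isSimpleGibbsWithDensities [G.LocallyFinite] (hG : G.IsTree)
    (hreg : G.IsRegularOfDegree (k + 1)) (o : V) (h : IsDensityPair k lam α β) :
    ∃ μ, IsSimpleGibbsWithDensities G lam o α β μ := by
  let A : V → ℝ := alternating G o α β
  let B : V → ℝ := alternating G o β α
  have hpair (v : V) : IsDensityPair k lam (A v) (B v) := h.alternating o v
  have hlt (v : V) : A v < 1 := by linarith [(hpair v).add_lt_one, (hpair v).pos_right]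
  have hB (v : V) : 0 < 1 - B v := by linarith [(hpair v).add_lt_one, (hpair v).pos_left]
  have hratio (v : V) : A v / (1 - B v) < 1 := by
    rw [div_lt_one (hB v)]
    linarith [(hpair v).add_lt_one]
  let a : V → unitInterval := fun v => ⟨A v, (hpair v).pos_left.le, (hlt v).le⟩
  let q : V → unitInterval := fun v =>
    ⟨A v / (1 - B v), div_nonneg (hpair v).pos_left.le (hB v).le, (hratio v).le⟩
  have hq (v w : V) (hvw : G.Adj v w) : (q w : ℝ) * (1 - a v) = a w := by
    have hAB : A v = B w := alternating_of_adj hG hvw.symm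
    simp only [q, a, hAB, div_mul_cancel₀ _ (hB w).ne']
  have hactivity (v : V) :
      (a v : ℝ) = lam * (1 - a v) * ∏ u ∈ G.neighborFinset v, (1 - (q u : ℝ)) := by
    have hneighbor : ∀ u ∈ G.neighborFinset v, (1 - (q u : ℝ)) = 1 - B v / (1 - A v) := by
      intro u hu
      have hvu := (G.mem_neighborFinset v u).1 hu
      have hA : A u = B v := alternating_of_adj hG hvu
      have hB : B u = A v := alternating_of_adj hG hvu
      simp only [q, hA, hB]
    rw [Finset.prod_congr rfl hneighbor, Finset.prod_const,
      SimpleGraph.card_neighborFinset_eq_degree, hreg.degree_eq]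
    exact (eq_mul_one_sub_div_pow_iff (hlt v)).2 (hpair v).eq_left
  exact ⟨treeMeasure G a q o, isGibbs_treeMeasure hG hq hlt hratio hactivity o,
    isSimpleMeasure_treeMeasure hG hq (fun v => (hpair v).pos_left) hlt o,
    treeMeasure_real_mem hG hq o⟩

lemma IsGibbs.mul_one_sub_pow_eq [G.LocallyFinite] [Countable V]
    (hreg : G.IsRegularOfDegree (k + 1)) (hlam : 0 < lam) (hμ : IsGibbs G lam μ)
    (hs : IsSimpleMeasure G μ) {v : V} (hβ : ∀ u, G.Adj v u → μ.real {I | u ∈ I} = β) :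
    μ.real {I | v ∈ I} * (1 - μ.real {I | v ∈ I}) ^ k =
      lam * (1 - μ.real {I | v ∈ I} - β) ^ (k + 1) := by
  rw [← eq_mul_one_sub_div_pow_iff (hμ.real_mem_lt_one hlam v)]
  conv_lhs => rw [hμ.real_mem_eq_mul_prod hlam hs v]
  rw [Finset.prod_congr rfl fun u hu => by rw [hβ u ((G.mem_neighborFinset v u).1 hu)],
    Finset.prod_const, SimpleGraph.card_neighborFinset_eq_degree, hreg.degree_eq]

namespace IsSimpleGibbsWithDensities

lemma real_mem_of_isEvenVertex (h : IsSimpleGibbsWithDensities G lam o α β μ) {v : V}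
    (hv : IsEvenVertex G o v) : μ.real {I | v ∈ I} = α := by
  rw [h.real_mem, alternating_of_isEvenVertex hv]

lemma real_mem_of_not_isEvenVertex (h : IsSimpleGibbsWithDensities G lam o α β μ) {v : V}
    (hv : ¬ IsEvenVertex G o v) : μ.real {I | v ∈ I} = β := by
  rw [h.real_mem, alternating_of_not_isEvenVertex hv]

variable [G.LocallyFinite] (hG : G.IsTree) (hlam : 0 < lam)
include hG hlam

lemma isDensityPair (hreg : G.IsRegularOfDegree (k + 1))
    (h : IsSimpleGibbsWithDensities G lam o α β μ) : IsDensityPair k lam α β := by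
  have := countable_of_connected_of_locallyFinite hG.connected
  obtain ⟨w, hw⟩ := exists_adj_of_isRegularOfDegree_succ hreg o
  have ho := isEvenVertex_self (G := G) o
  have hw' := (isEvenVertex_iff_not_of_adj hG o hw).1 ho
  have hpos := h.isGibbs.real_mem_pos hlam
  have hlt := h.isGibbs.real_mem_add_real_mem_lt_one hlam hw
  have heq {v : V} := h.isGibbs.mul_one_sub_pow_eq hreg hlam h.isSimpleMeasure (v := v)
    fun u hu => (h.real_mem u).trans (alternating_of_adj hG hu)
  have hleft := heq (v := o)
  have hright := heq (v := w)
  rw [h.real_mem_of_isEvenVertex ho, alternating_of_isEvenVertex ho] at hleft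
  rw [h.real_mem_of_not_isEvenVertex hw', alternating_of_not_isEvenVertex hw',
    sub_right_comm] at hright
  rw [h.real_mem_of_isEvenVertex ho, h.real_mem_of_not_isEvenVertex hw'] at hlt
  exact ⟨h.real_mem_of_isEvenVertex ho ▸ hpos o, h.real_mem_of_not_isEvenVertex hw' ▸ hpos w, hlt,
    hleft, hright⟩

lemma eq {ν : Measure (Set V)} (hμ : IsSimpleGibbsWithDensities G lam o α β μ)
    (hν : IsSimpleGibbsWithDensities G lam o α β ν) : μ = ν := by
  have := countable_of_connected_of_locallyFinite hG.connected
  have := hμ.isGibbs.isProbabilityMeasure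
  have := hν.isGibbs.isProbabilityMeasure
  exact IsSimpleMeasure.ext hG hμ.isGibbs.ae_isIndepSet hν.isGibbs.ae_isIndepSet
    hμ.isSimpleMeasure hν.isSimpleMeasure (fun v => (hμ.real_mem v).trans (hν.real_mem v).symm)
    (hμ.isGibbs.real_mem_lt_one hlam)

lemma map_iso_eq (h : IsSimpleGibbsWithDensities G lam o α β μ) (φ : G ≃g G)
    (hφ : ∀ v, alternating G o α β (φ v) = alternating G o α β v) :
    μ.map (fun I => φ '' I) = μ := by
  have := countable_of_connected_of_locallyFinite hG.connected
  have := h.isGibbs.isProbabilityMeasure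
  refine h.isSimpleMeasure.map_iso_eq hG h.isGibbs.ae_isIndepSet
    (h.isGibbs.real_mem_lt_one hlam) φ fun v => ?_
  rw [h.real_mem, h.real_mem, hφ]

lemma isSemiTranslationInvariant (h : IsSimpleGibbsWithDensities G lam o α β μ) :
    IsSemiTranslationInvariant G o μ :=
  fun φ hφ => h.map_iso_eq hG hlam φ fun v => alternating_congr (hφ v)

lemma isTranslationInvariant_iff (hreg : G.IsRegularOfDegree (k + 1))
    (h : IsSimpleGibbsWithDensities G lam o α β μ) : IsTranslationInvariant G μ ↔ α = β := by
  constructor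
  · intro hμ
    obtain ⟨w, hw⟩ := exists_adj_of_isRegularOfDegree_succ hreg o
    have ho := isEvenVertex_self (G := G) o
    rw [← h.real_mem_of_isEvenVertex ho,
      ← h.real_mem_of_not_isEvenVertex ((isEvenVertex_iff_not_of_adj hG o hw).1 ho)]
    exact hμ.real_mem_eq hG hreg o w
  · rintro rfl φ
    exact h.map_iso_eq hG hlam φ fun v => by rw [alternating_self, alternating_self]

end IsSimpleGibbsWithDensities

lemma IsSemiTranslationInvariant.exists_densities [G.LocallyFinite] (hG : G.IsTree)
    (hreg : G.IsRegularOfDegree (k + 1)) (hμ : IsGibbs G lam μ) (hs : IsSimpleMeasure G μ)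
    (h : IsSemiTranslationInvariant G o μ) :
    ∃ α β, IsSimpleGibbsWithDensities G lam o α β μ := by
  obtain ⟨w, hw⟩ := exists_adj_of_isRegularOfDegree_succ hreg o
  have ho := isEvenVertex_self (G := G) o
  have hw' := (isEvenVertex_iff_not_of_adj hG o hw).1 ho
  refine ⟨μ.real {I | o ∈ I}, μ.real {I | w ∈ I}, hμ, hs, fun v => ?_⟩
  by_cases hv : IsEvenVertex G o v
  · rw [alternating_of_isEvenVertex hv, h.real_mem_eq hG hreg (iff_of_true hv ho)]
  · rw [alternating_of_not_isEvenVertex hv, h.real_mem_eq hG hreg (iff_of_false hv hw')]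

lemma exists_eq_singleton_isTranslationInvariant [G.LocallyFinite] (hG : G.IsTree)
    (hreg : G.IsRegularOfDegree (k + 1)) (hlam : 0 < lam) :
    ∃ μ : Measure (Set V),
      {ν | IsGibbs G lam ν ∧ IsSimpleMeasure G ν ∧ IsTranslationInvariant G ν} = {μ} ∧
        ∀ v : V, μ.real {I | v ∈ I} = symmetricDensity k lam := by
  obtain ⟨o⟩ := hG.connected.nonempty
  obtain ⟨μ, hμ⟩ := exists_isSimpleGibbsWithDensities hG hreg o
    (isDensityPair_symmetricDensity k hlam)
  refine ⟨μ, Subset.antisymm ?_ ?_, fun v => (hμ.real_mem v).trans (alternating_self v)⟩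
  · rintro ν ⟨hgibbs, hsimple, hinv⟩
    have hsemi : IsSemiTranslationInvariant G o ν := fun φ _ => hinv φ
    obtain ⟨α, β, hν⟩ := hsemi.exists_densities hG hreg hgibbs hsimple
    obtain rfl := (hν.isTranslationInvariant_iff hG hlam hreg).1 hinv
    obtain rfl := (hν.isDensityPair hG hlam hreg).eq_symmetricDensity
    exact hν.eq hG hlam hμ
  · rintro _ rfl
    exact ⟨hμ.isGibbs, hμ.isSimpleMeasure, (hμ.isTranslationInvariant_iff hG hlam hreg).2 rfl⟩

lemma exists_eq_pair_isSemiTranslationInvariant [G.LocallyFinite] {m : ℕ} (hG : G.IsTree)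
    (hreg : G.IsRegularOfDegree (m + 3)) (hc : criticalActivity (m + 3) < lam) (o : V) :
    ∃ μ₁ μ₂ : Measure (Set V),
      {ν | IsGibbs G lam ν ∧ IsSimpleMeasure G ν ∧ IsSemiTranslationInvariant G o ν ∧
        ¬ IsTranslationInvariant G ν} = {μ₁, μ₂} ∧
      IsSimpleGibbsWithDensities G lam o (smallDensity m lam) (largeDensity m lam) μ₁ ∧
      IsSimpleGibbsWithDensities G lam o (largeDensity m lam) (smallDensity m lam) μ₂ := by
  have hlam := (criticalActivity_pos m).trans hc
  have hpair := isDensityPair_smallDensity_largeDensity m hc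
  have hne := ((smallDensity_lt_symmetricDensity m hc).trans
    (symmetricDensity_lt_largeDensity m hc)).ne
  obtain ⟨μ₁, h₁⟩ := exists_isSimpleGibbsWithDensities hG hreg o hpair
  obtain ⟨μ₂, h₂⟩ := exists_isSimpleGibbsWithDensities hG hreg o hpair.symm
  refine ⟨μ₁, μ₂, Subset.antisymm ?_ ?_, h₁, h₂⟩
  · rintro ν ⟨hgibbs, hsimple, hsemi, hinv⟩
    obtain ⟨α, β, hν⟩ := hsemi.exists_densities hG hreg hgibbs hsimple
    rw [hν.isTranslationInvariant_iff hG hlam hreg] at hinv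
    rcases (hν.isDensityPair hG hlam hreg).eq_or with ⟨heq, -⟩ | ⟨rfl, rfl⟩ | ⟨rfl, rfl⟩
    · exact absurd heq hinv
    · exact Or.inl (hν.eq hG hlam h₁)
    · exact Or.inr (hν.eq hG hlam h₂)
  · rintro ν (rfl | rfl)
    · exact ⟨h₁.isGibbs, h₁.isSimpleMeasure, h₁.isSemiTranslationInvariant hG hlam,
        fun hinv => hne ((h₁.isTranslationInvariant_iff hG hlam hreg).1 hinv)⟩
    · exact ⟨h₂.isGibbs, h₂.isSimpleMeasure, h₂.isSemiTranslationInvariant hG hlam,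
        fun hinv => hne.symm ((h₂.isTranslationInvariant_iff hG hlam hreg).1 hinv)⟩

end GibbsMeasures

theorem mainTheorem6 {V : Type*} (d : ℕ) (hd : 3 ≤ d)
    (G : SimpleGraph V) [G.LocallyFinite] (hG : G.IsTree) (hreg : G.IsRegularOfDegree d) (o : V) :
    ∃ pstar p₁ p₂ : ℝ → ℝ,
      -- `pstar` is the density of the unique simple translation-invariant Gibbs measure,
      -- and it gives the maximum on the diagonal
      (∀ lam : ℝ, 0 < lam →
        (∃ μ : Measure (Set V),
          {ν | IsGibbs G lam ν ∧ IsSimpleMeasure G ν ∧ IsTranslationInvariant G ν} = {μ} ∧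
          ∀ v : V, μ.real {I | v ∈ I} = pstar lam) ∧
        maximaOn (Phi1 d lam) (triangle ∩ {q | q.1 = q.2}) = {(pstar lam, pstar lam)}) ∧
      -- the regime `lam ≤ λ_c`
      (∀ lam : ℝ, 0 < lam → lam ≤ criticalActivity d →
        maximaOn (Phi1 d lam) triangle = {(pstar lam, pstar lam)} ∧
        localMaximaOn (Phi1 d lam) triangle = {(pstar lam, pstar lam)}) ∧
      -- the regime `lam > λ_c`
      (∀ lam : ℝ, criticalActivity d < lam →
        IsSaddle (Phi1 d lam) (pstar lam, pstar lam) ∧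
        p₁ lam < pstar lam ∧ pstar lam < p₂ lam ∧
        maximaOn (Phi1 d lam) triangle = {(p₁ lam, p₂ lam), (p₂ lam, p₁ lam)} ∧
        localMaximaOn (Phi1 d lam) triangle = {(p₁ lam, p₂ lam), (p₂ lam, p₁ lam)} ∧
        ∃ μ₁ μ₂ : Measure (Set V),
          {ν | IsGibbs G lam ν ∧ IsSimpleMeasure G ν ∧ IsSemiTranslationInvariant G o ν ∧
            ¬ IsTranslationInvariant G ν} = {μ₁, μ₂} ∧
          (∀ v : V, IsEvenVertex G o v →
            μ₁.real {I | v ∈ I} = p₁ lam ∧ μ₂.real {I | v ∈ I} = p₂ lam) ∧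
          (∀ v : V, ¬ IsEvenVertex G o v →
            μ₁.real {I | v ∈ I} = p₂ lam ∧ μ₂.real {I | v ∈ I} = p₁ lam)) ∧
      -- continuity in the activity
      ContinuousOn pstar (Ioi 0) ∧
      ContinuousOn p₁ (Ioi (criticalActivity d)) ∧
      ContinuousOn p₂ (Ioi (criticalActivity d)) ∧
      Tendsto (fun lam => p₁ lam - pstar lam) (𝓝[>] criticalActivity d) (𝓝 0) ∧
      Tendsto (fun lam => p₂ lam - pstar lam) (𝓝[>] criticalActivity d) (𝓝 0) := by
  obtain ⟨m, rfl⟩ := Nat.exists_eq_add_of_le' hd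
  obtain ⟨hsmall, hlarge⟩ := continuousOn_smallDensity_and_largeDensity m
  refine ⟨symmetricDensity (m + 2), smallDensity m, largeDensity m,
    fun lam hlam => ⟨exists_eq_singleton_isTranslationInvariant hG hreg hlam,
      maximaOn_Phi1_diagonal (m + 2) hlam⟩,
    fun lam hlam hc => maximaOn_localMaximaOn_Phi1_of_le hlam hc, fun lam hc => ?_,
    (continuousOn_symmetricDensity _).mono Ioi_subset_Ici_self,
    hsmall.mono Ioi_subset_Ici_self, hlarge.mono Ioi_subset_Ici_self,
    tendsto_sub_symmetricDensity hsmall (smallDensity_criticalActivity m),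
    tendsto_sub_symmetricDensity hlarge (largeDensity_criticalActivity m)⟩
  obtain ⟨hmax, hlocal⟩ := maximaOn_localMaximaOn_Phi1_of_lt hc
  obtain ⟨μ₁, μ₂, hset, h₁, h₂⟩ := exists_eq_pair_isSemiTranslationInvariant hG hreg hc o
  exact ⟨isSaddle_Phi1_symmetricDensity hc, smallDensity_lt_symmetricDensity m hc,
    symmetricDensity_lt_largeDensity m hc, hmax, hlocal, μ₁, μ₂, hset,
    fun v hv => ⟨h₁.real_mem_of_isEvenVertex hv, h₂.real_mem_of_isEvenVertex hv⟩,
    fun v hv => ⟨h₁.real_mem_of_not_isEvenVertex hv, h₂.real_mem_of_not_isEvenVertex hv⟩⟩
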